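/- Let $X$ be a compact connected Riemann surface, and fix a volume form $\omega_X$ on $X$ with $\int_X\omega_X=1$. Let $\mathcal{E}$ be a holomorphic vector bundle on $X$ of positive rank. For a holomorphic vector bundle $\mathcal{F}$ of positive rank, write $\deg\mathcal{F}=\int_X c_1(\det\mathcal{F})$ and $\mu(\mathcal{F})=\deg\mathcal{F}/\operatorname{rk}\mathcal{F}$. Suppose that $\mathcal{E}$ admits a Hermitian–Einstein metric, that is, a (smooth) Hermitian metric $H$ whose Chern connection $\nabla_H$ (the unique $H$-unitary connection with $\nabla_H^{0,1}=\bar\partial_{\mathcal{E}}$) has curvature $$F_H=-2\pi i\,\mu(\mathcal{E})\,\mathrm{id}_{\mathcal{E}}\,\omega_X .$$ Then $\mathcal{E}$ is polystable: it is either stable or a direct sum of finitely many stable holomorphic vector bundles, each of slope equal to $\mu(\mathcal{E})$. Here a holomorphic vector bundle $\mathcal{F}\neq 0$ is stable if $\mu(\mathcal{F}')<\mu(\mathcal{F})$ for every holomorphic subbundle $\mathcal{F}'\subset\mathcal{F}$ with $0<\operatorname{rk}\mathcal{F}'<\operatorname{rk}\mathcal{F}$. -/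

import Mathlib

open Bundle Set
open scoped Manifold ContDiff Topology

noncomputable section

namespace RiemannSurface

/-! ### Differential forms on a Riemann surface

A Riemann surface is a Hausdorff space `X` charted on `ℂ` with holomorphic coordinate changes,
`IsManifold 𝓘(ℂ) ω X`.  Its underlying real surface uses the same charts with the real model
`𝓘(ℝ, ℂ)`; the real tangent space `TangentSpace 𝓘(ℝ, ℂ) x` is `ℂ`, through the preferred chart
at `x`. -/

section Forms

variable {X : Type*} [TopologicalSpace X] [ChartedSpace ℂ X]

/-- The real surface underlying a Riemann surface is smooth. -/
theorem isManifold_real [IsManifold 𝓘(ℂ) ω X] : IsManifold 𝓘(ℝ, ℂ) ∞ X := by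
  refine isManifold_of_contDiffOn 𝓘(ℝ, ℂ) ∞ X fun e e' he he' => ?_
  have h := (contDiffGroupoid ω 𝓘(ℂ)).compatible he he'
  rw [contDiffGroupoid, mem_groupoid_of_pregroupoid] at h
  exact (h.1.restrict_scalars ℝ).of_le le_top

variable (X) in
/-- Complex-valued differential forms of degree `n` (no regularity imposed). -/
abbrev DForm (n : ℕ) : Type _ :=
  ∀ x : X, TangentSpace 𝓘(ℝ, ℂ) x [⋀^Fin n]→L[ℝ] ℂ

/-- The expression of a form in the preferred chart at `p`: its pullback by the inverse chart. -/
def DForm.inChart {n : ℕ} (α : DForm X n) (p : X) (z : ℂ) : ℂ [⋀^Fin n]→L[ℝ] ℂ :=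
  (α ((chartAt ℂ p).symm z)).compContinuousLinearMap
    (mfderiv 𝓘(ℝ, ℂ) 𝓘(ℝ, ℂ) (chartAt ℂ p).symm z)

/-- Smoothness of a form on an open set `U`: its expressions in charts are smooth. -/
def DForm.SmoothOn {n : ℕ} (α : DForm X n) (U : Set X) : Prop :=
  ∀ p : X, ContDiffOn ℝ ∞ (α.inChart p) ((chartAt ℂ p).target ∩ (chartAt ℂ p).symm ⁻¹' U)

/-- The exterior derivative, computed in the preferred chart at the point considered. -/
def DForm.d {n : ℕ} (α : DForm X n) : DForm X (n + 1) := fun x =>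
  (extDeriv (α.inChart x) (chartAt ℂ x x)).compContinuousLinearMap
    (mfderiv 𝓘(ℝ, ℂ) 𝓘(ℝ, ℂ) (chartAt ℂ x) x)

/-- The integral over a compact Riemann surface of a `2`-form, for the orientation given by the
complex structure: the sum over a smooth partition of unity subordinate to the charts of the
integrals of the coefficients of `dx ∧ dy`. -/
def integral [IsManifold 𝓘(ℂ) ω X] [T2Space X] [CompactSpace X] (α : DForm X 2) : ℂ :=
  haveI : IsManifold 𝓘(ℝ, ℂ) ∞ X := isManifold_real
  let ρ := Classical.choose
    (SmoothPartitionOfUnity.exists_isSubordinate_chartAt_source 𝓘(ℝ, ℂ) X)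
  ∑ᶠ p : X, ∫ z in (chartAt ℂ p).target,
    (ρ p ((chartAt ℂ p).symm z) : ℂ) * α.inChart p z ![1, Complex.I]

/-- A volume form of total mass one: a smooth, real-valued, nowhere vanishing `2`-form whose
integral is `1`. -/
structure IsUnitVolumeForm [IsManifold 𝓘(ℂ) ω X] [T2Space X] [CompactSpace X]
    (vol : DForm X 2) : Prop where
  smooth : vol.SmoothOn univ
  real : ∀ x v, (vol x v).im = 0
  ne_zero : ∀ x, vol x ≠ 0
  integral_eq_one : integral vol = 1

/-- The almost complex structure: multiplication by `i` on the real tangent space. -/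
def mulI {x : X} (v : TangentSpace 𝓘(ℝ, ℂ) x) : TangentSpace 𝓘(ℝ, ℂ) x :=
  show ℂ from Complex.I * (show ℂ from v)

/-- The coordinate vector field, on the domain of the preferred chart at `p`, that is constant
in this chart with value `v`.  Any two of these commute. -/
def coordField (p : X) (v : TangentSpace 𝓘(ℝ, ℂ) p) (y : X) : TangentSpace 𝓘(ℝ, ℂ) y :=
  show ℂ from mfderiv 𝓘(ℝ, ℂ) 𝓘(ℝ, ℂ) (chartAt ℂ p).symm (chartAt ℂ p y) (show ℂ from v)

end Forms

/-! ### Integration of Čech classes -/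

section Cech

variable {X : Type*} [TopologicalSpace X] [ChartedSpace ℂ X] [IsManifold 𝓘(ℂ) ω X] [T2Space X]
  [CompactSpace X]

/-- `r` is the integral over `X` of the class in `H²(X, ℤ)` of the Čech cocycle `c` on the open
cover `U`, through the de Rham isomorphism: `c` is the coboundary of a cochain `f` of smooth
functions, `df` is the coboundary of a cochain `A` of smooth `1`-forms, and `r` is the integral of
the global closed `2`-form given by `dA` on each `U i`. -/
def IsCechIntegral {n : ℕ} (U : Fin n → Set X) (c : Fin n → Fin n → Fin n → X → ℤ) (r : ℝ) :
    Prop :=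
  ∃ (f : Fin n → Fin n → X → ℂ) (A : Fin n → DForm X 1) (Φ : DForm X 2),
    (∀ i j, ContMDiffOn 𝓘(ℝ, ℂ) 𝓘(ℝ, ℂ) ∞ (f i j) (U i ∩ U j)) ∧
    (∀ i j k, ∀ x ∈ U i ∩ U j ∩ U k, f j k x - f i k x + f i j x = c i j k x) ∧
    (∀ i, (A i).SmoothOn (U i)) ∧
    (∀ i j, ∀ x ∈ U i ∩ U j, ∀ v : TangentSpace 𝓘(ℝ, ℂ) x,
      A j x ![v] - A i x ![v] = mvfderiv 𝓘(ℝ, ℂ) (f i j) x v) ∧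
    (∀ i, ∀ x ∈ U i, Φ x = (A i).d x) ∧
    integral Φ = r

end Cech

/-! ### Holomorphic vector bundles, Hermitian metrics and connections

A holomorphic vector bundle is a Mathlib vector bundle `V` over `X`, with complex model fibre `F`
and holomorphic coordinate changes, `ContMDiffVectorBundle ω F V 𝓘(ℂ)`. -/

section Bundles

variable {X : Type*} [TopologicalSpace X] [ChartedSpace ℂ X]
  (F : Type*) [NormedAddCommGroup F] [NormedSpace ℂ F]
  (V : X → Type*) [∀ x, AddCommGroup (V x)] [∀ x, Module ℂ (V x)] [∀ x, TopologicalSpace (V x)]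
  [TopologicalSpace (TotalSpace F V)] [FiberBundle F V]

variable {V} in
/-- The section `s` is smooth (in the real sense) on the open set `U`. -/
def SmoothSectionOn (s : ∀ x, V x) (U : Set X) : Prop :=
  ContMDiffOn 𝓘(ℝ, ℂ) (𝓘(ℝ, ℂ).prod 𝓘(ℝ, F)) ∞ (fun x => TotalSpace.mk' F x (s x)) U

variable {V} in
/-- The section `s` is holomorphic on the open set `U`. -/
def HolomorphicSectionOn (s : ∀ x, V x) (U : Set X) : Prop :=
  MDifferentiableOn 𝓘(ℂ) (𝓘(ℂ).prod 𝓘(ℂ, F)) (fun x => TotalSpace.mk' F x (s x)) U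

variable {V} in
/-- The Dolbeault operator of the bundle, `∂̄ s (v) = (ds(v) + i ds(iv)) / 2` in a local holomorphic
trivialization. -/
def dbar (s : ∀ x, V x) (x : X) (v : TangentSpace 𝓘(ℝ, ℂ) x) : V x :=
  let e := trivializationAt F V x
  let ds := mvfderiv 𝓘(ℝ, ℂ) (fun y => (e (TotalSpace.mk' F y (s y))).2) x
  e.symm x ((1 / 2 : ℂ) • (ds v + Complex.I • ds (mulI v)))

/-- A Hermitian metric: a Hermitian inner product (linear in the first variable) on each fibre,
such that the product of two smooth local sections is smooth. -/
structure HermitianMetric where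
  inner : ∀ x, V x →ₗ[ℂ] V x →ₛₗ[starRingEnd ℂ] ℂ
  conj_symm : ∀ x (u v : V x), inner x u v = starRingEnd ℂ (inner x v u)
  pos : ∀ x (u : V x), u ≠ 0 → 0 < (inner x u u).re
  smooth : ∀ (U : Set X), IsOpen U → ∀ s t : ∀ x, V x,
    SmoothSectionOn F s U → SmoothSectionOn F t U →
      ContMDiffOn 𝓘(ℝ, ℂ) 𝓘(ℝ, ℂ) ∞ (fun x => inner x (s x) (t x)) U

/-- A connection, as an operator on smooth local sections: `toFun s x v` is `(D s)_x (v)`, which is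
meaningful where `s` is smooth near `x`. -/
structure Connection where
  toFun : (∀ x, V x) → ∀ x : X, TangentSpace 𝓘(ℝ, ℂ) x →ₗ[ℝ] V x
  add : ∀ (U : Set X), IsOpen U → ∀ s t : ∀ x, V x,
    SmoothSectionOn F s U → SmoothSectionOn F t U → ∀ x ∈ U, ∀ v : TangentSpace 𝓘(ℝ, ℂ) x,
      toFun (fun y => s y + t y) x v = toFun s x v + toFun t x v
  leibniz : ∀ (U : Set X), IsOpen U → ∀ (g : X → ℂ) (s : ∀ x, V x),
    ContMDiffOn 𝓘(ℝ, ℂ) 𝓘(ℝ, ℂ) ∞ g U → SmoothSectionOn F s U →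
      ∀ x ∈ U, ∀ v : TangentSpace 𝓘(ℝ, ℂ) x,
        toFun (fun y => g y • s y) x v = g x • toFun s x v + (mvfderiv 𝓘(ℝ, ℂ) g x v : ℂ) • s x
  smooth : ∀ (U : Set X), IsOpen U → ∀ s : ∀ x, V x, SmoothSectionOn F s U →
    ∀ (p : X) (v : TangentSpace 𝓘(ℝ, ℂ) p),
      SmoothSectionOn F (fun y => toFun s y (coordField p v y)) (U ∩ (chartAt ℂ p).source)

variable {F V}

/-- The extension of a connection to `1`-forms `α` with values in the bundle,
`(D α)(v, w) = D_v (α(w)) - D_w (α(v))` for commuting extensions of `v` and `w`. -/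
def Connection.extend (D : Connection F V) (α : ∀ x : X, TangentSpace 𝓘(ℝ, ℂ) x →ₗ[ℝ] V x)
    (x : X) (v w : TangentSpace 𝓘(ℝ, ℂ) x) : V x :=
  D.toFun (fun y => α y (coordField x w y)) x v - D.toFun (fun y => α y (coordField x v y)) x w

/-- The curvature `F_D s = D (D s)`, a `2`-form with values in the bundle. -/
def Connection.curvature (D : Connection F V) (s : ∀ x, V x) (x : X)
    (v w : TangentSpace 𝓘(ℝ, ℂ) x) : V x :=
  D.extend (D.toFun s) x v w

/-- The connection is unitary: `d⟨s, t⟩ = ⟨D s, t⟩ + ⟨s, D t⟩`. -/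
def Connection.IsUnitary (D : Connection F V) (H : HermitianMetric F V) : Prop :=
  ∀ (U : Set X), IsOpen U → ∀ s t : ∀ x, V x, SmoothSectionOn F s U → SmoothSectionOn F t U →
    ∀ x ∈ U, ∀ v : TangentSpace 𝓘(ℝ, ℂ) x,
      mvfderiv 𝓘(ℝ, ℂ) (fun y => H.inner y (s y) (t y)) x v =
        H.inner x (D.toFun s x v) (t x) + H.inner x (s x) (D.toFun t x v)

/-- `D` is the Chern connection of `H`: it is unitary and its `(0,1)`-part is the Dolbeault
operator of the bundle. -/
def Connection.IsChern (D : Connection F V) (H : HermitianMetric F V) : Prop :=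
  D.IsUnitary H ∧
  ∀ (U : Set X), IsOpen U → ∀ s : ∀ x, V x, SmoothSectionOn F s U →
    ∀ x ∈ U, ∀ v : TangentSpace 𝓘(ℝ, ℂ) x,
      (1 / 2 : ℂ) • (D.toFun s x v + Complex.I • D.toFun s x (mulI v)) = dbar F s x v

/-! ### Holomorphic subbundles, degree and stability -/

variable (F) in
/-- `e` is a holomorphic frame over `U` of the family `W` of subspaces of the fibres. -/
structure IsHolomorphicFrame (W : ∀ x, Submodule ℂ (V x)) {r : ℕ} (U : Set X)
    (e : Fin r → ∀ x, V x) : Prop where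
  holomorphic : ∀ a, HolomorphicSectionOn F (e a) U
  linearIndependent : ∀ x ∈ U, LinearIndependent ℂ (fun a => e a x)
  span_eq : ∀ x ∈ U, Submodule.span ℂ (range fun a => e a x) = W x

variable (F V) in
/-- A holomorphic subbundle: a family of subspaces of the fibres, of constant dimension, with
holomorphic frames locally. -/
structure HolomorphicSubbundle where
  fiber : ∀ x, Submodule ℂ (V x)
  rank : ℕ
  exists_frame : ∀ x : X, ∃ (U : Set X) (e : Fin rank → ∀ x, V x),
    IsOpen U ∧ x ∈ U ∧ IsHolomorphicFrame F fiber U e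

variable (F V) in
/-- The whole bundle, as a subbundle of itself. -/
def HolomorphicSubbundle.whole [FiniteDimensional ℂ F] [VectorBundle ℂ F V]
    [IsManifold 𝓘(ℂ) ω X] [ContMDiffVectorBundle ω F V 𝓘(ℂ)] : HolomorphicSubbundle F V where
  fiber _ := ⊤
  rank := Module.finrank ℂ F
  exists_frame x := by
    have h := (trivializationAt F V x).isLocalFrameOn_localFrame_baseSet 𝓘(ℂ) ω
      (Module.finBasis ℂ F)
    exact ⟨_, _, (trivializationAt F V x).open_baseSet, mem_baseSet_trivializationAt F V x,
      fun a => (h.contMDiffOn a).mdifferentiableOn (by simp),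
      fun y hy => h.linearIndependent hy, fun y hy => top_le_iff.1 (h.generating hy)⟩

/-- The integer cocycle `c` on the open cover `U` represents the first Chern class of the
determinant line bundle of `W`: for holomorphic frames `e i` on `U i` with transition matrices
`g i j`, `e j = e i * g i j`, and smooth logarithms `l i j` of the transition functions `det (g i j)`
of the determinant, `c` is `i / 2π` times the coboundary of `l`, i.e. `i / 2π` times the image
of the determinant under the connecting map of the exponential sequence. -/
def HolomorphicSubbundle.IsChernCocycle (W : HolomorphicSubbundle F V) {n : ℕ}
    (U : Fin n → Set X) (c : Fin n → Fin n → Fin n → X → ℤ) : Prop :=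
  ∃ (e : Fin n → Fin W.rank → ∀ x, V x)
    (g : Fin n → Fin n → X → Matrix (Fin W.rank) (Fin W.rank) ℂ) (l : Fin n → Fin n → X → ℂ),
    (∀ i, IsHolomorphicFrame F W.fiber (U i) (e i)) ∧
    (∀ i j, ∀ x ∈ U i ∩ U j, ∀ a, e j a x = ∑ b, g i j x b a • e i b x) ∧
    (∀ i j, ContMDiffOn 𝓘(ℝ, ℂ) 𝓘(ℝ, ℂ) ∞ (l i j) (U i ∩ U j)) ∧
    (∀ i j, ∀ x ∈ U i ∩ U j, Complex.exp (l i j x) = (g i j x).det) ∧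
    (∀ i j k, ∀ x ∈ U i ∩ U j ∩ U k,
      (c i j k x : ℂ) = Complex.I / (2 * Real.pi) * (l j k x - l i k x + l i j x))

variable [IsManifold 𝓘(ℂ) ω X] [T2Space X] [CompactSpace X]

/-- `d` is the integral over `X` of the first Chern class of the determinant of `W`, computed on
some finite open cover. -/
def HolomorphicSubbundle.HasDegree (W : HolomorphicSubbundle F V) (d : ℝ) : Prop :=
  ∃ (n : ℕ) (U : Fin n → Set X) (c : Fin n → Fin n → Fin n → X → ℤ),
    (∀ i, IsOpen (U i)) ∧ (⋃ i, U i) = univ ∧ W.IsChernCocycle U c ∧ IsCechIntegral U c d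

open Classical in
/-- The degree of a holomorphic subbundle (which always exists and is unique). -/
def HolomorphicSubbundle.degree (W : HolomorphicSubbundle F V) : ℝ :=
  if h : ∃ d, W.HasDegree d then h.choose else 0

/-- The slope. -/
def HolomorphicSubbundle.slope (W : HolomorphicSubbundle F V) : ℝ :=
  W.degree / W.rank

/-- Stability: `W` is nonzero and every holomorphic subbundle of `W` other than `0` and `W` has
strictly smaller slope. -/
def HolomorphicSubbundle.IsStable (W : HolomorphicSubbundle F V) : Prop :=
  0 < W.rank ∧ ∀ W' : HolomorphicSubbundle F V, (∀ x, W'.fiber x ≤ W.fiber x) →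
    0 < W'.rank → W'.rank < W.rank → W'.slope < W.slope

variable (F V)
variable [FiniteDimensional ℂ F] [VectorBundle ℂ F V] [ContMDiffVectorBundle ω F V 𝓘(ℂ)]

/-- Polystability: the bundle is stable, or it is the direct sum of finitely many stable
holomorphic subbundles whose slope is that of the bundle. -/
def IsPolystable : Prop :=
  (HolomorphicSubbundle.whole F V).IsStable ∨
  ∃ (m : ℕ) (W : Fin m → HolomorphicSubbundle F V),
    (∀ x, DirectSum.IsInternal fun i => (W i).fiber x) ∧
    ∀ i, (W i).IsStable ∧ (W i).slope = (HolomorphicSubbundle.whole F V).slope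

variable {F V}

/-- `H` is a Hermitian–Einstein metric with respect to the volume form `vol`: its Chern connection
has curvature `-2πi μ id vol`, where `μ` is the slope of the bundle. -/
def HermitianMetric.IsHermitianEinstein (H : HermitianMetric F V) (vol : DForm X 2) : Prop :=
  ∃ D : Connection F V, D.IsChern H ∧
    ∀ (U : Set X), IsOpen U → ∀ s : ∀ x, V x, SmoothSectionOn F s U →
      ∀ x ∈ U, ∀ v w : TangentSpace 𝓘(ℝ, ℂ) x,
        D.curvature s x v w =
          (-2 * Real.pi * Complex.I * (HolomorphicSubbundle.whole F V).slope * vol x ![v, w]) • s x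

end Bundles

end RiemannSurface

end

/-!
Let `D` be the Chern connection of the Hermitian–Einstein metric `H`, and `μ` the slope of the
bundle. For a holomorphic subbundle `W` of rank `r` with local holomorphic frame `e` and dual
frame `e*`, the form `(i / 2π) ∑ ⟨D e_a, e_a*⟩` (`traceForm`) is `i / 2π` times the connection
form of `det W` for the Chern connection of the induced metric. A change of frame adds to it `i /
2π` times the logarithmic derivative of the determinant of the transition matrix
(`traceForm_change`), so its differential is a global form `W.curvForm`.

The curvature decreases in subbundles (`traceForm_d_apply`): the hypothesis on the curvature gives
`W.curvForm = r μ vol - σ`, where `σ ≥ 0` is, up to a constant, the square norm of the second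
fundamental form of `W`, and `σ = 0` exactly if `W` is parallel, i.e. preserved by `D`.

The degree of `W`, defined through Čech cocycles, is the integral of `W.curvForm`. It exists
because `W` has frames on a finite cover fine enough for the determinants of the transition
matrices to have logarithms (`HolomorphicSubbundle.hasDegree_of_integral`). Two de Rham
representatives of the same Čech class differ by an exact form, as smooth cocycles are
coboundaries, so that the value follows from Stokes' theorem `integral_d`
(`HolomorphicSubbundle.HasDegree.integral_eq`). Therefore `deg W ≤ r μ`, with equality exactly if
`W` is parallel (`HolomorphicSubbundle.degree_eq`).

Finally, inside a parallel `W` that is not stable, a subbundle of slope at least `μ` has slope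
`μ`, hence is parallel. Its orthogonal complement in `W` is parallel because `D` is unitary, and
holomorphic because the `(0,1)`-part of `D` is the Dolbeault operator
(`HolomorphicSubbundle.exists_complement`). Induction on the rank splits the whole bundle into an
orthogonal sum of parallel stable subbundles, which all have slope `μ`.
-/

namespace RiemannSurface

set_option linter.unusedSectionVars false

set_option synthInstance.maxHeartbeats 400000 in
theorem contDiffAt_extDeriv {E G : Type*} [NormedAddCommGroup E] [NormedSpace ℝ E]
    [NormedAddCommGroup G] [NormedSpace ℝ G] {n : ℕ} {a : E → E [⋀^Fin n]→L[ℝ] G} {z : E}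
    (h : ContDiffAt ℝ ∞ a z) : ContDiffAt ℝ ∞ (extDeriv a) z := by
  have h3 : ContDiffAt ℝ ∞ (fderiv ℝ a) z := h.fderiv_right (by simp)
  exact h3.continuousLinearMap_comp (ContinuousAlternatingMap.alternatizeUncurryFinCLM ℝ E G (n := n))

attribute [local instance] isManifold_real

/-! ### Charts -/

section Charts

variable {X : Type*} [TopologicalSpace X] [ChartedSpace ℂ X]

/-- The derivative of the inverse chart at `p`, as an endomorphism of `ℂ`: tangent spaces of `X` are
identified with `ℂ` through the preferred charts. -/
noncomputable def dsymm (p : X) (z : ℂ) : ℂ →L[ℝ] ℂ :=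
  mfderiv 𝓘(ℝ, ℂ) 𝓘(ℝ, ℂ) (chartAt ℂ p).symm z

/-- The change of coordinates from the preferred chart at `p` to the preferred chart at `q`. -/
noncomputable def transition (p q : X) : ℂ → ℂ := chartAt ℂ q ∘ (chartAt ℂ p).symm

theorem coordField_eq (p : X) (v : TangentSpace 𝓘(ℝ, ℂ) p) (y : X) :
    coordField p v y = dsymm p (chartAt ℂ p y) v := rfl

section RealSmooth

variable [IsManifold 𝓘(ℝ, ℂ) ∞ X]

theorem mdifferentiableAt_chart_symm {p : X} {z : ℂ} (hz : z ∈ (chartAt ℂ p).target) :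
    MDifferentiableAt 𝓘(ℝ, ℂ) 𝓘(ℝ, ℂ) (chartAt ℂ p).symm z :=
  ((contMDiffOn_chart_symm (I := 𝓘(ℝ, ℂ)) (n := ∞)).contMDiffAt
    ((chartAt ℂ p).open_target.mem_nhds hz)).mdifferentiableAt (by simp)

theorem mdifferentiableAt_chart {p y : X} (hy : y ∈ (chartAt ℂ p).source) :
    MDifferentiableAt 𝓘(ℝ, ℂ) 𝓘(ℝ, ℂ) (chartAt ℂ p) y :=
  ((contMDiffOn_chart (I := 𝓘(ℝ, ℂ)) (n := ∞)).contMDiffAt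
    ((chartAt ℂ p).open_source.mem_nhds hy)).mdifferentiableAt (by simp)

theorem dsymm_eq {p : X} {z : ℂ} (hz : z ∈ (chartAt ℂ p).target) :
    dsymm p z = fderiv ℝ (transition p ((chartAt ℂ p).symm z)) z := by
  rw [dsymm, (mdifferentiableAt_chart_symm hz).mfderiv]
  simp only [mfld_simps, fderivWithin_univ]
  rfl

theorem dsymm_self (x : X) : dsymm x (chartAt ℂ x x) = ContinuousLinearMap.id ℝ ℂ := by
  have hz := mem_chart_target ℂ x
  rw [dsymm_eq hz, (chartAt ℂ x).left_inv (mem_chart_source ℂ x)]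
  have : transition x x =ᶠ[𝓝 (chartAt ℂ x x)] id := by
    filter_upwards [(chartAt ℂ x).open_target.mem_nhds hz] with w hw
    exact (chartAt ℂ x).right_inv hw
  rw [this.fderiv_eq, fderiv_id]

theorem coordField_self (x : X) (v : TangentSpace 𝓘(ℝ, ℂ) x) : coordField x v x = v := by
  rw [coordField_eq, dsymm_self]; rfl

theorem mfderiv_chartAt_self (x : X) :
    (mfderiv 𝓘(ℝ, ℂ) 𝓘(ℝ, ℂ) (chartAt ℂ x) x : ℂ →L[ℝ] ℂ) = ContinuousLinearMap.id ℝ ℂ := by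
  have hz := mem_chart_target ℂ x
  rw [(mdifferentiableAt_chart (mem_chart_source ℂ x)).mfderiv]
  simp only [mfld_simps, fderivWithin_univ]
  have : (chartAt ℂ x ∘ (chartAt ℂ x).symm) =ᶠ[𝓝 (chartAt ℂ x x)] id := by
    filter_upwards [(chartAt ℂ x).open_target.mem_nhds hz] with w hw
    exact (chartAt ℂ x).right_inv hw
  have h2 := this.fderiv_eq (𝕜 := ℝ)
  rw [fderiv_id] at h2
  exact h2

theorem d_eq {n : ℕ} (α : DForm X n) (x : X) :
    α.d x = extDeriv (α.inChart x) (chartAt ℂ x x) := by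
  change (extDeriv (α.inChart x) (chartAt ℂ x x)).compContinuousLinearMap
    (mfderiv 𝓘(ℝ, ℂ) 𝓘(ℝ, ℂ) (chartAt ℂ x) x : ℂ →L[ℝ] ℂ) = _
  rw [mfderiv_chartAt_self]
  rfl

variable {E : Type*} [NormedAddCommGroup E] [NormedSpace ℝ E]

theorem ContMDiffOn.comp_chart_symm {g : X → E} {U : Set X}
    (hg : ContMDiffOn 𝓘(ℝ, ℂ) 𝓘(ℝ, E) ∞ g U) (p : X) :
    ContDiffOn ℝ ∞ (g ∘ (chartAt ℂ p).symm)
      ((chartAt ℂ p).target ∩ (chartAt ℂ p).symm ⁻¹' U) := by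
  rw [← contMDiffOn_iff_contDiffOn]
  exact hg.comp ((contMDiffOn_chart_symm (I := 𝓘(ℝ, ℂ)) (n := ∞)).mono inter_subset_left)
    fun z hz => hz.2

theorem ContMDiffOn.mdifferentiableAt_real {g : X → E} {U : Set X} (hU : IsOpen U)
    (hg : ContMDiffOn 𝓘(ℝ, ℂ) 𝓘(ℝ, E) ∞ g U) {x : X} (hx : x ∈ U) :
    MDifferentiableAt 𝓘(ℝ, ℂ) 𝓘(ℝ, E) g x :=
  (hg.contMDiffAt (hU.mem_nhds hx)).mdifferentiableAt (by simp)

theorem mvfderiv_dsymm {g : X → E} {p : X} {z : ℂ} (hz : z ∈ (chartAt ℂ p).target)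
    (hg : MDifferentiableAt 𝓘(ℝ, ℂ) 𝓘(ℝ, E) g ((chartAt ℂ p).symm z)) (w : ℂ) :
    mvfderiv 𝓘(ℝ, ℂ) g ((chartAt ℂ p).symm z) (dsymm p z w) =
      fderiv ℝ (g ∘ (chartAt ℂ p).symm) z w := by
  have h := mfderiv_comp_apply (I' := 𝓘(ℝ, ℂ)) z hg (mdifferentiableAt_chart_symm hz) w
  rw [mfderiv_eq_fderiv] at h
  exact h.symm

theorem mvfderiv_eq_fderiv_chart {g : X → E} {x : X}
    (hg : MDifferentiableAt 𝓘(ℝ, ℂ) 𝓘(ℝ, E) g x) (w : ℂ) :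
    mvfderiv 𝓘(ℝ, ℂ) g x w = fderiv ℝ (g ∘ (chartAt ℂ x).symm) (chartAt ℂ x x) w := by
  rw [hg.mvfderiv]
  simp only [mfld_simps, fderivWithin_univ]
  rfl

theorem mvfderiv_congr {g g' : X → E} {x : X} (h : g =ᶠ[𝓝 x] g') :
    mvfderiv 𝓘(ℝ, ℂ) g x = mvfderiv 𝓘(ℝ, ℂ) g' x := by
  ext v
  have h2 := h.mfderiv_eq (I := 𝓘(ℝ, ℂ)) (I' := 𝓘(ℝ, E))
  change (mfderiv 𝓘(ℝ, ℂ) 𝓘(ℝ, E) g x : ℂ →L[ℝ] E) v = (mfderiv 𝓘(ℝ, ℂ) 𝓘(ℝ, E) g' x : ℂ →L[ℝ] E) v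
  congr 1

end RealSmooth

section Holomorphic

variable [IsManifold 𝓘(ℂ) ω X]

theorem contDiffOn_transition (p q : X) : ContDiffOn ℂ ω (transition p q)
    ((chartAt ℂ p).target ∩ (chartAt ℂ p).symm ⁻¹' (chartAt ℂ q).source) := by
  have h := (contDiffGroupoid ω 𝓘(ℂ)).compatible (chart_mem_atlas ℂ p) (chart_mem_atlas ℂ q)
  rw [contDiffGroupoid, mem_groupoid_of_pregroupoid] at h
  have h' : ContDiffOn ℂ ω (𝓘(ℂ) ∘ ((chartAt ℂ p).symm ≫ₕ chartAt ℂ q) ∘ 𝓘(ℂ).symm)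
      (𝓘(ℂ).symm ⁻¹' ((chartAt ℂ p).symm ≫ₕ chartAt ℂ q).source ∩ range 𝓘(ℂ)) := h.1
  simpa only [mfld_simps] using! h'

theorem isOpen_transition_source (p q : X) :
    IsOpen ((chartAt ℂ p).target ∩ (chartAt ℂ p).symm ⁻¹' (chartAt ℂ q).source) :=
  (chartAt ℂ p).symm.isOpen_inter_preimage (chartAt ℂ q).open_source

theorem contDiffAt_transition {p q : X} {z : ℂ} (hz : z ∈ (chartAt ℂ p).target)
    (hq : (chartAt ℂ p).symm z ∈ (chartAt ℂ q).source) :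
    ContDiffAt ℂ ω (transition p q) z :=
  (contDiffOn_transition p q).contDiffAt ((isOpen_transition_source p q).mem_nhds ⟨hz, hq⟩)

theorem hasDerivAt_transition {p q : X} {z : ℂ} (hz : z ∈ (chartAt ℂ p).target)
    (hq : (chartAt ℂ p).symm z ∈ (chartAt ℂ q).source) :
    HasDerivAt (transition p q) (deriv (transition p q) z) z :=
  ((contDiffAt_transition hz hq).differentiableAt (by simp)).hasDerivAt

theorem fderiv_transition_apply {p q : X} {z : ℂ} (hz : z ∈ (chartAt ℂ p).target)
    (hq : (chartAt ℂ p).symm z ∈ (chartAt ℂ q).source) (w : ℂ) :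
    fderiv ℝ (transition p q) z w = deriv (transition p q) z * w := by
  rw [((hasDerivAt_transition hz hq).hasFDerivAt.restrictScalars ℝ).fderiv]
  simp [mul_comm]

theorem differentiableAt_transition {p q : X} {z : ℂ} (hz : z ∈ (chartAt ℂ p).target)
    (hq : (chartAt ℂ p).symm z ∈ (chartAt ℂ q).source) :
    DifferentiableAt ℝ (transition p q) z :=
  ((hasDerivAt_transition hz hq).hasFDerivAt.restrictScalars ℝ).differentiableAt

theorem dsymm_comp_transition {p q : X} {z : ℂ} (hz : z ∈ (chartAt ℂ p).target)
    (hq : (chartAt ℂ p).symm z ∈ (chartAt ℂ q).source) :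
    (dsymm q (transition p q z)).comp (fderiv ℝ (transition p q) z) = dsymm p z := by
  have hz' : transition p q z ∈ (chartAt ℂ q).target := (chartAt ℂ q).map_source hq
  have hy : (chartAt ℂ q).symm (transition p q z) = (chartAt ℂ p).symm z :=
    (chartAt ℂ q).left_inv hq
  rw [dsymm_eq hz, dsymm_eq hz', hy]
  rw [← fderiv_comp]
  · apply Filter.EventuallyEq.fderiv_eq
    filter_upwards [(isOpen_transition_source p q).mem_nhds ⟨hz, hq⟩] with w hw
    simp only [transition, Function.comp]
    rw [(chartAt ℂ q).left_inv hw.2]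
  · exact differentiableAt_transition hz' (by rw [hy]; exact mem_chart_source ℂ _)
  · exact differentiableAt_transition hz hq

/-- The derivative of an inverse chart is multiplication by a complex number. -/
theorem dsymm_apply {p : X} {z : ℂ} (hz : z ∈ (chartAt ℂ p).target) (w : ℂ) :
    dsymm p z w = deriv (transition p ((chartAt ℂ p).symm z)) z * w := by
  rw [dsymm_eq hz, fderiv_transition_apply hz (mem_chart_source ℂ _)]

theorem transition_transition {p q : X} {z : ℂ} (hz : z ∈ (chartAt ℂ p).target)
    (hq : (chartAt ℂ p).symm z ∈ (chartAt ℂ q).source) :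
    transition q p (transition p q z) = z := by
  simp only [transition, Function.comp]
  rw [(chartAt ℂ q).left_inv hq, (chartAt ℂ p).right_inv hz]

theorem deriv_transition_ne_zero {p q : X} {z : ℂ} (hz : z ∈ (chartAt ℂ p).target)
    (hq : (chartAt ℂ p).symm z ∈ (chartAt ℂ q).source) : deriv (transition p q) z ≠ 0 := by
  have hz' : transition p q z ∈ (chartAt ℂ q).target := (chartAt ℂ q).map_source hq
  have hy : (chartAt ℂ q).symm (transition p q z) = (chartAt ℂ p).symm z :=
    (chartAt ℂ q).left_inv hq
  have h1 := (hasDerivAt_transition (q := p) hz'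
    (by rw [hy]; exact (chartAt ℂ p).map_target hz)).comp z (hasDerivAt_transition hz hq)
  have h2 : HasDerivAt (transition q p ∘ transition p q) 1 z := by
    refine (hasDerivAt_id z).congr_of_eventuallyEq ?_
    filter_upwards [(isOpen_transition_source p q).mem_nhds ⟨hz, hq⟩] with w hw
    exact transition_transition hw.1 hw.2
  intro h0
  have := h1.unique h2
  rw [h0, mul_zero] at this
  exact zero_ne_one this

theorem dsymm_mul_I {p : X} {z : ℂ} (hz : z ∈ (chartAt ℂ p).target) (w : ℂ) :
    dsymm p z (Complex.I * w) = Complex.I * dsymm p z w := by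
  rw [dsymm_apply hz, dsymm_apply hz]; ring

theorem dsymm_one_ne_zero {p : X} {z : ℂ} (hz : z ∈ (chartAt ℂ p).target) :
    dsymm p z 1 ≠ 0 := by
  rw [dsymm_apply hz, mul_one]
  exact deriv_transition_ne_zero hz (mem_chart_source ℂ _)

/-- The expressions of a form in two charts are pulled back to each other by the change of
coordinates. -/
theorem inChart_transition {n : ℕ} (α : DForm X n) {p q : X} {z : ℂ}
    (hz : z ∈ (chartAt ℂ p).target) (hq : (chartAt ℂ p).symm z ∈ (chartAt ℂ q).source) :
    α.inChart p z = (α.inChart q (transition p q z)).compContinuousLinearMap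
      (fderiv ℝ (transition p q) z) := by
  have hy : (chartAt ℂ q).symm (transition p q z) = (chartAt ℂ p).symm z :=
    (chartAt ℂ q).left_inv hq
  let a : X → ℂ [⋀^Fin n]→L[ℝ] ℂ := α
  have h1 : α.inChart p z = (a ((chartAt ℂ p).symm z)).compContinuousLinearMap (dsymm p z) := rfl
  have h2 : α.inChart q (transition p q z) =
    (a ((chartAt ℂ q).symm (transition p q z))).compContinuousLinearMap
      (dsymm q (transition p q z)) := rfl
  rw [h1, h2, hy, ← dsymm_comp_transition hz hq]
  rfl

/-! ### Exterior derivatives in arbitrary charts -/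

theorem isOpen_target_inter {U : Set X} (hU : IsOpen U) (p : X) :
    IsOpen ((chartAt ℂ p).target ∩ (chartAt ℂ p).symm ⁻¹' U) :=
  (chartAt ℂ p).symm.isOpen_inter_preimage hU

theorem DForm.SmoothOn.contDiffAt {n : ℕ} {α : DForm X n} {U : Set X} (hU : IsOpen U)
    (hα : α.SmoothOn U) {p : X} {z : ℂ} (hz : z ∈ (chartAt ℂ p).target)
    (hzU : (chartAt ℂ p).symm z ∈ U) : ContDiffAt ℝ ∞ (α.inChart p) z :=
  (hα p).contDiffAt ((isOpen_target_inter hU p).mem_nhds ⟨hz, hzU⟩)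

/-- The exterior derivative, defined through the preferred chart at each point, is computed by
every chart. -/
theorem inChart_d {n : ℕ} {α : DForm X n} {U : Set X} (hU : IsOpen U) (hα : α.SmoothOn U)
    {p : X} {z : ℂ} (hz : z ∈ (chartAt ℂ p).target) (hzU : (chartAt ℂ p).symm z ∈ U) :
    (α.d).inChart p z = extDeriv (α.inChart p) z := by
  set y := (chartAt ℂ p).symm z with hy
  have hys := mem_chart_source ℂ y
  have hf : transition p y z = chartAt ℂ y y := rfl
  have e1 : α.inChart p =ᶠ[𝓝 z] fun z' => (α.inChart y (transition p y z')).compContinuousLinearMap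
      (fderiv ℝ (transition p y) z') := by
    filter_upwards [(isOpen_transition_source p y).mem_nhds ⟨hz, hys⟩] with w hw
    exact inChart_transition α hw.1 hw.2
  have hdiff : DifferentiableAt ℝ (α.inChart y) (transition p y z) := by
    rw [hf]
    exact (hα.contDiffAt hU (mem_chart_target ℂ y)
      (by rw [(chartAt ℂ y).left_inv hys]; exact hzU)).differentiableAt (by simp)
  have h3 : ContDiffAt ℝ ω (transition p y) z := (contDiffAt_transition hz hys).restrict_scalars ℝ
  rw [e1.extDeriv_eq, extDeriv_pullback hdiff h3 le_top]
  change (show ℂ [⋀^Fin (n + 1)]→L[ℝ] ℂ from α.d y).compContinuousLinearMap (dsymm p z) = _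
  rw [show (show ℂ [⋀^Fin (n + 1)]→L[ℝ] ℂ from α.d y) = _ from d_eq α y, dsymm_eq hz]
  rfl

theorem DForm.SmoothOn.d {n : ℕ} {α : DForm X n} {U : Set X} (hU : IsOpen U)
    (hα : α.SmoothOn U) : (α.d).SmoothOn U := by
  intro p z hz
  have h := hα.contDiffAt hU hz.1 hz.2
  have h2 : ContDiffAt ℝ ∞ (extDeriv (α.inChart p)) z := by
    exact contDiffAt_extDeriv h
  refine (h2.congr_of_eventuallyEq ?_).contDiffWithinAt
  filter_upwards [(isOpen_target_inter hU p).mem_nhds hz] with w hw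
  exact inChart_d hU hα hw.1 hw.2

theorem inChart_congr {n : ℕ} {α β : DForm X n} {p : X} {z : ℂ}
    (h : α ((chartAt ℂ p).symm z) = β ((chartAt ℂ p).symm z)) :
    α.inChart p z = β.inChart p z := by
  simp only [DForm.inChart, h]

theorem DForm.SmoothOn.congr {n : ℕ} {α β : DForm X n} {U : Set X} (hα : α.SmoothOn U)
    (h : ∀ x ∈ U, β x = α x) : β.SmoothOn U :=
  fun p => (hα p).congr fun _ hz => inChart_congr (h _ hz.2)

/-- Smoothness is local. -/
theorem DForm.SmoothOn.of_locally {n : ℕ} {α : DForm X n} {U : Set X}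
    (h : ∀ x ∈ U, ∃ U', IsOpen U' ∧ x ∈ U' ∧ α.SmoothOn U') : α.SmoothOn U := by
  intro p z hz
  obtain ⟨U', ho, hx, hs⟩ := h _ hz.2
  exact (hs.contDiffAt ho hz.1 hx).contDiffWithinAt

theorem d_congr {n : ℕ} {α β : DForm X n} {U : Set X} (hU : IsOpen U)
    (h : ∀ x ∈ U, α x = β x) {x : X} (hx : x ∈ U) : α.d x = β.d x := by
  rw [d_eq, d_eq]
  apply Filter.EventuallyEq.extDeriv_eq
  have hz := mem_chart_target ℂ x
  filter_upwards [(isOpen_target_inter hU x).mem_nhds ⟨hz, by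
    simpa [(chartAt ℂ x).left_inv (mem_chart_source ℂ x)] using hx⟩] with w hw
  exact inChart_congr (h _ hw.2)

theorem inChart_sub {n : ℕ} (α β : DForm X n) (p : X) :
    (α - β).inChart p = α.inChart p - β.inChart p := rfl

theorem DForm.SmoothOn.sub {n : ℕ} {α β : DForm X n} {U : Set X} (hα : α.SmoothOn U)
    (hβ : β.SmoothOn U) : (α - β).SmoothOn U := fun p => (hα p).sub (hβ p)

theorem d_sub {n : ℕ} {α β : DForm X n} {U : Set X} (hU : IsOpen U) (hα : α.SmoothOn U)
    (hβ : β.SmoothOn U) {x : X} (hx : x ∈ U) : (α - β).d x = α.d x - β.d x := by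
  have hx' : (chartAt ℂ x).symm (chartAt ℂ x x) ∈ U := by
    simpa [(chartAt ℂ x).left_inv (mem_chart_source ℂ x)] using hx
  have ha := (hα.contDiffAt hU (mem_chart_target ℂ x) hx').differentiableAt (by simp)
  have hb := (hβ.contDiffAt hU (mem_chart_target ℂ x) hx').differentiableAt (by simp)
  rw [d_eq, d_eq, d_eq, inChart_sub]
  rw [sub_eq_add_neg, extDeriv_add ha hb.neg]
  have : extDeriv (-β.inChart x) (chartAt ℂ x x) = - extDeriv (β.inChart x) (chartAt ℂ x x) := by
    have := extDeriv_smul (x := chartAt ℂ x x) (-1 : ℝ) (β.inChart x)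
    rw [neg_one_smul, neg_one_smul] at this
    exact this
  rw [this]
  exact (sub_eq_add_neg (G := ℂ [⋀^Fin (n + 1)]→L[ℝ] ℂ) _ _).symm

/-! ### One-forms -/

/-- The `1`-form with given values on tangent vectors. -/
noncomputable def oneForm (L : ∀ x : X, TangentSpace 𝓘(ℝ, ℂ) x →ₗ[ℝ] ℂ) : DForm X 1 := fun x =>
  ContinuousAlternatingMap.ofSubsingleton ℝ ℂ ℂ (0 : Fin 1)
    (LinearMap.toContinuousLinearMap (show ℂ →ₗ[ℝ] ℂ from L x))

/-- A real-linear form on the plane in terms of `dx` and `dy`. -/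
theorem eq_re_im_of_oneForm (a : ℂ [⋀^Fin 1]→L[ℝ] ℂ) :
    a = a ![1] • ContinuousAlternatingMap.ofSubsingleton ℝ ℂ ℂ (0 : Fin 1)
          (Complex.ofRealCLM.comp Complex.reCLM) +
        a ![Complex.I] • ContinuousAlternatingMap.ofSubsingleton ℝ ℂ ℂ (0 : Fin 1)
          (Complex.ofRealCLM.comp Complex.imCLM) := by
  set L := (ContinuousAlternatingMap.ofSubsingleton ℝ ℂ ℂ (0 : Fin 1)).symm a with hL
  have ha : ∀ w, a w = L (w 0) := by
    intro w
    have : w = fun _ => w 0 := by ext i; fin_cases i; rfl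
    conv_lhs => rw [this]
    rfl
  ext w
  have h1 : w 0 = (w 0).re • (1 : ℂ) + (w 0).im • Complex.I := by
    apply Complex.ext <;> simp
  change a w = a ![1] * ((w 0).re : ℂ) + a ![Complex.I] * ((w 0).im : ℂ)
  rw [ha, ha, ha]
  conv_lhs => rw [h1, map_add, map_smul, map_smul]
  simp [mul_comm]

/-- A `1`-form is smooth as soon as its values on coordinate fields are. -/
theorem smoothOn_oneForm {L : ∀ x : X, TangentSpace 𝓘(ℝ, ℂ) x →ₗ[ℝ] ℂ} {U : Set X}
    (h : ∀ (p : X) (w : TangentSpace 𝓘(ℝ, ℂ) p), ContMDiffOn 𝓘(ℝ, ℂ) 𝓘(ℝ, ℂ) ∞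
      (fun y => L y (coordField p w y)) (U ∩ (chartAt ℂ p).source)) :
    (oneForm L).SmoothOn U := by
  intro p
  have key : ∀ w : ℂ, ContDiffOn ℝ ∞ (fun z => (oneForm L).inChart p z ![w])
      ((chartAt ℂ p).target ∩ (chartAt ℂ p).symm ⁻¹' U) := by
    intro w
    have := ContMDiffOn.comp_chart_symm (h p w) p
    refine (this.mono fun z hz => ⟨hz.1, hz.2, (chartAt ℂ p).map_target hz.1⟩).congr ?_
    intro z hz
    change L _ (dsymm p z w) = L _ (dsymm p (chartAt ℂ p ((chartAt ℂ p).symm z)) w)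
    rw [(chartAt ℂ p).right_inv hz.1]
  have e : (oneForm L).inChart p = fun z =>
      (oneForm L).inChart p z ![1] • ContinuousAlternatingMap.ofSubsingleton ℝ ℂ ℂ (0 : Fin 1)
          (Complex.ofRealCLM.comp Complex.reCLM) +
        (oneForm L).inChart p z ![Complex.I] • ContinuousAlternatingMap.ofSubsingleton ℝ ℂ ℂ
          (0 : Fin 1) (Complex.ofRealCLM.comp Complex.imCLM) := by
    funext z
    exact eq_re_im_of_oneForm _
  rw [e]
  exact ((key 1).smul contDiffOn_const).add ((key Complex.I).smul contDiffOn_const)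

/-- Cartan's formula for the exterior derivative of a `1`-form, on the commuting coordinate fields
that extend two tangent vectors. -/
theorem oneForm_d_apply {L : ∀ x : X, TangentSpace 𝓘(ℝ, ℂ) x →ₗ[ℝ] ℂ} {U : Set X} (hU : IsOpen U)
    (hL : ∀ (p : X) (w : TangentSpace 𝓘(ℝ, ℂ) p), ContMDiffOn 𝓘(ℝ, ℂ) 𝓘(ℝ, ℂ) ∞
      (fun y => L y (coordField p w y)) (U ∩ (chartAt ℂ p).source)) {x : X} (hx : x ∈ U)
    (v w : TangentSpace 𝓘(ℝ, ℂ) x) :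
    (oneForm L).d x ![v, w] =
      mvfderiv 𝓘(ℝ, ℂ) (fun y => L y (coordField x w y)) x v -
        mvfderiv 𝓘(ℝ, ℂ) (fun y => L y (coordField x v y)) x w := by
  have hxs := mem_chart_source ℂ x
  have hx' : (chartAt ℂ x).symm (chartAt ℂ x x) ∈ U := by
    simpa [(chartAt ℂ x).left_inv hxs] using hx
  have ha := ((smoothOn_oneForm hL).contDiffAt hU (mem_chart_target ℂ x) hx').differentiableAt
    (by simp)
  have hd : ∀ u u' : ℂ, mvfderiv 𝓘(ℝ, ℂ) (fun y => L y (coordField x u y)) x u' =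
      fderiv ℝ (fun z => (oneForm L).inChart x z ![u]) (chartAt ℂ x x) u' := by
    intro u u'
    rw [mvfderiv_eq_fderiv_chart
      (ContMDiffOn.mdifferentiableAt_real (hU.inter (chartAt ℂ x).open_source) (hL x u) ⟨hx, hxs⟩)]
    congr 1
    apply Filter.EventuallyEq.fderiv_eq
    filter_upwards [(chartAt ℂ x).open_target.mem_nhds (mem_chart_target ℂ x)] with z hz
    change L _ (dsymm x (chartAt ℂ x ((chartAt ℂ x).symm z)) u) = L _ (dsymm x z u)
    rw [(chartAt ℂ x).right_inv hz]
  rw [d_eq]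
  change extDeriv ((oneForm L).inChart x) (chartAt ℂ x x) (![v, w] : Fin 2 → ℂ) = _
  rw [hd w v, hd v w]
  refine (extDeriv_apply ha _).trans ?_
  rw [Fin.sum_univ_two]
  have r0 : (0 : Fin 2).removeNth (![v, w] : Fin 2 → ℂ) = ![w] := by ext i; fin_cases i; rfl
  have r1 : (1 : Fin 2).removeNth (![v, w] : Fin 2 → ℂ) = ![v] := by ext i; fin_cases i; rfl
  rw [r0, r1]
  simp only [Fin.val_zero, pow_zero, one_smul, Fin.val_one, pow_one, neg_smul, ← sub_eq_add_neg]
  rfl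

/-- The differential of a function, as a `1`-form. -/
noncomputable def dFun (u : X → ℂ) : DForm X 1 := oneForm fun x => (mvfderiv 𝓘(ℝ, ℂ) u x).toLinearMap

theorem dFun_inChart {u : X → ℂ} {U : Set X} (hU : IsOpen U)
    (hu : ContMDiffOn 𝓘(ℝ, ℂ) 𝓘(ℝ, ℂ) ∞ u U) {p : X} {z : ℂ} (hz : z ∈ (chartAt ℂ p).target)
    (hzU : (chartAt ℂ p).symm z ∈ U) :
    (dFun u).inChart p z = ContinuousAlternatingMap.ofSubsingleton ℝ ℂ ℂ (0 : Fin 1)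
      (fderiv ℝ (u ∘ (chartAt ℂ p).symm) z) := by
  ext w
  exact mvfderiv_dsymm hz (ContMDiffOn.mdifferentiableAt_real hU hu hzU) (w 0)

theorem dFun_inChart_eventuallyEq {u : X → ℂ} {U : Set X} (hU : IsOpen U)
    (hu : ContMDiffOn 𝓘(ℝ, ℂ) 𝓘(ℝ, ℂ) ∞ u U) {p : X} {z : ℂ} (hz : z ∈ (chartAt ℂ p).target)
    (hzU : (chartAt ℂ p).symm z ∈ U) :
    (dFun u).inChart p =ᶠ[𝓝 z] extDeriv (fun z => ContinuousAlternatingMap.constOfIsEmpty ℝ ℂ (Fin 0)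
      ((u ∘ (chartAt ℂ p).symm) z)) := by
  filter_upwards [(isOpen_target_inter hU p).mem_nhds ⟨hz, hzU⟩] with w hw
  rw [dFun_inChart hU hu hw.1 hw.2, extDeriv_constOfIsEmpty]

theorem contDiffAt_zeroForm {u : X → ℂ} {U : Set X} (hU : IsOpen U)
    (hu : ContMDiffOn 𝓘(ℝ, ℂ) 𝓘(ℝ, ℂ) ∞ u U) {p : X} {z : ℂ} (hz : z ∈ (chartAt ℂ p).target)
    (hzU : (chartAt ℂ p).symm z ∈ U) :
    ContDiffAt ℝ ∞ (fun z => ContinuousAlternatingMap.constOfIsEmpty ℝ ℂ (Fin 0)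
      ((u ∘ (chartAt ℂ p).symm) z)) z := by
  have h1 : ContDiffAt ℝ ∞ (u ∘ (chartAt ℂ p).symm) z :=
    (ContMDiffOn.comp_chart_symm hu p).contDiffAt ((isOpen_target_inter hU p).mem_nhds ⟨hz, hzU⟩)
  exact (ContinuousAlternatingMap.constOfIsEmptyLIE ℝ ℂ ℂ (Fin 0)).contDiff.contDiffAt.comp z h1

theorem smoothOn_dFun {u : X → ℂ} {U : Set X} (hU : IsOpen U)
    (hu : ContMDiffOn 𝓘(ℝ, ℂ) 𝓘(ℝ, ℂ) ∞ u U) : (dFun u).SmoothOn U := by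
  intro p z hz
  have h := contDiffAt_zeroForm hU hu hz.1 hz.2
  refine (ContDiffAt.congr_of_eventuallyEq ?_
    (dFun_inChart_eventuallyEq hU hu hz.1 hz.2)).contDiffWithinAt
  exact contDiffAt_extDeriv h

theorem d_dFun {u : X → ℂ} {U : Set X} (hU : IsOpen U)
    (hu : ContMDiffOn 𝓘(ℝ, ℂ) 𝓘(ℝ, ℂ) ∞ u U) {x : X} (hx : x ∈ U) : (dFun u).d x = 0 := by
  have hx' : (chartAt ℂ x).symm (chartAt ℂ x x) ∈ U := by
    simpa [(chartAt ℂ x).left_inv (mem_chart_source ℂ x)] using hx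
  have hz := mem_chart_target ℂ x
  rw [d_eq, (dFun_inChart_eventuallyEq hU hu hz hx').extDeriv_eq,
    extDeriv_extDeriv_apply (contDiffAt_zeroForm hU hu hz hx')
      (by simpa using WithTop.coe_le_coe.2 (le_top : (2 : ℕ∞) ≤ ⊤))]
  rfl

end Holomorphic

end Charts

/-! ### Integration of two-forms -/

theorem twoForm_apply (a : ℂ [⋀^Fin 2]→L[ℝ] ℂ) (u w : ℂ) :
    a ![u, w] = ((u.re * w.im - u.im * w.re : ℝ) : ℂ) * a ![1, Complex.I] := by
  have hu : u = u.re • (1 : ℂ) + u.im • Complex.I := by apply Complex.ext <;> simp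
  have hw : w = w.re • (1 : ℂ) + w.im • Complex.I := by apply Complex.ext <;> simp
  have add0 : ∀ x y z : ℂ, a ![x + y, z] = a ![x, z] + a ![y, z] := fun x y z =>
    a.toAlternatingMap.map_vecCons_add ![z] x y
  have smul0 : ∀ (c : ℝ) (x z : ℂ), a ![c • x, z] = c • a ![x, z] := fun c x z =>
    a.toAlternatingMap.map_vecCons_smul ![z] c x
  have swap : ∀ x y : ℂ, a ![x, y] = - a ![y, x] := by
    intro x y
    have := a.toAlternatingMap.map_swap ![x, y] (i := 0) (j := 1) (by decide)
    have e : (![x, y] ∘ (Equiv.swap 0 1 : Equiv.Perm (Fin 2))) = ![y, x] := by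
      ext i; fin_cases i <;> rfl
    rw [e] at this
    change a ![y, x] = - a ![x, y] at this
    rw [this, neg_neg]
  have self : ∀ x : ℂ, a ![x, x] = 0 := fun x =>
    a.map_eq_zero_of_eq ![x, x] (i := 0) (j := 1) rfl (by decide)
  conv_lhs => rw [hu, add0, smul0, smul0, swap 1, swap Complex.I, hw, add0, add0, smul0, smul0,
    smul0, smul0, self, self, swap Complex.I]
  push_cast
  simp only [Complex.real_smul]
  ring

/-- On a pair `(v, iv)`, every `2`-form on the plane is `‖v‖²` times its coefficient: this makes
the sign of a real `2`-form on a Riemann surface meaningful. -/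
theorem twoForm_mul_I (a : ℂ [⋀^Fin 2]→L[ℝ] ℂ) (v : ℂ) :
    a ![v, Complex.I * v] = ((‖v‖ ^ 2 : ℝ) : ℂ) * a ![1, Complex.I] := by
  rw [twoForm_apply, ← Complex.normSq_eq_norm_sq, Complex.normSq_apply]
  simp

theorem det_mul_complex (c : ℂ) (L : ℂ →L[ℝ] ℂ) (hL : ∀ w, L w = c * w) : L.det = ‖c‖ ^ 2 := by
  have : (L : ℂ →ₗ[ℝ] ℂ) = LinearMap.mulLeft ℝ c := by ext w; simp [hL]
  rw [ContinuousLinearMap.det, this, ← Complex.normSq_eq_norm_sq, ← Algebra.norm_complex_apply,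
    Algebra.norm_apply]
  rfl

section

open MeasureTheory

variable {X : Type*} [TopologicalSpace X] [ChartedSpace ℂ X] [IsManifold 𝓘(ℂ) ω X]

/-- The coefficient of `dx ∧ dy` of a `2`-form, in the preferred chart at `p`. -/
noncomputable def coeff (α : DForm X 2) (p : X) (z : ℂ) : ℂ := α.inChart p z ![1, Complex.I]

theorem coeff_eq (α : DForm X 2) {p : X} {z : ℂ} (hz : z ∈ (chartAt ℂ p).target) :
    coeff α p z = α ((chartAt ℂ p).symm z) ![dsymm p z 1, mulI (dsymm p z 1)] := by
  have h : (dsymm p z ∘ ![1, Complex.I] : Fin 2 → ℂ) =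
      ![dsymm p z 1, Complex.I * dsymm p z 1] := by
    ext i
    fin_cases i
    · rfl
    · simpa using dsymm_mul_I hz 1
  change (show ℂ [⋀^Fin 2]→L[ℝ] ℂ from α ((chartAt ℂ p).symm z)) (dsymm p z ∘ ![1, Complex.I]) = _
  rw [h]
  rfl

theorem image_transition (p q : X) :
    transition p q '' ((chartAt ℂ p).target ∩ (chartAt ℂ p).symm ⁻¹' (chartAt ℂ q).source) =
      (chartAt ℂ q).target ∩ (chartAt ℂ q).symm ⁻¹' (chartAt ℂ p).source := by
  have key : ∀ {p q : X} {z : ℂ}, z ∈ (chartAt ℂ p).target ∩ (chartAt ℂ p).symm ⁻¹'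
      (chartAt ℂ q).source → transition p q z ∈ (chartAt ℂ q).target ∩
        (chartAt ℂ q).symm ⁻¹' (chartAt ℂ p).source := by
    intro p q z hz
    refine ⟨(chartAt ℂ q).map_source hz.2, ?_⟩
    simp only [transition, Function.comp, mem_preimage]
    rw [(chartAt ℂ q).left_inv hz.2]
    exact (chartAt ℂ p).map_target hz.1
  apply Subset.antisymm
  · rintro _ ⟨z, hz, rfl⟩
    exact key hz
  · intro w hw
    exact ⟨transition q p w, key hw, transition_transition hw.1 hw.2⟩

/-- Change of variables between two charts: the real Jacobian of a holomorphic map is the squared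
modulus of its derivative, which is the factor by which coefficients of `2`-forms change. -/
theorem integral_coeff_change (α : DForm X 2) (h : X → ℂ) (p q : X) :
    ∫ z in (chartAt ℂ p).target ∩ (chartAt ℂ p).symm ⁻¹' (chartAt ℂ q).source,
        h ((chartAt ℂ p).symm z) * coeff α p z =
      ∫ z in (chartAt ℂ q).target ∩ (chartAt ℂ q).symm ⁻¹' (chartAt ℂ p).source,
        h ((chartAt ℂ q).symm z) * coeff α q z := by
  set s := (chartAt ℂ p).target ∩ (chartAt ℂ p).symm ⁻¹' (chartAt ℂ q).source with hs
  rw [← image_transition p q, integral_image_eq_integral_abs_det_fderiv_smul volume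
    (f' := fun z => fderiv ℝ (transition p q) z) (isOpen_transition_source p q).measurableSet]
  · refine setIntegral_congr_fun (isOpen_transition_source p q).measurableSet ?_
    intro z hz
    have hy : (chartAt ℂ q).symm (transition p q z) = (chartAt ℂ p).symm z :=
      (chartAt ℂ q).left_inv hz.2
    have hc : coeff α p z = ((‖deriv (transition p q) z‖ ^ 2 : ℝ) : ℂ) *
        coeff α q (transition p q z) := by
      rw [coeff, inChart_transition α hz.1 hz.2, coeff, ← twoForm_mul_I]
      change (α.inChart q (transition p q z)) (fderiv ℝ (transition p q) z ∘ ![1, Complex.I]) = _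
      congr 1
      ext i
      fin_cases i
      · simpa using fderiv_transition_apply hz.1 hz.2 1
      · simpa [mul_comm] using fderiv_transition_apply hz.1 hz.2 Complex.I
    simp only
    rw [hy, hc, det_mul_complex _ _ (fderiv_transition_apply hz.1 hz.2), abs_of_nonneg (by positivity),
      Complex.real_smul]
    ring
  · intro z hz
    exact (differentiableAt_transition hz.1 hz.2).hasFDerivAt.hasFDerivWithinAt
  · intro z hz w hw hzw
    rw [← transition_transition hz.1 hz.2, ← transition_transition hw.1 hw.2, hzw]

theorem continuousOn_coeff {α : DForm X 2} {U : Set X} (hα : α.SmoothOn U) (p : X) :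
    ContinuousOn (coeff α p) ((chartAt ℂ p).target ∩ (chartAt ℂ p).symm ⁻¹' U) := by
  intro z hz
  have h := ((hα p).continuousOn z hz)
  exact (ContinuousAlternatingMap.apply ℝ ℂ ℂ
    (![1, Complex.I] : Fin 2 → ℂ)).continuous.continuousAt.comp_continuousWithinAt h

theorem isCompact_image_tsupport [CompactSpace X] {χ : X → ℝ} {p : X}
    (hχ : tsupport χ ⊆ (chartAt ℂ p).source) : IsCompact (chartAt ℂ p '' tsupport χ) :=
  ((isClosed_tsupport χ).isCompact).image_of_continuousOn ((chartAt ℂ p).continuousOn.mono hχ)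

theorem integrableOn_cutoff [CompactSpace X] {χ : X → ℝ} {p : X} (hc : Continuous χ)
    (hχ : tsupport χ ⊆ (chartAt ℂ p).source) {g : ℂ → ℂ} (hg : ContinuousOn g (chartAt ℂ p).target) :
    IntegrableOn (fun z => (χ ((chartAt ℂ p).symm z) : ℂ) * g z) (chartAt ℂ p).target := by
  have hK := isCompact_image_tsupport hχ
  have hsub : chartAt ℂ p '' tsupport χ ⊆ (chartAt ℂ p).target := by
    rintro _ ⟨x, hx, rfl⟩
    exact (chartAt ℂ p).map_source (hχ hx)
  have hcont : ContinuousOn (fun z => (χ ((chartAt ℂ p).symm z) : ℂ) * g z)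
      (chartAt ℂ p).target := by
    refine ContinuousOn.mul ?_ hg
    exact (Complex.continuous_ofReal.comp hc).comp_continuousOn (chartAt ℂ p).continuousOn_symm
  have h1 : IntegrableOn (fun z => (χ ((chartAt ℂ p).symm z) : ℂ) * g z)
      (chartAt ℂ p '' tsupport χ) := (hcont.mono hsub).integrableOn_compact hK
  refine h1.of_forall_sdiff_eq_zero (chartAt ℂ p).open_target.measurableSet ?_
  intro z hz
  have : χ ((chartAt ℂ p).symm z) = 0 := by
    by_contra hne
    refine hz.2 ⟨(chartAt ℂ p).symm z, subset_tsupport _ hne, (chartAt ℂ p).right_inv hz.1⟩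
  simp [this]

variable [T2Space X] [CompactSpace X]

variable (X) in
/-- The partition of unity used in the definition of the integral. -/
noncomputable def chartPartition : SmoothPartitionOfUnity X 𝓘(ℝ, ℂ) X univ :=
  Classical.choose (SmoothPartitionOfUnity.exists_isSubordinate_chartAt_source 𝓘(ℝ, ℂ) X)

theorem tsupport_chartPartition (p : X) : tsupport (chartPartition X p) ⊆ (chartAt ℂ p).source :=
  Classical.choose_spec (SmoothPartitionOfUnity.exists_isSubordinate_chartAt_source 𝓘(ℝ, ℂ) X) p

theorem integral_def (α : DForm X 2) : integral α = ∑ᶠ p : X, ∫ z in (chartAt ℂ p).target,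
    (chartPartition X p ((chartAt ℂ p).symm z) : ℂ) * coeff α p z := rfl

theorem finite_chartPartition : {p : X | (Function.support (chartPartition X p)).Nonempty}.Finite :=
  (chartPartition X).locallyFinite.finite_nonempty_of_compact

variable (X) in
/-- The charts that contribute to the integral. -/
noncomputable def chartIndices : Finset X := (finite_chartPartition (X := X)).toFinset

theorem chartPartition_eq_zero {p : X} (hp : p ∉ chartIndices X) (x : X) :
    chartPartition X p x = 0 := by
  by_contra h
  exact hp ((Set.Finite.mem_toFinset _).2 ⟨x, h⟩)

theorem integral_eq_sum (α : DForm X 2) : integral α = ∑ p ∈ chartIndices X,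
    ∫ z in (chartAt ℂ p).target,
      (chartPartition X p ((chartAt ℂ p).symm z) : ℂ) * coeff α p z := by
  rw [integral_def]
  refine finsum_eq_sum_of_support_subset _ fun p hp => ?_
  by_contra hn
  refine hp ?_
  simp [chartPartition_eq_zero hn]

theorem sum_chartPartition (x : X) : ∑ p ∈ chartIndices X, chartPartition X p x = 1 := by
  rw [← (chartPartition X).sum_eq_one (mem_univ x)]
  refine (finsum_eq_sum_of_support_subset _ fun p hp => ?_).symm
  by_contra hn
  exact hp (chartPartition_eq_zero hn x)

theorem continuousOn_coeff_univ {α : DForm X 2} (hα : α.SmoothOn univ) (p : X) :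
    ContinuousOn (coeff α p) (chartAt ℂ p).target := by
  simpa using continuousOn_coeff hα p

theorem integrableOn_chartPartition {α : DForm X 2} (hα : α.SmoothOn univ) (p : X) :
    IntegrableOn (fun z => (chartPartition X p ((chartAt ℂ p).symm z) : ℂ) * coeff α p z)
      (chartAt ℂ p).target :=
  integrableOn_cutoff (chartPartition X p).contMDiff.continuous (tsupport_chartPartition p)
    (continuousOn_coeff_univ hα p)

theorem integral_sub {α β : DForm X 2} (hα : α.SmoothOn univ) (hβ : β.SmoothOn univ) :
    integral (α - β) = integral α - integral β := by
  simp only [integral_eq_sum, ← Finset.sum_sub_distrib]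
  refine Finset.sum_congr rfl fun p _ => ?_
  rw [← MeasureTheory.integral_sub (integrableOn_chartPartition hα p)
    (integrableOn_chartPartition hβ p)]
  congr 1
  ext z
  rw [← mul_sub]
  rfl

theorem integral_smul (c : ℂ) (α : DForm X 2) : integral (c • α) = c * integral α := by
  simp only [integral_eq_sum, Finset.mul_sum, ← MeasureTheory.integral_const_mul]
  refine Finset.sum_congr rfl fun p _ => ?_
  congr 1
  ext z
  have : coeff (c • α) p z = c * coeff α p z := rfl
  rw [this]
  ring

/-- The integral of a non-negative form is non-negative, and vanishes only if the form does. -/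
theorem integral_nonneg {α : DForm X 2} (hα : α.SmoothOn univ)
    (h : ∀ (x : X) (v : TangentSpace 𝓘(ℝ, ℂ) x), ∃ t : ℝ, 0 ≤ t ∧ α x ![v, mulI v] = t) :
    ∃ T : ℝ, 0 ≤ T ∧ integral α = T ∧ (T = 0 → α = 0) := by
  have hre : ∀ p, ∀ z ∈ (chartAt ℂ p).target,
      0 ≤ (coeff α p z).re ∧ coeff α p z = ((coeff α p z).re : ℂ) := by
    intro p z hz
    obtain ⟨t, ht, e⟩ := h _ (dsymm p z 1)
    rw [coeff_eq α hz, e]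
    simpa using ht
  have hρ : ∀ p x, 0 ≤ chartPartition X p x := fun p x => (chartPartition X).nonneg p x
  set T : X → ℝ := fun p => ∫ z in (chartAt ℂ p).target,
    chartPartition X p ((chartAt ℂ p).symm z) * (coeff α p z).re with hT
  have hTnn : ∀ p, 0 ≤ T p := fun p => setIntegral_nonneg (chartAt ℂ p).open_target.measurableSet
    fun z hz => mul_nonneg (hρ p _) (hre p z hz).1
  have e1 : ∀ p, ∫ z in (chartAt ℂ p).target,
      (chartPartition X p ((chartAt ℂ p).symm z) : ℂ) * coeff α p z = (T p : ℂ) := by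
    intro p
    rw [hT, ← integral_complex_ofReal]
    refine setIntegral_congr_fun (chartAt ℂ p).open_target.measurableSet fun z hz => ?_
    rw [Complex.ofReal_mul, ← (hre p z hz).2]
  refine ⟨∑ p ∈ chartIndices X, T p, Finset.sum_nonneg fun p _ => hTnn p, ?_, ?_⟩
  · rw [integral_eq_sum]
    push_cast
    exact Finset.sum_congr rfl fun p _ => e1 p
  · intro h0
    have hz0 := (Finset.sum_eq_zero_iff_of_nonneg fun p _ => hTnn p).1 h0
    have hvan : ∀ p ∈ chartIndices X, ∀ z ∈ (chartAt ℂ p).target,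
        chartPartition X p ((chartAt ℂ p).symm z) * (coeff α p z).re = 0 := by
      intro p hp
      have hint : IntegrableOn (fun z => chartPartition X p ((chartAt ℂ p).symm z) *
          (coeff α p z).re) (chartAt ℂ p).target := by
        refine IntegrableOn.congr_fun (integrableOn_chartPartition hα p).re (fun z hz => ?_)
          (chartAt ℂ p).open_target.measurableSet
        simp
      have hae := (setIntegral_eq_zero_iff_of_nonneg_ae
        (ae_restrict_of_forall_mem (chartAt ℂ p).open_target.measurableSet
          fun z hz => mul_nonneg (hρ p _) (hre p z hz).1) hint).1 (hz0 p hp)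
      have hcont : ContinuousOn (fun z => chartPartition X p ((chartAt ℂ p).symm z) *
          (coeff α p z).re) (chartAt ℂ p).target :=
        ((chartPartition X p).contMDiff.continuous.comp_continuousOn (chartAt ℂ p).continuousOn_symm).mul
          (Complex.continuous_re.comp_continuousOn (continuousOn_coeff_univ hα p))
      exact Measure.eqOn_open_of_ae_eq hae (chartAt ℂ p).open_target hcont continuousOn_const
    funext x
    obtain ⟨p, hp⟩ := (chartPartition X).exists_pos_of_mem (mem_univ x)
    have hpi : p ∈ chartIndices X := by
      by_contra hn
      rw [chartPartition_eq_zero hn] at hp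
      exact lt_irrefl _ hp
    have hxs : x ∈ (chartAt ℂ p).source :=
      tsupport_chartPartition p (subset_tsupport _ hp.ne')
    have hzt := (chartAt ℂ p).map_source hxs
    have hinv := (chartAt ℂ p).left_inv hxs
    have h1 := hvan p hpi _ hzt
    rw [hinv] at h1
    have h2 : coeff α p (chartAt ℂ p x) = 0 := by
      rw [(hre p _ hzt).2, (mul_eq_zero.1 h1).resolve_left hp.ne', Complex.ofReal_zero]
    let a : X → ℂ [⋀^Fin 2]→L[ℝ] ℂ := α
    have h3 : coeff α p (chartAt ℂ p x) = a ((chartAt ℂ p).symm (chartAt ℂ p x))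
        ![dsymm p (chartAt ℂ p x) 1, Complex.I * dsymm p (chartAt ℂ p x) 1] := coeff_eq α hzt
    rw [hinv, h2, twoForm_mul_I] at h3
    have h4 : a x ![1, Complex.I] = 0 := by
      refine (mul_eq_zero.1 h3.symm).resolve_left ?_
      exact_mod_cast pow_ne_zero 2 (norm_ne_zero_iff.2 (dsymm_one_ne_zero hzt))
    change a x = 0
    ext w
    have hw : w = ![w 0, w 1] := by ext i; fin_cases i <;> rfl
    rw [hw, twoForm_apply, h4, mul_zero]
    rfl

/-! ### Stokes' theorem -/

/-- The integral of the derivative of a compactly supported function in a fixed direction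
vanishes. -/
theorem integral_fderiv_eq_zero {g : ℂ → ℂ} (hg : ContDiff ℝ 1 g) (hs : HasCompactSupport g) (v : ℂ) :
    ∫ z, fderiv ℝ g z v = 0 := by
  have hc : Continuous fun z => fderiv ℝ g z v :=
    (hg.continuous_fderiv (by simp)).clm_apply continuous_const
  have hcs : HasCompactSupport fun z => fderiv ℝ g z v := hs.fderiv_apply (𝕜 := ℝ) v
  have := integral_mul_fderiv_eq_neg_fderiv_mul_of_integrable (𝕜 := ℂ) (μ := volume)
    (f := fun _ : ℂ => (1 : ℂ)) (g := g) (v := v) (by simp)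
    (by simpa using hc.integrable_of_hasCompactSupport hcs)
    (by simpa using hg.continuous.integrable_of_hasCompactSupport hs)
    (fun x _ => differentiableAt_const _) (fun x _ => (hg.differentiable (by simp)) x)
  simpa using this

/-- The product of a `1`-form by a function of the partition of unity. -/
noncomputable def cutForm (B : DForm X 1) (q : X) : DForm X 1 :=
  fun x => (chartPartition X q x : ℂ) • B x

theorem smoothOn_cutForm {B : DForm X 1} (hB : B.SmoothOn univ) (q : X) :
    (cutForm B q).SmoothOn univ := by
  intro p
  have h1 := ContMDiffOn.comp_chart_symm ((chartPartition X q).contMDiff.contMDiffOn (s := univ)) p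
  have h2 : ContDiffOn ℝ ∞ (fun z => (chartPartition X q ((chartAt ℂ p).symm z) : ℂ))
      ((chartAt ℂ p).target ∩ (chartAt ℂ p).symm ⁻¹' univ) :=
    Complex.ofRealCLM.contDiff.comp_contDiffOn h1
  exact h2.smul (hB p)

theorem d_zero {n : ℕ} (x : X) : (0 : DForm X n).d x = 0 := by
  have h0 : (0 : DForm X n).SmoothOn univ := fun p => contDiffOn_const (c := 0)
  have := d_sub isOpen_univ h0 h0 (mem_univ x)
  rwa [sub_self, sub_self] at this

theorem cutForm_d_eq_zero {B : DForm X 1} {q x : X} (hx : x ∉ tsupport (chartPartition X q)) :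
    (cutForm B q).d x = 0 := by
  rw [d_congr (isClosed_tsupport (chartPartition X q)).isOpen_compl (β := 0) ?_ hx, d_zero]
  intro y hy
  have : chartPartition X q y = 0 := by
    by_contra h
    exact hy (subset_tsupport _ h)
  simp only [cutForm, this, Complex.ofReal_zero]
  exact zero_smul ℂ (show ℂ [⋀^Fin 1]→L[ℝ] ℂ from B y)

/-- Stokes' theorem for a form supported in one chart, with the integral taken in this chart. -/
theorem setIntegral_coeff_cutForm_d {B : DForm X 1} (hB : B.SmoothOn univ) (q : X) :
    ∫ z in (chartAt ℂ q).target, coeff (cutForm B q).d q z = 0 := by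
  set T := (chartAt ℂ q).target with hT
  have hTo : IsOpen T := (chartAt ℂ q).open_target
  set K := chartAt ℂ q '' tsupport (chartPartition X q) with hK
  have hKc : IsCompact K := isCompact_image_tsupport (tsupport_chartPartition q)
  have hsm := smoothOn_cutForm hB q
  -- the components of the form, extended by zero to the plane
  set b : ℂ → ℂ → ℂ := fun w => T.indicator fun z => (cutForm B q).inChart q z ![w] with hb
  have hbK : ∀ w, ∀ z ∉ K, b w z = 0 := by
    intro w z hz
    by_cases hzT : z ∈ T
    · have h0 : chartPartition X q ((chartAt ℂ q).symm z) = 0 := by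
        by_contra h
        exact hz ⟨_, subset_tsupport _ h, (chartAt ℂ q).right_inv hzT⟩
      have h1 : (cutForm B q).inChart q z = (0 : DForm X 1).inChart q z :=
        inChart_congr (by
          simp only [cutForm, h0, Complex.ofReal_zero]
          exact zero_smul ℂ (show ℂ [⋀^Fin 1]→L[ℝ] ℂ from B _))
      rw [hb]
      simp only
      rw [indicator_of_mem hzT, h1]
      rfl
    · exact indicator_of_notMem hzT _
  have hbT : ∀ w, ∀ z ∈ T, b w =ᶠ[𝓝 z] fun z => (cutForm B q).inChart q z ![w] := by
    intro w z hz
    filter_upwards [hTo.mem_nhds hz] with y hy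
    exact indicator_of_mem hy _
  have hb0 : ∀ w, ∀ z ∉ K, b w =ᶠ[𝓝 z] fun _ => 0 := by
    intro w z hz
    filter_upwards [hKc.isClosed.isOpen_compl.mem_nhds hz] with y hy
    exact hbK w y hy
  have hKT : K ⊆ T := by
    rintro _ ⟨x, hx, rfl⟩
    exact (chartAt ℂ q).map_source (tsupport_chartPartition q hx)
  have hdiff : ∀ z ∈ T, ContDiffAt ℝ ∞ ((cutForm B q).inChart q) z := fun z hz =>
    hsm.contDiffAt isOpen_univ hz (mem_univ _)
  have hbs : ∀ w, ContDiff ℝ 1 (b w) := by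
    intro w
    rw [contDiff_iff_contDiffAt]
    intro z
    by_cases hz : z ∈ K
    · refine ContDiffAt.congr_of_eventuallyEq ?_ (hbT w z (hKT hz))
      exact ((hdiff z (hKT hz)).of_le (by simp)).continuousLinearMap_comp
        (ContinuousAlternatingMap.apply ℝ ℂ ℂ (![w] : Fin 1 → ℂ))
    · exact contDiffAt_const.congr_of_eventuallyEq (hb0 w z hz)
  have hbc : ∀ w, HasCompactSupport (b w) := fun w => HasCompactSupport.intro hKc (hbK w)
  have hco : ∀ z ∈ T, coeff (cutForm B q).d q z =
      fderiv ℝ (b Complex.I) z 1 - fderiv ℝ (b 1) z Complex.I := by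
    intro z hz
    rw [coeff, inChart_d isOpen_univ hsm hz (mem_univ _),
      extDeriv_apply ((hdiff z hz).differentiableAt (by simp)), Fin.sum_univ_two,
      (hbT Complex.I z hz).fderiv_eq, (hbT 1 z hz).fderiv_eq]
    have r0 : (0 : Fin 2).removeNth (![1, Complex.I] : Fin 2 → ℂ) = ![Complex.I] := by
      ext i; fin_cases i; rfl
    have r1 : (1 : Fin 2).removeNth (![1, Complex.I] : Fin 2 → ℂ) = ![1] := by
      ext i; fin_cases i; rfl
    rw [r0, r1]
    simp [sub_eq_add_neg]
  have hint : ∀ w v, Integrable fun z => fderiv ℝ (b w) z v := fun w v =>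
    (((hbs w).continuous_fderiv (by simp)).clm_apply
      continuous_const).integrable_of_hasCompactSupport ((hbc w).fderiv_apply (𝕜 := ℝ) v)
  rw [setIntegral_congr_fun hTo.measurableSet hco,
    setIntegral_eq_integral_of_forall_compl_eq_zero, MeasureTheory.integral_sub (hint _ _) (hint _ _),
    integral_fderiv_eq_zero (hbs _) (hbc _), integral_fderiv_eq_zero (hbs _) (hbc _), sub_zero]
  intro z hz
  have hzK : z ∉ K := fun h => hz (hKT h)
  rw [(hb0 _ z hzK).fderiv_eq, (hb0 _ z hzK).fderiv_eq]
  simp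

theorem integral_cutForm_d {B : DForm X 1} (hB : B.SmoothOn univ) (q : X) :
    integral (cutForm B q).d = 0 := by
  have hsm : (cutForm B q).d.SmoothOn univ := (smoothOn_cutForm hB q).d isOpen_univ
  have hvan : ∀ p : X, ∀ z, (chartAt ℂ p).symm z ∉ tsupport (chartPartition X q) →
      coeff (cutForm B q).d p z = 0 := by
    intro p z hz
    have h1 : (cutForm B q).d.inChart p z = (0 : DForm X 2).inChart p z :=
      inChart_congr (cutForm_d_eq_zero hz)
    rw [coeff, h1]
    rfl
  -- all the integrals defining the integral can be computed in the chart at `q`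
  have key : ∀ p, ∫ z in (chartAt ℂ p).target,
      (chartPartition X p ((chartAt ℂ p).symm z) : ℂ) * coeff (cutForm B q).d p z =
      ∫ z in (chartAt ℂ q).target,
        (chartPartition X p ((chartAt ℂ q).symm z) : ℂ) * coeff (cutForm B q).d q z := by
    intro p
    have h := integral_coeff_change (cutForm B q).d (fun x => (chartPartition X p x : ℂ)) p q
    rw [setIntegral_eq_of_subset_of_forall_sdiff_eq_zero
      (chartAt ℂ p).open_target.measurableSet inter_subset_left, h,
      setIntegral_eq_of_subset_of_forall_sdiff_eq_zero
      (chartAt ℂ q).open_target.measurableSet inter_subset_left]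
    · rintro z ⟨hz, hz'⟩
      have : chartPartition X p ((chartAt ℂ q).symm z) = 0 := by
        by_contra hne
        exact hz' ⟨hz, tsupport_chartPartition p (subset_tsupport _ hne)⟩
      simp [this]
    · rintro z ⟨hz, hz'⟩
      rw [hvan p z fun hn => hz' ⟨hz, tsupport_chartPartition q hn⟩, mul_zero]
  rw [integral_eq_sum, Finset.sum_congr rfl fun p _ => key p, ← integral_finsetSum]
  · rw [← setIntegral_coeff_cutForm_d hB q]
    congr 1
    ext z
    rw [← Finset.sum_mul, ← Complex.ofReal_sum, sum_chartPartition, Complex.ofReal_one, one_mul]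
  · intro p _
    have hcont : ContinuousOn (fun z => (chartPartition X p ((chartAt ℂ q).symm z) : ℂ) *
        coeff (cutForm B q).d q z) (chartAt ℂ q).target := by
      refine ContinuousOn.mul ?_ (continuousOn_coeff_univ hsm q)
      exact (Complex.continuous_ofReal.comp
        (chartPartition X p).contMDiff.continuous).comp_continuousOn (chartAt ℂ q).continuousOn_symm
    have hsub : chartAt ℂ q '' tsupport (chartPartition X q) ⊆ (chartAt ℂ q).target := by
      rintro _ ⟨x, hx, rfl⟩
      exact (chartAt ℂ q).map_source (tsupport_chartPartition q hx)
    refine ((hcont.mono hsub).integrableOn_compact (isCompact_image_tsupport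
      (tsupport_chartPartition q))).of_forall_sdiff_eq_zero
      (chartAt ℂ q).open_target.measurableSet ?_
    rintro z ⟨hz, hz'⟩
    rw [hvan q z fun hn => hz' ⟨_, hn, (chartAt ℂ q).right_inv hz⟩, mul_zero]

/-- Stokes' theorem on a compact Riemann surface. -/
theorem integral_d {B : DForm X 1} (hB : B.SmoothOn univ) : integral B.d = 0 := by
  have key : ∀ s : Finset X, (B - ∑ q ∈ s, cutForm B q).SmoothOn univ ∧
      integral (B - ∑ q ∈ s, cutForm B q).d = integral B.d := by
    classical
    intro s
    induction s using Finset.induction_on with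
    | empty => simpa using hB
    | insert q s hq ih =>
      have e : B - ∑ q ∈ insert q s, cutForm B q = (B - ∑ q ∈ s, cutForm B q) - cutForm B q := by
        rw [Finset.sum_insert hq]; abel
      have hc := smoothOn_cutForm hB q
      have hd : (B - ∑ q ∈ insert q s, cutForm B q).d =
          (B - ∑ q ∈ s, cutForm B q).d - (cutForm B q).d := by
        funext x
        rw [e]
        exact d_sub isOpen_univ ih.1 hc (mem_univ x)
      refine ⟨?_, ?_⟩
      · rw [e]
        exact ih.1.sub hc
      · rw [hd, integral_sub (ih.1.d isOpen_univ) (hc.d isOpen_univ), ih.2, integral_cutForm_d hB,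
          sub_zero]
  -- once all the indices are removed, nothing is left of the form
  have h0 : B - ∑ q ∈ chartIndices X, cutForm B q = 0 := by
    funext x
    have : (∑ q ∈ chartIndices X, cutForm B q) x = B x := by
      rw [Finset.sum_apply]
      simp only [cutForm]
      rw [← Finset.sum_smul, ← Complex.ofReal_sum, sum_chartPartition, Complex.ofReal_one, one_smul]
    rw [Pi.sub_apply, this, sub_self, Pi.zero_apply]
  rw [← (key (chartIndices X)).2, h0]
  have h1 : (0 : DForm X 1).d = B.d - B.d := by
    funext x
    rw [sub_self, d_zero, Pi.zero_apply]
  rw [h1, integral_sub (hB.d isOpen_univ) (hB.d isOpen_univ), sub_self]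

end

/-! ### Derivatives of complex functions on the surface -/

section Functions

variable {X : Type*} [TopologicalSpace X] [ChartedSpace ℂ X]

theorem MDifferentiableAt.differentiableAt_chart {E : Type*} [NormedAddCommGroup E]
    [NormedSpace ℝ E] {g : X → E} {x : X} (hg : MDifferentiableAt 𝓘(ℝ, ℂ) 𝓘(ℝ, E) g x) :
    DifferentiableAt ℝ (g ∘ (chartAt ℂ x).symm) (chartAt ℂ x x) := by
  have := (mdifferentiableAt_iff g x).1 hg |>.2
  simp only [mfld_simps, differentiableWithinAt_univ] at this
  exact this

theorem mdifferentiableAt_of_chart {E : Type*} [NormedAddCommGroup E]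
    [NormedSpace ℝ E] {g : X → E} {x : X} (hc : ContinuousAt g x)
    (hg : DifferentiableAt ℝ (g ∘ (chartAt ℂ x).symm) (chartAt ℂ x x)) :
    MDifferentiableAt 𝓘(ℝ, ℂ) 𝓘(ℝ, E) g x := by
  rw [mdifferentiableAt_iff]
  refine ⟨hc, ?_⟩
  simp only [mfld_simps, differentiableWithinAt_univ]
  exact hg

variable [IsManifold 𝓘(ℂ) ω X]

theorem mvfderiv_mul_complex {f g : X → ℂ} {x : X} (hf : MDifferentiableAt 𝓘(ℝ, ℂ) 𝓘(ℝ, ℂ) f x)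
    (hg : MDifferentiableAt 𝓘(ℝ, ℂ) 𝓘(ℝ, ℂ) g x) (v : TangentSpace 𝓘(ℝ, ℂ) x) :
    mvfderiv 𝓘(ℝ, ℂ) (fun y => f y * g y) x v =
      f x * mvfderiv 𝓘(ℝ, ℂ) g x v + mvfderiv 𝓘(ℝ, ℂ) f x v * g x := by
  have hf' := MDifferentiableAt.differentiableAt_chart hf
  have hg' := MDifferentiableAt.differentiableAt_chart hg
  have hfg : MDifferentiableAt 𝓘(ℝ, ℂ) 𝓘(ℝ, ℂ) (fun y => f y * g y) x :=
    mdifferentiableAt_of_chart (hf.continuousAt.mul hg.continuousAt) (hf'.mul hg')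
  rw [mvfderiv_eq_fderiv_chart hfg v, mvfderiv_eq_fderiv_chart hf v, mvfderiv_eq_fderiv_chart hg v]
  have e : (fun y => f y * g y) ∘ (chartAt ℂ x).symm =
    (f ∘ (chartAt ℂ x).symm) * (g ∘ (chartAt ℂ x).symm) := rfl
  rw [e, fderiv_mul hf' hg']
  have h1 : (f ∘ (chartAt ℂ x).symm) (chartAt ℂ x x) = f x := by
    simp [(chartAt ℂ x).left_inv (mem_chart_source ℂ x)]
  have h2 : (g ∘ (chartAt ℂ x).symm) (chartAt ℂ x x) = g x := by
    simp [(chartAt ℂ x).left_inv (mem_chart_source ℂ x)]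
  rw [h1, h2]
  change f x * fderiv ℝ (g ∘ (chartAt ℂ x).symm) (chartAt ℂ x x) v +
    g x * fderiv ℝ (f ∘ (chartAt ℂ x).symm) (chartAt ℂ x x) v = _
  rw [mul_comm (g x)]

theorem mvfderiv_add_complex {f g : X → ℂ} {x : X} (hf : MDifferentiableAt 𝓘(ℝ, ℂ) 𝓘(ℝ, ℂ) f x)
    (hg : MDifferentiableAt 𝓘(ℝ, ℂ) 𝓘(ℝ, ℂ) g x) (v : TangentSpace 𝓘(ℝ, ℂ) x) :
    mvfderiv 𝓘(ℝ, ℂ) (fun y => f y + g y) x v =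
      mvfderiv 𝓘(ℝ, ℂ) f x v + mvfderiv 𝓘(ℝ, ℂ) g x v := by
  rw [mvfderiv_fun_add hf hg]
  rfl

theorem mvfderiv_const_complex (c : ℂ) (x : X) (v : TangentSpace 𝓘(ℝ, ℂ) x) :
    mvfderiv 𝓘(ℝ, ℂ) (fun _ : X => c) x v = 0 := by
  rw [mvfderiv_const]
  rfl

theorem mdifferentiableAt_add_complex {f g : X → ℂ} {x : X}
    (hf : MDifferentiableAt 𝓘(ℝ, ℂ) 𝓘(ℝ, ℂ) f x) (hg : MDifferentiableAt 𝓘(ℝ, ℂ) 𝓘(ℝ, ℂ) g x) :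
    MDifferentiableAt 𝓘(ℝ, ℂ) 𝓘(ℝ, ℂ) (fun y => f y + g y) x :=
  hf.add hg

theorem mvfderiv_sum_complex {ι : Type*} (s : Finset ι) {f : ι → X → ℂ} {x : X}
    (hf : ∀ i, MDifferentiableAt 𝓘(ℝ, ℂ) 𝓘(ℝ, ℂ) (f i) x) (v : TangentSpace 𝓘(ℝ, ℂ) x) :
    MDifferentiableAt 𝓘(ℝ, ℂ) 𝓘(ℝ, ℂ) (fun y => ∑ i ∈ s, f i y) x ∧
    mvfderiv 𝓘(ℝ, ℂ) (fun y => ∑ i ∈ s, f i y) x v = ∑ i ∈ s, mvfderiv 𝓘(ℝ, ℂ) (f i) x v := by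
  classical
  induction s using Finset.induction_on with
  | empty =>
    simp only [Finset.sum_empty]
    exact ⟨mdifferentiableAt_const, mvfderiv_const_complex 0 x v⟩
  | insert i s hi ih =>
    simp only [Finset.sum_insert hi]
    exact ⟨mdifferentiableAt_add_complex (hf i) ih.1,
      by rw [mvfderiv_add_complex (hf i) ih.1, ih.2]⟩

theorem contMDiffOn_mul_complex {f g : X → ℂ} {U : Set X}
    (hf : ContMDiffOn 𝓘(ℝ, ℂ) 𝓘(ℝ, ℂ) ∞ f U) (hg : ContMDiffOn 𝓘(ℝ, ℂ) 𝓘(ℝ, ℂ) ∞ g U) :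
    ContMDiffOn 𝓘(ℝ, ℂ) 𝓘(ℝ, ℂ) ∞ (fun y => f y * g y) U := by
  have h : ContDiff ℝ ∞ fun p : ℂ × ℂ => p.1 * p.2 := contDiff_fst.mul contDiff_snd
  exact h.contMDiff.comp_contMDiffOn (hf.prodMk_space hg)

theorem contMDiffOn_sum_complex {ι : Type*} (s : Finset ι) {f : ι → X → ℂ} {U : Set X}
    (hf : ∀ i ∈ s, ContMDiffOn 𝓘(ℝ, ℂ) 𝓘(ℝ, ℂ) ∞ (f i) U) :
    ContMDiffOn 𝓘(ℝ, ℂ) 𝓘(ℝ, ℂ) ∞ (fun y => ∑ i ∈ s, f i y) U := by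
  classical
  induction s using Finset.induction_on with
  | empty => simpa using contMDiffOn_const
  | insert i s hi ih =>
    simp only [Finset.sum_insert hi]
    exact (hf i (Finset.mem_insert_self _ _)).add
      (ih fun j hj => hf j (Finset.mem_insert_of_mem hj))

end Functions

/-! ### Smooth and holomorphic sections -/

section Sections

variable {X : Type*} [TopologicalSpace X] [ChartedSpace ℂ X]
  {F : Type*} [NormedAddCommGroup F] [NormedSpace ℂ F]
  {V : X → Type*} [∀ x, AddCommGroup (V x)] [∀ x, Module ℂ (V x)] [∀ x, TopologicalSpace (V x)]
  [TopologicalSpace (TotalSpace F V)] [FiberBundle F V]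

variable (F) in
/-- A section in the preferred trivialization at `x`. -/
noncomputable def coord (x : X) (s : ∀ x, V x) (y : X) : F :=
  (trivializationAt F V x (TotalSpace.mk' F y (s y))).2

theorem smoothSectionOn_iff {s : ∀ x, V x} {U : Set X} (hU : IsOpen U) :
    SmoothSectionOn F s U ↔ ∀ x ∈ U, ContMDiffAt 𝓘(ℝ, ℂ) 𝓘(ℝ, F) ∞ (coord F x s) x := by
  constructor
  · intro h x hx
    exact (contMDiffAt_section x).1 (h.contMDiffAt (hU.mem_nhds hx))
  · intro h x hx
    exact ((contMDiffAt_section x).2 (h x hx)).contMDiffWithinAt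

theorem SmoothSectionOn.mono {s : ∀ x, V x} {U U' : Set X} (hs : SmoothSectionOn F s U)
    (h : U' ⊆ U) : SmoothSectionOn F s U' := ContMDiffOn.mono hs h

theorem SmoothSectionOn.congr {s t : ∀ x, V x} {U : Set X} (hs : SmoothSectionOn F s U)
    (h : ∀ x ∈ U, t x = s x) : SmoothSectionOn F t U :=
  ContMDiffOn.congr hs fun x hx => by rw [h x hx]

theorem HolomorphicSectionOn.mono {s : ∀ x, V x} {U U' : Set X} (hs : HolomorphicSectionOn F s U)
    (h : U' ⊆ U) : HolomorphicSectionOn F s U' := MDifferentiableOn.mono hs h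

variable [VectorBundle ℂ F V]

theorem coord_add {x y : X} (hy : y ∈ (trivializationAt F V x).baseSet) (s t : ∀ x, V x) :
    coord F x (fun y => s y + t y) y = coord F x s y + coord F x t y :=
  ((trivializationAt F V x).linear ℂ hy).map_add _ _

theorem coord_smul {x y : X} (hy : y ∈ (trivializationAt F V x).baseSet) (c : ℂ) (s : ∀ x, V x) :
    coord F x (fun y => c • s y) y = c • coord F x s y :=
  ((trivializationAt F V x).linear ℂ hy).map_smul _ _

theorem coord_zero {x y : X} (hy : y ∈ (trivializationAt F V x).baseSet) :
    coord F x (fun y => (0 : V y)) y = 0 :=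
  ((trivializationAt F V x).linear ℂ hy).map_zero

theorem eventually_baseSet (x : X) : ∀ᶠ y in 𝓝 x, y ∈ (trivializationAt F V x).baseSet :=
  (trivializationAt F V x).open_baseSet.mem_nhds (mem_baseSet_trivializationAt F V x)

theorem smoothSectionOn_zero {U : Set X} (hU : IsOpen U) :
    SmoothSectionOn F (fun x => (0 : V x)) U := by
  rw [smoothSectionOn_iff hU]
  intro x hx
  refine (contMDiffAt_const (c := (0 : F))).congr_of_eventuallyEq ?_
  filter_upwards [eventually_baseSet (F := F) (V := V) x] with y hy
  exact coord_zero hy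

theorem SmoothSectionOn.add {s t : ∀ x, V x} {U : Set X} (hU : IsOpen U)
    (hs : SmoothSectionOn F s U) (ht : SmoothSectionOn F t U) :
    SmoothSectionOn F (fun y => s y + t y) U := by
  rw [smoothSectionOn_iff hU] at hs ht ⊢
  intro x hx
  refine ((hs x hx).add (ht x hx)).congr_of_eventuallyEq ?_
  filter_upwards [eventually_baseSet (F := F) (V := V) x] with y hy
  exact coord_add hy s t

theorem SmoothSectionOn.smul {g : X → ℂ} {s : ∀ x, V x} {U : Set X} (hU : IsOpen U)
    (hg : ContMDiffOn 𝓘(ℝ, ℂ) 𝓘(ℝ, ℂ) ∞ g U) (hs : SmoothSectionOn F s U) :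
    SmoothSectionOn F (fun y => g y • s y) U := by
  rw [smoothSectionOn_iff hU] at hs ⊢
  intro x hx
  have hsm : ContDiff ℝ ∞ fun p : ℂ × F => p.1 • p.2 := contDiff_fst.smul contDiff_snd
  refine (hsm.contMDiff.contMDiffAt.comp x
    ((hg.contMDiffAt (hU.mem_nhds hx)).prodMk_space (hs x hx))).congr_of_eventuallyEq ?_
  filter_upwards [eventually_baseSet (F := F) (V := V) x] with y hy
  exact coord_smul hy (g y) s

theorem SmoothSectionOn.sum {ι : Type*} (I : Finset ι) {s : ι → ∀ x, V x} {U : Set X}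
    (hU : IsOpen U) (hs : ∀ i, SmoothSectionOn F (s i) U) :
    SmoothSectionOn F (fun y => ∑ i ∈ I, s i y) U := by
  classical
  induction I using Finset.induction_on with
  | empty => simpa using smoothSectionOn_zero hU
  | insert i I hi ih =>
    simp only [Finset.sum_insert hi]
    exact SmoothSectionOn.add hU (hs i) ih

theorem SmoothSectionOn.sum_smul {ι : Type*} [Fintype ι] {g : ι → X → ℂ} {s : ι → ∀ x, V x}
    {U : Set X} (hU : IsOpen U) (hg : ∀ i, ContMDiffOn 𝓘(ℝ, ℂ) 𝓘(ℝ, ℂ) ∞ (g i) U)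
    (hs : ∀ i, SmoothSectionOn F (s i) U) :
    SmoothSectionOn F (fun y => ∑ i, g i y • s i y) U :=
  SmoothSectionOn.sum _ hU fun i => (hs i).smul hU (hg i)

theorem SmoothSectionOn.neg {s : ∀ x, V x} {U : Set X} (hU : IsOpen U)
    (hs : SmoothSectionOn F s U) : SmoothSectionOn F (fun y => - s y) U := by
  have := hs.smul hU (contMDiffOn_const (c := (-1 : ℂ)))
  simpa using this

theorem SmoothSectionOn.sub {s t : ∀ x, V x} {U : Set X} (hU : IsOpen U)
    (hs : SmoothSectionOn F s U) (ht : SmoothSectionOn F t U) :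
    SmoothSectionOn F (fun y => s y - t y) U := by
  simpa [sub_eq_add_neg] using hs.add hU (ht.neg hU)

section Holo

variable [IsManifold 𝓘(ℂ) ω X]

theorem mdifferentiableAt_complex_iff {g : X → F} {x : X} :
    MDifferentiableAt 𝓘(ℂ) 𝓘(ℂ, F) g x ↔
      ContinuousAt g x ∧ DifferentiableAt ℂ (g ∘ (chartAt ℂ x).symm) (chartAt ℂ x x) := by
  rw [mdifferentiableAt_iff]
  refine and_congr_right fun _ => ?_
  simp only [mfld_simps, differentiableWithinAt_univ]
  rfl

/-- In a trivialization and a chart, a holomorphic section is a holomorphic function of one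
variable, hence it is analytic. -/
theorem HolomorphicSectionOn.smooth [FiniteDimensional ℂ F] [ContMDiffVectorBundle ω F V 𝓘(ℂ)]
    {s : ∀ x, V x} {U : Set X} (hU : IsOpen U) (hs : HolomorphicSectionOn F s U) :
    SmoothSectionOn F s U := by
  have : CompleteSpace F := FiniteDimensional.complete ℂ F
  have : ContMDiffVectorBundle 1 F V 𝓘(ℂ) := inferInstance
  rw [smoothSectionOn_iff hU]
  intro x hx
  set e := trivializationAt F V x
  have hUe : IsOpen (U ∩ e.baseSet) := hU.inter e.open_baseSet
  have h1 : MDifferentiableOn 𝓘(ℂ) 𝓘(ℂ, F) (coord F x s) (U ∩ e.baseSet) :=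
    (e.mdifferentiableOn_section_iff hUe inter_subset_right).1 (hs.mono inter_subset_left)
  have h2 : DifferentiableOn ℂ (coord F x s ∘ (chartAt ℂ x).symm)
      ((chartAt ℂ x).target ∩ (chartAt ℂ x).symm ⁻¹' (U ∩ e.baseSet)) := by
    rw [← mdifferentiableOn_iff_differentiableOn]
    exact h1.comp (((contMDiffOn_chart_symm (I := 𝓘(ℂ)) (n := ω)).mdifferentiableOn
      (by simp)).mono inter_subset_left) fun z hz => hz.2
  have hopen := (chartAt ℂ x).symm.isOpen_inter_preimage hUe
  have h3 : ContDiffOn ℝ ∞ (coord F x s ∘ (chartAt ℂ x).symm)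
      ((chartAt ℂ x).target ∩ (chartAt ℂ x).symm ⁻¹' (U ∩ e.baseSet)) :=
    (h2.contDiffOn (n := ∞) hopen).restrict_scalars ℝ
  have hxx : (chartAt ℂ x).symm (chartAt ℂ x x) = x :=
    (chartAt ℂ x).left_inv (mem_chart_source ℂ x)
  have hxU : x ∈ U ∩ e.baseSet := ⟨hx, mem_baseSet_trivializationAt F V x⟩
  have hmem : chartAt ℂ x x ∈ (chartAt ℂ x).target ∩ (chartAt ℂ x).symm ⁻¹' (U ∩ e.baseSet) :=
    ⟨mem_chart_target ℂ x, by rw [mem_preimage, hxx]; exact hxU⟩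
  rw [contMDiffAt_iff]
  refine ⟨(h1.mdifferentiableAt (hUe.mem_nhds hxU)).continuousAt, ?_⟩
  simp only [mfld_simps, contDiffWithinAt_univ]
  exact (h3.contDiffAt (hopen.mem_nhds hmem))

/-- The Cauchy–Riemann equation for sections, at one point. -/
theorem dbar_eq_zero_iff {s : ∀ x, V x} {U : Set X} (hU : IsOpen U) (hs : SmoothSectionOn F s U)
    {x : X} (hx : x ∈ U) :
    (∀ v : TangentSpace 𝓘(ℝ, ℂ) x, dbar F s x v = 0) ↔
      MDifferentiableAt 𝓘(ℂ) (𝓘(ℂ).prod 𝓘(ℂ, F)) (fun x => TotalSpace.mk' F x (s x)) x := by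
  have hsm := (smoothSectionOn_iff hU).1 hs x hx
  have hmd : MDifferentiableAt 𝓘(ℝ, ℂ) 𝓘(ℝ, F) (coord F x s) x := hsm.mdifferentiableAt (by simp)
  have hdr := MDifferentiableAt.differentiableAt_chart hmd
  set L := fderiv ℝ (coord F x s ∘ (chartAt ℂ x).symm) (chartAt ℂ x x) with hL
  rw [mdifferentiableAt_section]
  have e1 : MDifferentiableAt 𝓘(ℂ) 𝓘(ℂ, F)
      (fun b => (trivializationAt F V x (TotalSpace.mk' F b (s b))).2) x ↔
      DifferentiableAt ℂ (coord F x s ∘ (chartAt ℂ x).symm) (chartAt ℂ x x) := by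
    refine mdifferentiableAt_complex_iff.trans ?_
    exact and_iff_right hsm.continuousAt
  rw [e1, differentiableAt_complex_iff_differentiableAt_real, and_iff_right hdr]
  have hd : ∀ v : ℂ, dbar F s x v = (trivializationAt F V x).symm x
      ((1 / 2 : ℂ) • (L v + Complex.I • L (Complex.I * v))) := by
    intro v
    have h1 := mvfderiv_eq_fderiv_chart hmd v
    have h2 := mvfderiv_eq_fderiv_chart hmd (Complex.I * v)
    rw [hL, ← h1, ← h2]
    rfl
  have hmem := mem_baseSet_trivializationAt F V x
  have hsymm : ∀ u : F, (trivializationAt F V x).symm x u = 0 ↔ u = 0 := by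
    intro u
    rw [← (trivializationAt F V x).linearEquivAt_symm_apply (R := ℂ) x hmem,
      LinearEquiv.map_eq_zero_iff]
  constructor
  · intro h
    have h1 := h (1 : ℂ)
    rw [hd, hsymm, smul_eq_zero_iff_right (by norm_num), mul_one] at h1
    have h2 : L 1 = - (Complex.I • L Complex.I) := eq_neg_of_add_eq_zero_left h1
    rw [h2, smul_neg, smul_smul, Complex.I_mul_I, neg_one_smul, neg_neg]
  · intro h v
    have hlin : ∀ w : ℂ, L w = w • L 1 := by
      intro w
      have hw : w = w.re • (1 : ℂ) + w.im • Complex.I := by apply Complex.ext <;> simp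
      change L Complex.I = Complex.I • L 1 at h
      conv_lhs => rw [hw, map_add, map_smul, map_smul, h]
      conv_rhs => rw [hw, add_smul, smul_assoc, smul_assoc, one_smul]
    refine (hd v).trans ?_
    rw [hsymm]
    obtain ⟨c, hc⟩ : ∃ c : ℂ, c = v := ⟨v, rfl⟩
    change (1 / 2 : ℂ) • (L v + Complex.I • L (Complex.I * (show ℂ from v))) = 0
    rw [← hc, hlin c, hlin (Complex.I * c), smul_smul, ← mul_assoc, Complex.I_mul_I, neg_one_mul,
      neg_smul, add_neg_cancel, smul_zero]

theorem HolomorphicSectionOn.dbar_eq_zero [FiniteDimensional ℂ F]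
    [ContMDiffVectorBundle ω F V 𝓘(ℂ)] {s : ∀ x, V x} {U : Set X} (hU : IsOpen U)
    (hs : HolomorphicSectionOn F s U) {x : X} (hx : x ∈ U) (v : TangentSpace 𝓘(ℝ, ℂ) x) :
    dbar F s x v = 0 :=
  (dbar_eq_zero_iff hU (hs.smooth hU) hx).2 (MDifferentiableOn.mdifferentiableAt hs (hU.mem_nhds hx)) v

theorem holomorphicSectionOn_of_dbar {s : ∀ x, V x} {U : Set X} (hU : IsOpen U)
    (hs : SmoothSectionOn F s U) (h : ∀ x ∈ U, ∀ v : TangentSpace 𝓘(ℝ, ℂ) x, dbar F s x v = 0) :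
    HolomorphicSectionOn F s U :=
  fun x hx => ((dbar_eq_zero_iff hU hs hx).1 (h x hx)).mdifferentiableWithinAt

end Holo

/-! ### Connections act locally -/

variable [IsManifold 𝓘(ℂ) ω X] (D : Connection F V)

/-- A connection is a local operator. Its axioms only concern sections with prescribed behaviour
on an open set, so locality has to be derived from the Leibniz rule. -/
theorem Connection.congr {s t : ∀ x, V x} {U : Set X} (hU : IsOpen U)
    (hs : SmoothSectionOn F s U) (h : ∀ x ∈ U, t x = s x) {x : X} (hx : x ∈ U)
    (v : TangentSpace 𝓘(ℝ, ℂ) x) : D.toFun t x v = D.toFun s x v := by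
  classical
  -- the difference is the product of itself by a function that vanishes on `U`
  let g : X → ℂ := fun y => if y ∈ U then 0 else 1
  have hg : ContMDiffOn 𝓘(ℝ, ℂ) 𝓘(ℝ, ℂ) ∞ g U :=
    (contMDiffOn_const (c := (0 : ℂ))).congr fun y hy => if_pos hy
  have hd : SmoothSectionOn F (fun y => t y - s y) U :=
    (smoothSectionOn_zero hU).congr fun y hy => by rw [h y hy, sub_self]
  have e1 : t = fun y => s y + (t y - s y) := by funext y; abel
  have e2 : (fun y => t y - s y) = fun y => g y • (t y - s y) := by
    funext y
    by_cases hy : y ∈ U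
    · rw [h y hy, sub_self, smul_zero]
    · simp [g, hy]
  have hg0 : mvfderiv 𝓘(ℝ, ℂ) g x v = 0 := by
    have : g =ᶠ[𝓝 x] fun _ => (0 : ℂ) := by
      filter_upwards [hU.mem_nhds hx] with y hy
      exact if_pos hy
    rw [mvfderiv_congr this]
    exact mvfderiv_const_complex 0 x v
  have e3 : D.toFun (fun y => t y - s y) x v = 0 := by
    rw [e2, D.leibniz U hU g _ hg hd x hx v, hg0, show g x = 0 from if_pos hx, zero_smul, zero_smul,
      add_zero]
  conv_lhs => rw [e1]
  rw [D.add U hU s _ hs hd x hx v, e3, add_zero]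

theorem Connection.map_sub {s t : ∀ x, V x} {U : Set X} (hU : IsOpen U)
    (hs : SmoothSectionOn F s U) (ht : SmoothSectionOn F t U) {x : X} (hx : x ∈ U)
    (v : TangentSpace 𝓘(ℝ, ℂ) x) :
    D.toFun (fun y => s y - t y) x v = D.toFun s x v - D.toFun t x v := by
  have h := D.add U hU _ t (hs.sub hU ht) ht x hx v
  simp only [sub_add_cancel] at h
  exact eq_sub_of_add_eq h.symm

theorem Connection.map_zero {U : Set X} (hU : IsOpen U) {x : X} (hx : x ∈ U)
    (v : TangentSpace 𝓘(ℝ, ℂ) x) : D.toFun (fun y => (0 : V y)) x v = 0 := by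
  have h := D.add U hU _ _ (smoothSectionOn_zero hU) (smoothSectionOn_zero hU) x hx v
  simpa using h

theorem Connection.map_sum_smul {ι : Type*} [Fintype ι] {g : ι → X → ℂ} {s : ι → ∀ x, V x}
    {U : Set X} (hU : IsOpen U) (hg : ∀ i, ContMDiffOn 𝓘(ℝ, ℂ) 𝓘(ℝ, ℂ) ∞ (g i) U)
    (hs : ∀ i, SmoothSectionOn F (s i) U) {x : X} (hx : x ∈ U) (v : TangentSpace 𝓘(ℝ, ℂ) x) :
    D.toFun (fun y => ∑ i, g i y • s i y) x v =
      ∑ i, (g i x • D.toFun (s i) x v + (mvfderiv 𝓘(ℝ, ℂ) (g i) x v : ℂ) • s i x) := by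
  classical
  have key : ∀ I : Finset ι, D.toFun (fun y => ∑ i ∈ I, g i y • s i y) x v =
      ∑ i ∈ I, (g i x • D.toFun (s i) x v + (mvfderiv 𝓘(ℝ, ℂ) (g i) x v : ℂ) • s i x) := by
    intro I
    induction I using Finset.induction_on with
    | empty => simpa using D.map_zero hU hx v
    | insert i I hi ih =>
      simp only [Finset.sum_insert hi]
      rw [← ih, D.add U hU _ _ ((hs i).smul hU (hg i))
        (SmoothSectionOn.sum I hU fun i => (hs i).smul hU (hg i)) x hx v,
        D.leibniz U hU _ _ (hg i) (hs i) x hx v]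
  exact key Finset.univ

end Sections

/-! ### Hermitian forms on a vector space -/

section Hermitian

variable {E : Type*} [AddCommGroup E] [Module ℂ E] {B : E →ₗ[ℂ] E →ₛₗ[starRingEnd ℂ] ℂ}

theorem hermitian_self_eq_zero (hp : ∀ u, u ≠ 0 → 0 < (B u u).re) {u : E} (h : B u u = 0) :
    u = 0 := by
  by_contra hu
  have := hp u hu
  rw [h] at this
  exact lt_irrefl _ this

/-- Linear independence is detected by the Gram determinant; for sections this makes it an open
condition. -/
theorem gram_det_ne_zero_iff (hp : ∀ u, u ≠ 0 → 0 < (B u u).re) {r : ℕ} (e : Fin r → E) :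
    (Matrix.of fun a b => B (e a) (e b)).det ≠ 0 ↔ LinearIndependent ℂ e := by
  have hsum : ∀ (x : Fin r → ℂ) (b : Fin r),
      Matrix.vecMul x (Matrix.of fun a b => B (e a) (e b)) b = B (∑ a, x a • e a) (e b) := by
    intro x b
    simp [Matrix.vecMul, dotProduct, map_sum, LinearMap.sum_apply]
  rw [Ne, ← Matrix.exists_vecMul_eq_zero_iff, Fintype.linearIndependent_iff]
  constructor
  · intro h x hx i
    by_contra hi
    refine h ⟨x, fun h0 => hi (congrFun h0 i), ?_⟩
    funext b
    rw [hsum, hx]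
    simp
  · rintro h ⟨x, hx, h0⟩
    refine hx (funext fun i => h x ?_ i)
    refine hermitian_self_eq_zero hp (B := B) ?_
    have : ∀ b, B (∑ a, x a • e a) (e b) = 0 := fun b => by rw [← hsum, h0]; rfl
    rw [map_sum (B (∑ a, x a • e a))]
    simp only [LinearMap.map_smulₛₗ, this, smul_zero, Finset.sum_const_zero]

/-- The inner product space structure, conjugate linear in the first variable as in Mathlib, of a
positive definite Hermitian form. -/
@[reducible] noncomputable def hermitianCore (hs : ∀ u v, B u v = starRingEnd ℂ (B v u))
    (hp : ∀ u, u ≠ 0 → 0 < (B u u).re) : InnerProductSpace.Core ℂ E where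
  inner u v := B v u
  conj_inner_symm u v := (hs v u).symm
  re_inner_nonneg u := by
    by_cases hu : u = 0
    · simp [hu]
    · exact (hp u hu).le
  add_left u v w := by simp
  smul_left u v c := by simp
  definite u h := hermitian_self_eq_zero hp h

theorem exists_orthogonal_decomposition (hs : ∀ u v, B u v = starRingEnd ℂ (B v u))
    (hp : ∀ u, u ≠ 0 → 0 < (B u u).re) (W : Submodule ℂ E) [FiniteDimensional ℂ W] (u : E) :
    ∃ p ∈ W, ∀ w ∈ W, B (u - p) w = 0 := by
  let c := hermitianCore hs hp
  let : NormedAddCommGroup E := c.toNormedAddCommGroup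
  let : InnerProductSpace ℂ E := InnerProductSpace.ofCore c.toCore
  refine ⟨W.starProjection u, Submodule.starProjection_apply_mem _ _, fun w hw => ?_⟩
  exact (Submodule.mem_orthogonal _ _).1 (Submodule.sub_starProjection_mem_orthogonal (K := W) u) w hw

theorem exists_orthonormal_basis (hs : ∀ u v, B u v = starRingEnd ℂ (B v u))
    (hp : ∀ u, u ≠ 0 → 0 < (B u u).re) (W : Submodule ℂ E) [FiniteDimensional ℂ W] :
    ∃ (n : ℕ) (f : Fin n → E), (∀ k, f k ∈ W) ∧ ∀ w ∈ W, w = ∑ k, B w (f k) • f k := by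
  let c := hermitianCore hs hp
  let : NormedAddCommGroup E := c.toNormedAddCommGroup
  let : InnerProductSpace ℂ E := InnerProductSpace.ofCore c.toCore
  let b := stdOrthonormalBasis ℂ W
  refine ⟨_, fun k => (b k : E), fun k => (b k).2, fun w hw => ?_⟩
  have := congrArg (Subtype.val) (b.sum_repr' ⟨w, hw⟩)
  simp only [Submodule.coe_sum, Submodule.coe_smul] at this
  exact this.symm

/-- The Hermitian form induced on linear maps is positive: if `e` and `d` are dual bases of a
subspace, then `∑ ⟨d b, d a⟩ ⟨β a, β b⟩` is the squared Hilbert–Schmidt norm of the linear map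
that sends each `e a` to `β a`. -/
theorem hilbertSchmidt_nonneg (hs : ∀ u v, B u v = starRingEnd ℂ (B v u))
    (hp : ∀ u, u ≠ 0 → 0 < (B u u).re) {r : ℕ} (W : Submodule ℂ E) [FiniteDimensional ℂ W]
    {e d : Fin r → E} (he : ∀ a, e a ∈ W) (hd : ∀ a, d a ∈ W)
    (hed : ∀ a b, B (e b) (d a) = if b = a then 1 else 0) (β : Fin r → E) :
    ∃ n : ℝ, 0 ≤ n ∧ ∑ a, ∑ b, B (d b) (d a) * B (β a) (β b) = n ∧ (n = 0 ↔ ∀ a, β a = 0) := by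
  obtain ⟨m, f, hf, hexp⟩ := exists_orthonormal_basis hs hp W
  have hnn : ∀ u, 0 ≤ (B u u).re ∧ B u u = ((B u u).re : ℂ) := by
    intro u
    refine ⟨?_, ?_⟩
    · by_cases hu : u = 0
      · simp [hu]
      · exact (hp u hu).le
    · exact (Complex.conj_eq_iff_re.1 (hs u u).symm).symm
  -- the images of an orthonormal basis
  set t : Fin m → E := fun k => ∑ a, B (f k) (d a) • β a with ht
  have hpars : ∀ a b, B (d b) (d a) = ∑ k, B (f k) (d a) * starRingEnd ℂ (B (f k) (d b)) := by
    intro a b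
    conv_lhs => rw [hexp (d b) (hd b)]
    simp only [map_sum, LinearMap.sum_apply, map_smul, LinearMap.smul_apply, smul_eq_mul]
    refine Finset.sum_congr rfl fun k _ => ?_
    rw [← hs (d b) (f k), mul_comm]
  have hsum : ∑ a, ∑ b, B (d b) (d a) * B (β a) (β b) = ∑ k, B (t k) (t k) := by
    simp only [ht, map_sum, LinearMap.sum_apply, map_smul, LinearMap.smul_apply, smul_eq_mul,
      LinearMap.map_smulₛₗ, hpars, Finset.sum_mul, Finset.mul_sum]
    calc _ = ∑ a, ∑ k, ∑ b, B (f k) (d a) * starRingEnd ℂ (B (f k) (d b)) * B (β a) (β b) :=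
          Finset.sum_congr rfl fun a _ => Finset.sum_comm
      _ = ∑ k, ∑ a, ∑ b, B (f k) (d a) * starRingEnd ℂ (B (f k) (d b)) * B (β a) (β b) :=
          Finset.sum_comm
      _ = _ := by
          refine Finset.sum_congr rfl fun k _ => ?_
          rw [Finset.sum_comm]
          refine Finset.sum_congr rfl fun a _ => Finset.sum_congr rfl fun b _ => ?_
          ring
  refine ⟨∑ k, (B (t k) (t k)).re, Finset.sum_nonneg fun k _ => (hnn _).1, ?_, ?_⟩
  · rw [hsum, Complex.ofReal_sum]
    exact Finset.sum_congr rfl fun k _ => (hnn _).2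
  · rw [Finset.sum_eq_zero_iff_of_nonneg fun k _ => (hnn _).1]
    constructor
    · intro h b
      have ht0 : ∀ k, t k = 0 := fun k => hermitian_self_eq_zero hp (B := B) <| by
        rw [(hnn (t k)).2, h k (Finset.mem_univ k), Complex.ofReal_zero]
      have : β b = ∑ k, B (e b) (f k) • t k := by
        simp only [ht, Finset.smul_sum, smul_smul]
        rw [Finset.sum_comm]
        simp only [← Finset.sum_smul]
        have hδ : ∀ a, ∑ k, B (e b) (f k) * B (f k) (d a) = if b = a then 1 else 0 := by
          intro a
          rw [← hed a b]
          conv_rhs => rw [hexp (e b) (he b)]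
          simp [map_sum, LinearMap.sum_apply]
        simp [hδ]
      rw [this]
      simp [ht0]
    · intro h k _
      simp [ht, h]

end Hermitian

/-! ### The derivative of the determinant -/

section Det

variable {r : ℕ}

theorem contDiff_det : ContDiff ℝ ∞ fun M : Fin r → Fin r → ℂ => (Matrix.of M).det := by
  simp only [Matrix.det_apply, Matrix.of_apply]
  refine ContDiff.sum fun σ _ => ContDiff.const_smul _ ?_
  refine contDiff_prod fun i _ => ?_
  fun_prop

theorem contDiffAt_inv_apply {M : Fin r → Fin r → ℂ} (hM : (Matrix.of M).det ≠ 0) (a b : Fin r) :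
    ContDiffAt ℝ ∞ (fun M : Fin r → Fin r → ℂ => (Matrix.of M)⁻¹ a b) M := by
  have e : (fun M : Fin r → Fin r → ℂ => (Matrix.of M)⁻¹ a b) = fun M : Fin r → Fin r → ℂ =>
      ((Matrix.of M).det)⁻¹ * (Matrix.of fun i j =>
        (Matrix.of M).updateRow b (Pi.single a 1) i j).det := by
    funext M
    rw [Matrix.inv_def, Ring.inverse_eq_inv', Matrix.smul_apply, Matrix.adjugate_apply, smul_eq_mul]
    rfl
  rw [e]
  refine ContDiffAt.mul (contDiff_det.contDiffAt.inv hM) ?_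
  refine (contDiff_det.comp ?_).contDiffAt
  refine contDiff_pi.2 fun i => contDiff_pi.2 fun j => ?_
  by_cases hi : i = b
  · subst hi
    simp only [Matrix.updateRow_self]
    exact contDiff_const
  · simp only [Matrix.updateRow_ne hi, Matrix.of_apply]
    fun_prop

/-- Jacobi's formula. -/
theorem fderiv_det {M : Fin r → Fin r → ℂ} (hM : (Matrix.of M).det ≠ 0) (N : Fin r → Fin r → ℂ) :
    fderiv ℝ (fun M : Fin r → Fin r → ℂ => (Matrix.of M).det) M N =
      (Matrix.of M).det * ((Matrix.of M)⁻¹ * Matrix.of N).trace := by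
  have hdiff : DifferentiableAt ℝ (fun M : Fin r → Fin r → ℂ => (Matrix.of M).det) M :=
    contDiff_det.contDiffAt.differentiableAt (by simp)
  set A := (Matrix.of M)⁻¹ * Matrix.of N with hA
  have hline : ∀ t : ℝ, (Matrix.of (M + t • N)).det =
      (Matrix.of M).det * Polynomial.eval (t : ℂ)
        (1 + (Polynomial.X : Polynomial ℂ) • A.map Polynomial.C).det := by
    intro t
    have h1 : (Matrix.of (M + t • N)) = Matrix.of M * (1 + (t : ℂ) • A) := by
      rw [mul_add, mul_one, Matrix.mul_smul, hA, Matrix.mul_nonsing_inv_cancel_left _ _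
        (isUnit_iff_ne_zero.2 hM)]
      ext i j
      simp
    rw [h1, Matrix.det_mul]
    congr 1
    rw [← Polynomial.coe_evalRingHom, RingHom.map_det]
    congr 1
    ext i j
    by_cases hij : i = j <;> simp [hij] <;> exact mul_comm _ _
  have h1 : HasDerivAt (fun t : ℝ => (Matrix.of (M + t • N)).det)
      (fderiv ℝ (fun M : Fin r → Fin r → ℂ => (Matrix.of M).det) M N) 0 := by
    have h2 : HasFDerivAt (fun M : Fin r → Fin r → ℂ => (Matrix.of M).det)
        (fderiv ℝ (fun M : Fin r → Fin r → ℂ => (Matrix.of M).det) M) (M + (0 : ℝ) • N) := by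
      rw [zero_smul, add_zero]; exact hdiff.hasFDerivAt
    have h3 : HasDerivAt (fun t : ℝ => M + t • N) N 0 := by
      simpa using ((hasDerivAt_id (0 : ℝ)).smul_const N).const_add M
    exact h2.comp_hasDerivAt (0 : ℝ) h3
  have h4 : HasDerivAt (fun t : ℝ => (Matrix.of (M + t • N)).det)
      ((Matrix.of M).det * A.trace) 0 := by
    simp only [hline]
    have h5 := Polynomial.hasDerivAt (1 + (Polynomial.X : Polynomial ℂ) • A.map Polynomial.C).det
      ((0 : ℝ) : ℂ)
    rw [Complex.ofReal_zero, Matrix.derivative_det_one_add_X_smul] at h5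
    have h6 := HasDerivAt.comp_ofReal (z := (0 : ℝ)) (by simpa using h5)
    exact h6.const_mul _
  exact h1.unique h4

end Det

/-! ### Holomorphic frames and their duals -/

section Frames

variable {X : Type*} [TopologicalSpace X] [ChartedSpace ℂ X]
  {F : Type*} [NormedAddCommGroup F] [NormedSpace ℂ F]
  {V : X → Type*} [∀ x, AddCommGroup (V x)] [∀ x, Module ℂ (V x)] [∀ x, TopologicalSpace (V x)]
  [TopologicalSpace (TotalSpace F V)] [FiberBundle F V]
  (H : HermitianMetric F V)

/-- The Gram matrix of a family of sections. -/
noncomputable def gram {r : ℕ} (e : Fin r → ∀ x, V x) (x : X) : Matrix (Fin r) (Fin r) ℂ :=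
  Matrix.of fun a b => H.inner x (e a x) (e b x)

/-- The frame dual to `e` with respect to the metric, in the span of `e`; as the metric is
conjugate linear in its second variable, the coefficients are conjugates of those of the inverse
Gram matrix. -/
noncomputable def dualFrame {r : ℕ} (e : Fin r → ∀ x, V x) (a : Fin r) (x : X) : V x :=
  ∑ c, starRingEnd ℂ ((gram H e x)⁻¹ c a) • e c x

section Algebra

variable {H} {r : ℕ} {W : ∀ x, Submodule ℂ (V x)} {U : Set X} {e : Fin r → ∀ x, V x}

theorem gram_det_ne_zero_iff_section (e : Fin r → ∀ x, V x) (x : X) :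
    (gram H e x).det ≠ 0 ↔ LinearIndependent ℂ fun a => e a x :=
  gram_det_ne_zero_iff (H.pos x) fun a => e a x

theorem IsHolomorphicFrame.gram_det_ne_zero (he : IsHolomorphicFrame F W U e) {x : X}
    (hx : x ∈ U) : (gram H e x).det ≠ 0 :=
  (gram_det_ne_zero_iff_section e x).2 (he.linearIndependent x hx)

theorem IsHolomorphicFrame.mem (he : IsHolomorphicFrame F W U e) {x : X} (hx : x ∈ U)
    (a : Fin r) : e a x ∈ W x := by
  rw [← he.span_eq x hx]
  exact Submodule.subset_span ⟨a, rfl⟩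

theorem IsHolomorphicFrame.finiteDimensional (he : IsHolomorphicFrame F W U e) {x : X}
    (hx : x ∈ U) : FiniteDimensional ℂ (W x) := by
  rw [← he.span_eq x hx]
  exact FiniteDimensional.span_of_finite ℂ (Set.finite_range _)

theorem IsHolomorphicFrame.finrank (he : IsHolomorphicFrame F W U e) {x : X}
    (hx : x ∈ U) : Module.finrank ℂ (W x) = r := by
  rw [← he.span_eq x hx, finrank_span_eq_card (he.linearIndependent x hx), Fintype.card_fin]

theorem IsHolomorphicFrame.inner_dualFrame (he : IsHolomorphicFrame F W U e) {x : X} (hx : x ∈ U)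
    (a b : Fin r) : H.inner x (e b x) (dualFrame H e a x) = if b = a then 1 else 0 := by
  have h : (gram H e x * (gram H e x)⁻¹) b a = if b = a then 1 else 0 := by
    rw [Matrix.mul_nonsing_inv _ (isUnit_iff_ne_zero.2 (he.gram_det_ne_zero hx)), Matrix.one_apply]
  rw [← h, Matrix.mul_apply, dualFrame, map_sum]
  refine Finset.sum_congr rfl fun c _ => ?_
  rw [LinearMap.map_smulₛₗ, Complex.conj_conj, smul_eq_mul, mul_comm]
  rfl

theorem IsHolomorphicFrame.dualFrame_mem (he : IsHolomorphicFrame F W U e) {x : X} (hx : x ∈ U)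
    (a : Fin r) : dualFrame H e a x ∈ W x :=
  Submodule.sum_mem _ fun c _ => Submodule.smul_mem _ _ (he.mem hx c)

theorem IsHolomorphicFrame.eq_sum (he : IsHolomorphicFrame F W U e) {x : X} (hx : x ∈ U) {w : V x}
    (hw : w ∈ W x) : w = ∑ b, H.inner x w (dualFrame H e b x) • e b x := by
  rw [← he.span_eq x hx] at hw
  obtain ⟨c, rfl⟩ := (Submodule.mem_span_range_iff_exists_fun ℂ).1 hw
  refine Finset.sum_congr rfl fun b _ => ?_
  congr 1
  simp [map_sum, LinearMap.sum_apply, he.inner_dualFrame hx]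

theorem IsHolomorphicFrame.inner_eq_zero (he : IsHolomorphicFrame F W U e) {x : X} (hx : x ∈ U)
    {u : V x} (h : ∀ b, H.inner x u (e b x) = 0) {w : V x} (hw : w ∈ W x) : H.inner x u w = 0 := by
  rw [he.eq_sum (H := H) hx hw, map_sum]
  exact Finset.sum_eq_zero fun b _ => by rw [LinearMap.map_smulₛₗ, h b, smul_zero]

/-- The component of a vector orthogonal to the fibre of `W`. -/
theorem IsHolomorphicFrame.inner_sub_eq_zero (he : IsHolomorphicFrame F W U e) {x : X} (hx : x ∈ U)
    (u : V x) {w : V x} (hw : w ∈ W x) :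
    H.inner x (u - ∑ b, H.inner x u (dualFrame H e b x) • e b x) w = 0 := by
  have h0 : ∀ a, H.inner x (u - ∑ b, H.inner x u (dualFrame H e b x) • e b x)
      (dualFrame H e a x) = 0 := by
    intro a
    simp [map_sum, LinearMap.sum_apply, he.inner_dualFrame hx]
  have hd : w = ∑ b, starRingEnd ℂ (H.inner x (e b x) w) • dualFrame H e b x := by
    -- both sides lie in the fibre of `W` and have the same products with the frame
    rw [← sub_eq_zero]
    refine hermitian_self_eq_zero (H.pos x) (B := H.inner x) ?_
    refine he.inner_eq_zero hx (fun b => ?_) ?_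
    · rw [H.conj_symm, map_sub, map_sum]
      simp [he.inner_dualFrame hx, apply_ite]
    · exact Submodule.sub_mem _ hw (Submodule.sum_mem _ fun c _ =>
        Submodule.smul_mem _ _ (he.dualFrame_mem hx c))
  rw [hd, map_sum]
  exact Finset.sum_eq_zero fun b _ => by rw [LinearMap.map_smulₛₗ, h0 b, smul_zero]

end Algebra

variable [IsManifold 𝓘(ℂ) ω X] [VectorBundle ℂ F V] [FiniteDimensional ℂ F]
  [ContMDiffVectorBundle ω F V 𝓘(ℂ)]

section Smoothness

variable {H} {r : ℕ} {W : ∀ x, Submodule ℂ (V x)} {U : Set X} {e : Fin r → ∀ x, V x}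

theorem contMDiffOn_matrix {M : X → Matrix (Fin r) (Fin r) ℂ}
    (hM : ∀ a b, ContMDiffOn 𝓘(ℝ, ℂ) 𝓘(ℝ, ℂ) ∞ (fun x => M x a b) U) :
    ContMDiffOn 𝓘(ℝ, ℂ) 𝓘(ℝ, Fin r → Fin r → ℂ) ∞ (fun x a b => M x a b) U :=
  contMDiffOn_pi_space.2 fun a => contMDiffOn_pi_space.2 fun b => hM a b

theorem contMDiffOn_matrix_det {M : X → Matrix (Fin r) (Fin r) ℂ}
    (hM : ∀ a b, ContMDiffOn 𝓘(ℝ, ℂ) 𝓘(ℝ, ℂ) ∞ (fun x => M x a b) U) :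
    ContMDiffOn 𝓘(ℝ, ℂ) 𝓘(ℝ, ℂ) ∞ (fun x => (M x).det) U :=
  contDiff_det.contMDiff.comp_contMDiffOn (contMDiffOn_matrix hM)

theorem contMDiffOn_matrix_inv (hU : IsOpen U) {M : X → Matrix (Fin r) (Fin r) ℂ}
    (hM : ∀ a b, ContMDiffOn 𝓘(ℝ, ℂ) 𝓘(ℝ, ℂ) ∞ (fun x => M x a b) U)
    (hdet : ∀ x ∈ U, (M x).det ≠ 0) (a b : Fin r) :
    ContMDiffOn 𝓘(ℝ, ℂ) 𝓘(ℝ, ℂ) ∞ (fun x => (M x)⁻¹ a b) U := fun x hx =>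
  ((contDiffAt_inv_apply (M := fun a b => M x a b) (hdet x hx) a b).contMDiffAt.comp x
    ((contMDiffOn_matrix hM).contMDiffAt (hU.mem_nhds hx))).contMDiffWithinAt

/-- Jacobi's formula on the surface. -/
theorem mvfderiv_matrix_det (hU : IsOpen U) {M : X → Matrix (Fin r) (Fin r) ℂ}
    (hM : ∀ a b, ContMDiffOn 𝓘(ℝ, ℂ) 𝓘(ℝ, ℂ) ∞ (fun x => M x a b) U) {x : X} (hx : x ∈ U)
    (hdet : (M x).det ≠ 0) (v : TangentSpace 𝓘(ℝ, ℂ) x) :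
    mvfderiv 𝓘(ℝ, ℂ) (fun x => (M x).det) x v =
      (M x).det * ((M x)⁻¹ * Matrix.of fun a b => mvfderiv 𝓘(ℝ, ℂ) (fun x => M x a b) x v).trace := by
  set φ := chartAt ℂ x
  have hm := ContMDiffOn.mdifferentiableAt_real hU (contMDiffOn_matrix hM) hx
  have hdm := ContMDiffOn.mdifferentiableAt_real hU (contMDiffOn_matrix_det hM) hx
  have hxx : φ.symm (φ x) = x := φ.left_inv (mem_chart_source ℂ x)
  have hmc := MDifferentiableAt.differentiableAt_chart hm
  have hdet' : (fun M : Fin r → Fin r → ℂ => (Matrix.of M).det) ∘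
      ((fun x a b => M x a b) ∘ φ.symm) = (fun x => (M x).det) ∘ φ.symm := rfl
  have hMx : ((fun x a b => M x a b) ∘ φ.symm) (φ x) = fun a b => M x a b := by
    simp only [Function.comp, hxx]
  have h1 := mvfderiv_eq_fderiv_chart hdm v
  refine h1.trans ?_
  rw [← hdet', fderiv_comp]
  · rw [hMx]
    refine (fderiv_det (M := fun a b => M x a b) hdet _).trans ?_
    congr 2
    congr 1
    ext a b
    have h2 := mvfderiv_eq_fderiv_chart (ContMDiffOn.mdifferentiableAt_real hU (hM a b) hx) v
    refine Eq.trans ?_ h2.symm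
    let L : (Fin r → Fin r → ℂ) →L[ℝ] ℂ :=
      (ContinuousLinearMap.proj (R := ℝ) (φ := fun _ : Fin r => ℂ) b).comp
        (ContinuousLinearMap.proj (R := ℝ) (φ := fun _ : Fin r => Fin r → ℂ) a)
    have h3 := (L.hasFDerivAt.comp (φ x) hmc.hasFDerivAt).fderiv
    exact (DFunLike.congr_fun h3 v).symm
  · rw [hMx]
    exact contDiff_det.contDiffAt.differentiableAt (by simp)
  · exact hmc

theorem IsHolomorphicFrame.smooth (he : IsHolomorphicFrame F W U e) (hU : IsOpen U) (a : Fin r) :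
    SmoothSectionOn F (e a) U := (he.holomorphic a).smooth hU

theorem IsHolomorphicFrame.mono (he : IsHolomorphicFrame F W U e) {U' : Set X} (h : U' ⊆ U) :
    IsHolomorphicFrame F W U' e :=
  ⟨fun a => (he.holomorphic a).mono h, fun x hx => he.linearIndependent x (h hx),
    fun x hx => he.span_eq x (h hx)⟩

theorem contMDiffOn_conj {g : X → ℂ} (hg : ContMDiffOn 𝓘(ℝ, ℂ) 𝓘(ℝ, ℂ) ∞ g U) :
    ContMDiffOn 𝓘(ℝ, ℂ) 𝓘(ℝ, ℂ) ∞ (fun x => starRingEnd ℂ (g x)) U :=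
  Complex.conjCLE.contDiff.contMDiff.comp_contMDiffOn hg

theorem IsHolomorphicFrame.smooth_dualFrame (he : IsHolomorphicFrame F W U e) (hU : IsOpen U)
    (a : Fin r) : SmoothSectionOn F (dualFrame H e a) U := by
  refine SmoothSectionOn.sum_smul hU (fun c => contMDiffOn_conj ?_) fun c => he.smooth hU c
  exact contMDiffOn_matrix_inv hU (fun a b => H.smooth U hU _ _ (he.smooth hU a) (he.smooth hU b))
    (fun x hx => he.gram_det_ne_zero hx) c a

theorem IsHolomorphicFrame.smooth_inner_dualFrame (he : IsHolomorphicFrame F W U e) (hU : IsOpen U)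
    {s : ∀ x, V x} (hs : SmoothSectionOn F s U) (a : Fin r) :
    ContMDiffOn 𝓘(ℝ, ℂ) 𝓘(ℝ, ℂ) ∞ (fun x => H.inner x (s x) (dualFrame H e a x)) U :=
  H.smooth U hU _ _ hs (he.smooth_dualFrame hU a)

end Smoothness

/-! ### The trace of the connection induced on a subbundle -/

variable (D : Connection F V) {r : ℕ} {W : ∀ x, Submodule ℂ (V x)} {U : Set X}
  {e : Fin r → ∀ x, V x}

/-- `i / 2π` times the trace, over the span of the frame `e`, of the orthogonal projection of the
connection: `v ↦ (i / 2π) ∑ ⟨D_v e_a, e_a^*⟩`. -/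
noncomputable def traceLin (e : Fin r → ∀ x, V x) (x : X) : TangentSpace 𝓘(ℝ, ℂ) x →ₗ[ℝ] ℂ where
  toFun v := Complex.I / (2 * Real.pi) * ∑ a, H.inner x (D.toFun (e a) x v) (dualFrame H e a x)
  map_add' v w := by
    simp only [map_add, LinearMap.add_apply, Finset.sum_add_distrib, mul_add]
  map_smul' c v := by
    have : ∀ a, H.inner x (D.toFun (e a) x (c • v)) (dualFrame H e a x) =
        (c : ℂ) * H.inner x (D.toFun (e a) x v) (dualFrame H e a x) := by
      intro a
      rw [map_smul, ← Complex.coe_smul, map_smul, LinearMap.smul_apply, smul_eq_mul]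
    simp only [this, ← Finset.mul_sum, RingHom.id_apply, Complex.real_smul]
    ring

/-- `i / 2π` times the connection form of the determinant of a subbundle in a local frame. -/
noncomputable def traceForm (e : Fin r → ∀ x, V x) : DForm X 1 := oneForm (traceLin H D e)

variable {H D}

theorem contMDiffOn_traceLin (he : IsHolomorphicFrame F W U e) (hU : IsOpen U) (p : X)
    (w : TangentSpace 𝓘(ℝ, ℂ) p) : ContMDiffOn 𝓘(ℝ, ℂ) 𝓘(ℝ, ℂ) ∞
      (fun y => traceLin H D e y (coordField p w y)) (U ∩ (chartAt ℂ p).source) := by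
  refine contMDiffOn_mul_complex contMDiffOn_const (contMDiffOn_sum_complex _ fun a _ => ?_)
  have ho := hU.inter (chartAt ℂ p).open_source
  exact H.smooth _ ho _ _ (D.smooth U hU _ (he.smooth hU a) p w)
    ((he.smooth_dualFrame hU a).mono inter_subset_left)

theorem smoothOn_traceForm (he : IsHolomorphicFrame F W U e) (hU : IsOpen U) :
    (traceForm H D e).SmoothOn U :=
  smoothOn_oneForm (contMDiffOn_traceLin he hU)

/-- Under a change of frame, the connection form of the determinant changes by the logarithmic
derivative of the determinant of the transition matrix. -/
theorem traceForm_change (hU : IsOpen U) (he : IsHolomorphicFrame F W U e)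
    {e' : Fin r → ∀ x, V x} (he' : IsHolomorphicFrame F W U e')
    {g : X → Matrix (Fin r) (Fin r) ℂ} (hg : ∀ x ∈ U, ∀ a, e' a x = ∑ b, g x b a • e b x)
    {l : X → ℂ} (hl : ContMDiffOn 𝓘(ℝ, ℂ) 𝓘(ℝ, ℂ) ∞ l U)
    (hexp : ∀ x ∈ U, Complex.exp (l x) = (g x).det) {x : X} (hx : x ∈ U)
    (v : TangentSpace 𝓘(ℝ, ℂ) x) :
    traceForm H D e' x ![v] - traceForm H D e x ![v] =
      Complex.I / (2 * Real.pi) * mvfderiv 𝓘(ℝ, ℂ) l x v := by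
  have hgi : ∀ x ∈ U, ∀ a b, g x b a = H.inner x (e' a x) (dualFrame H e b x) := by
    intro x hx a b
    rw [hg x hx a]
    simp [map_sum, LinearMap.sum_apply, he.inner_dualFrame hx]
  have hgs : ∀ b a, ContMDiffOn 𝓘(ℝ, ℂ) 𝓘(ℝ, ℂ) ∞ (fun x => g x b a) U := fun b a =>
    (he.smooth_inner_dualFrame (H := H) hU (he'.smooth hU a) b).congr fun x hx => hgi x hx a b
  have hdet : (g x).det ≠ 0 := by rw [← hexp x hx]; exact Complex.exp_ne_zero _
  -- the derivative of the determinant, computed in two ways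
  have hld : mvfderiv 𝓘(ℝ, ℂ) l x v =
      ((g x)⁻¹ * Matrix.of fun a b => mvfderiv 𝓘(ℝ, ℂ) (fun x => g x a b) x v).trace := by
    have h1 := mvfderiv_matrix_det hU hgs hx hdet v
    have h2 : mvfderiv 𝓘(ℝ, ℂ) (fun x => (g x).det) x v =
        (g x).det * mvfderiv 𝓘(ℝ, ℂ) l x v := by
      have hlm := ContMDiffOn.mdifferentiableAt_real hU hl hx
      have hem : MDifferentiableAt 𝓘(ℝ, ℂ) 𝓘(ℝ, ℂ) (fun x => Complex.exp (l x)) x :=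
        ContMDiffOn.mdifferentiableAt_real hU
          ((Complex.contDiff_exp (𝕜 := ℝ)).contMDiff.comp_contMDiffOn hl) hx
      have e1 : (fun x => (g x).det) =ᶠ[𝓝 x] fun x => Complex.exp (l x) := by
        filter_upwards [hU.mem_nhds hx] with y hy
        exact (hexp y hy).symm
      rw [mvfderiv_congr e1]
      refine (mvfderiv_eq_fderiv_chart hem v).trans ?_
      rw [mvfderiv_eq_fderiv_chart hlm v, ← hexp x hx]
      have h3 := (MDifferentiableAt.differentiableAt_chart hlm).hasFDerivAt.cexp.fderiv
      change fderiv ℝ (fun z => Complex.exp ((l ∘ (chartAt ℂ x).symm) z)) (chartAt ℂ x x) v = _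
      rw [h3]
      have hxx : (l ∘ (chartAt ℂ x).symm) (chartAt ℂ x x) = l x := by
        simp [(chartAt ℂ x).left_inv (mem_chart_source ℂ x)]
      rw [hxx]
      rfl
    rw [h2] at h1
    exact mul_left_cancel₀ hdet h1
  -- the inverse transition matrix
  have hk : (g x)⁻¹ = Matrix.of fun a b => H.inner x (e b x) (dualFrame H e' a x) := by
    refine Matrix.inv_eq_left_inv ?_
    ext a a'
    rw [Matrix.mul_apply, Matrix.one_apply]
    have h1 := he'.inner_dualFrame (H := H) hx a a'
    rw [hg x hx a'] at h1
    simp only [map_sum, LinearMap.sum_apply, map_smul, LinearMap.smul_apply, smul_eq_mul] at h1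
    exact (Finset.sum_congr rfl fun b _ => mul_comm _ _).trans
      (h1.trans (if_congr eq_comm rfl rfl))
  have hdual : ∀ (u : V x) b, ∑ a, g x b a * H.inner x u (dualFrame H e' a x) =
      H.inner x u (dualFrame H e b x) := by
    intro u b
    have h0 : dualFrame H e b x = ∑ a, starRingEnd ℂ (g x b a) • dualFrame H e' a x := by
      rw [← sub_eq_zero]
      refine hermitian_self_eq_zero (H.pos x) (B := H.inner x) ?_
      refine he.inner_eq_zero hx (fun c => ?_) ?_
      · have h1 : (g x * (g x)⁻¹) b c = if b = c then 1 else 0 := by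
          rw [Matrix.mul_nonsing_inv _ (isUnit_iff_ne_zero.2 hdet), Matrix.one_apply]
        rw [H.conj_symm, map_sub, map_sum, he.inner_dualFrame hx]
        rw [hk, Matrix.mul_apply] at h1
        have h2 : ∑ a, H.inner x (e c x) (starRingEnd ℂ (g x b a) • dualFrame H e' a x) =
            if c = b then 1 else 0 := by
          simp only [LinearMap.map_smulₛₗ, Complex.conj_conj, smul_eq_mul]
          exact h1.trans (if_congr eq_comm rfl rfl)
        rw [h2, sub_self, map_zero]
      · exact Submodule.sub_mem _ (he.dualFrame_mem hx b) (Submodule.sum_mem _ fun a _ =>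
          Submodule.smul_mem _ _ (he'.dualFrame_mem hx a))
    rw [h0, map_sum]
    exact Finset.sum_congr rfl fun a _ => by rw [LinearMap.map_smulₛₗ, Complex.conj_conj, smul_eq_mul]
  have hD : ∀ a, D.toFun (e' a) x v = ∑ b, (g x b a • D.toFun (e b) x v +
      (mvfderiv 𝓘(ℝ, ℂ) (fun x => g x b a) x v : ℂ) • e b x) := by
    intro a
    have h1 : SmoothSectionOn F (fun y => ∑ b, g y b a • e b y) U :=
      SmoothSectionOn.sum_smul hU (fun b => hgs b a) fun b => he.smooth hU b
    rw [D.congr hU h1 (fun y hy => hg y hy a) hx v,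
      D.map_sum_smul hU (fun b => hgs b a) (fun b => he.smooth hU b) hx v]
  change Complex.I / (2 * Real.pi) * ∑ a, H.inner x (D.toFun (e' a) x v) (dualFrame H e' a x) -
    Complex.I / (2 * Real.pi) * ∑ a, H.inner x (D.toFun (e a) x v) (dualFrame H e a x) = _
  rw [← mul_sub, hld, hk]
  congr 1
  simp only [hD, map_sum, map_add, map_smul, LinearMap.sum_apply, LinearMap.add_apply,
    LinearMap.smul_apply, smul_eq_mul, Finset.sum_add_distrib]
  have h1 : ∑ a, ∑ b, g x b a * H.inner x (D.toFun (e b) x v) (dualFrame H e' a x) =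
      ∑ b, H.inner x (D.toFun (e b) x v) (dualFrame H e b x) := by
    rw [Finset.sum_comm]
    exact Finset.sum_congr rfl fun b _ => hdual _ b
  rw [h1, add_sub_cancel_left, Matrix.trace]
  refine Finset.sum_congr rfl fun a _ => ?_
  rw [Matrix.diag_apply, Matrix.mul_apply]
  exact Finset.sum_congr rfl fun b _ => mul_comm _ _

end Frames

/-! ### The curvature of the determinant of a subbundle -/

section Curvature

variable {X : Type*} [TopologicalSpace X] [ChartedSpace ℂ X] [IsManifold 𝓘(ℂ) ω X]
  {F : Type*} [NormedAddCommGroup F] [NormedSpace ℂ F] [FiniteDimensional ℂ F]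
  {V : X → Type*} [∀ x, AddCommGroup (V x)] [∀ x, Module ℂ (V x)] [∀ x, TopologicalSpace (V x)]
  [TopologicalSpace (TotalSpace F V)] [FiberBundle F V] [VectorBundle ℂ F V]
  [ContMDiffVectorBundle ω F V 𝓘(ℂ)]
  {H : HermitianMetric F V} {D : Connection F V} {r : ℕ} {W : ∀ x, Submodule ℂ (V x)} {U : Set X}
  {e : Fin r → ∀ x, V x}

variable (H D e) in
/-- The second fundamental form of the span of the frame `e`: the component of `D_v e_a` orthogonal
to this span. -/
noncomputable def secondForm (a : Fin r) (x : X) (v : TangentSpace 𝓘(ℝ, ℂ) x) : V x :=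
  D.toFun (e a) x v - ∑ b, H.inner x (D.toFun (e a) x v) (dualFrame H e b x) • e b x

theorem inner_secondForm (he : IsHolomorphicFrame F W U e) {x : X} (hx : x ∈ U) (a : Fin r)
    (v : TangentSpace 𝓘(ℝ, ℂ) x) {w : V x} (hw : w ∈ W x) :
    H.inner x (secondForm H D e a x v) w = 0 :=
  he.inner_sub_eq_zero hx _ hw

theorem secondForm_eq_zero_iff (he : IsHolomorphicFrame F W U e) {x : X} (hx : x ∈ U) (a : Fin r)
    (v : TangentSpace 𝓘(ℝ, ℂ) x) : secondForm H D e a x v = 0 ↔ D.toFun (e a) x v ∈ W x := by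
  constructor
  · intro h
    rw [sub_eq_zero.1 h]
    exact Submodule.sum_mem _ fun b _ => Submodule.smul_mem _ _ (he.mem hx b)
  · intro h
    exact sub_eq_zero.2 (he.eq_sum hx h)

/-- The connection is complex linear on holomorphic sections. -/
theorem Connection.IsChern.toFun_mulI (hD : D.IsChern H) (hU : IsOpen U) {s : ∀ x, V x}
    (hs : HolomorphicSectionOn F s U) {x : X} (hx : x ∈ U) (v : TangentSpace 𝓘(ℝ, ℂ) x) :
    D.toFun s x (mulI v) = Complex.I • D.toFun s x v := by
  have h := hD.2 U hU s (hs.smooth hU) x hx v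
  rw [hs.dbar_eq_zero hU hx v, smul_eq_zero_iff_right (by norm_num)] at h
  have h2 := congrArg (fun u => Complex.I • u) h
  simp only [smul_add, smul_smul, Complex.I_mul_I, smul_zero, neg_smul, one_smul] at h2
  exact (sub_eq_zero.1 (by rwa [← sub_eq_add_neg] at h2)).symm

theorem secondForm_mulI (hD : D.IsChern H) (he : IsHolomorphicFrame F W U e) (hU : IsOpen U)
    {x : X} (hx : x ∈ U) (a : Fin r) (v : TangentSpace 𝓘(ℝ, ℂ) x) :
    secondForm H D e a x (mulI v) = Complex.I • secondForm H D e a x v := by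
  simp only [secondForm, hD.toFun_mulI hU (he.holomorphic a) hx v, map_smul, LinearMap.smul_apply,
    smul_sub, Finset.smul_sum, smul_smul, smul_eq_mul]

/-- Tangentially to the subbundle, the dual frame is differentiated by the negative of the
connection matrix, as its products with the frame are constant. -/
theorem inner_frame_deriv_dualFrame (hD : D.IsUnitary H) (he : IsHolomorphicFrame F W U e)
    (hU : IsOpen U) {x : X} (hx : x ∈ U) (a b : Fin r) (v : TangentSpace 𝓘(ℝ, ℂ) x) :
    H.inner x (e b x) (D.toFun (dualFrame H e a) x v) =
      - H.inner x (D.toFun (e b) x v) (dualFrame H e a x) := by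
  have h := hD U hU _ _ (he.smooth hU b) (he.smooth_dualFrame (H := H) hU a) x hx v
  have h1 : (fun y => H.inner y (e b y) (dualFrame H e a y)) =ᶠ[𝓝 x]
      fun _ => if b = a then 1 else 0 := by
    filter_upwards [hU.mem_nhds hx] with y hy
    exact he.inner_dualFrame hy a b
  rw [mvfderiv_congr h1, mvfderiv_const_complex] at h
  exact eq_neg_of_add_eq_zero_right h.symm

/-- Orthogonally to the subbundle, the dual frame is differentiated through the second fundamental
form. -/
theorem inner_secondForm_deriv_dualFrame (he : IsHolomorphicFrame F W U e)
    (hU : IsOpen U) {x : X} (hx : x ∈ U) (a : Fin r) {u : V x}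
    (hu : ∀ w ∈ W x, H.inner x u w = 0) (v : TangentSpace 𝓘(ℝ, ℂ) x) :
    H.inner x u (D.toFun (dualFrame H e a) x v) =
      ∑ c, H.inner x (dualFrame H e c x) (dualFrame H e a x) *
        H.inner x u (secondForm H D e c x v) := by
  have hm : ∀ c, ContMDiffOn 𝓘(ℝ, ℂ) 𝓘(ℝ, ℂ) ∞
      (fun y => H.inner y (dualFrame H e a y) (dualFrame H e c y)) U := fun c =>
    H.smooth U hU _ _ (he.smooth_dualFrame hU a) (he.smooth_dualFrame hU c)
  have hs := fun c => he.smooth hU c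
  rw [D.congr hU (SmoothSectionOn.sum_smul hU hm hs)
    (fun y hy => he.eq_sum (H := H) hy (he.dualFrame_mem hy a)) hx v,
    D.map_sum_smul hU hm hs hx v, map_sum]
  refine Finset.sum_congr rfl fun c _ => ?_
  rw [map_add, LinearMap.map_smulₛₗ, LinearMap.map_smulₛₗ, hu _ (he.mem hx c), smul_zero, add_zero,
    ← H.conj_symm, smul_eq_mul, secondForm, map_sub,
    hu (∑ b, _) (Submodule.sum_mem _ fun b _ => Submodule.smul_mem _ _ (he.mem hx b)), sub_zero]

theorem sum_inner_deriv_dualFrame (hD : D.IsUnitary H) (he : IsHolomorphicFrame F W U e)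
    (hU : IsOpen U) {x : X} (hx : x ∈ U) (v w : TangentSpace 𝓘(ℝ, ℂ) x) :
    ∑ a, H.inner x (D.toFun (e a) x w) (D.toFun (dualFrame H e a) x v) =
      ∑ a, ∑ c, H.inner x (dualFrame H e c x) (dualFrame H e a x) *
        H.inner x (secondForm H D e a x w) (secondForm H D e c x v) -
      ∑ a, ∑ b, H.inner x (D.toFun (e a) x w) (dualFrame H e b x) *
        H.inner x (D.toFun (e b) x v) (dualFrame H e a x) := by
  rw [← Finset.sum_sub_distrib]
  refine Finset.sum_congr rfl fun a _ => ?_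
  rw [← inner_secondForm_deriv_dualFrame he hU hx a (fun u hu => inner_secondForm he hx a w hu) v,
    secondForm, map_sub, map_sum, LinearMap.sub_apply, LinearMap.sum_apply]
  simp only [map_smul, LinearMap.smul_apply, smul_eq_mul, inner_frame_deriv_dualFrame hD he hU hx]
  simp

/-- The Gauss–Codazzi equation, traced: if the curvature of the ambient bundle is
`-2πi μ vol`, the curvature form of the determinant of a subbundle of rank `r` is `r μ vol` minus a
non-negative form, which vanishes only where the second fundamental form does. -/
theorem traceForm_d_apply (hD : D.IsChern H) (he : IsHolomorphicFrame F W U e)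
    (hU : IsOpen U) {μ : ℝ} {vol : DForm X 2}
    (hcurv : ∀ (U : Set X), IsOpen U → ∀ s : ∀ x, V x, SmoothSectionOn F s U →
      ∀ x ∈ U, ∀ v w : TangentSpace 𝓘(ℝ, ℂ) x,
        D.curvature s x v w = (-2 * Real.pi * Complex.I * μ * vol x ![v, w]) • s x)
    {x : X} (hx : x ∈ U) (v : TangentSpace 𝓘(ℝ, ℂ) x) :
    ∃ n : ℝ, 0 ≤ n ∧ (traceForm H D e).d x ![v, mulI v] =
        (r * μ : ℝ) * vol x ![v, mulI v] - (n : ℂ) ∧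
      (n = 0 ↔ ∀ a, D.toFun (e a) x v ∈ W x) := by
  have hfd := he.finiteDimensional hx
  obtain ⟨n, hn, hsum, hn0⟩ := hilbertSchmidt_nonneg (B := H.inner x) (H.conj_symm x) (H.pos x)
    (W x) (he.mem hx) (he.dualFrame_mem (H := H) hx) (fun a b => he.inner_dualFrame hx a b)
    (fun a => secondForm H D e a x v)
  -- the bracket of the second fundamental forms below is `2 i n`, and `(i / 2π) (2 i n) = -n / π`
  refine ⟨n / Real.pi, by positivity, ?_, ?_⟩
  swap
  · rw [div_eq_zero_iff, or_iff_left Real.pi_ne_zero, hn0]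
    exact forall_congr' fun a => secondForm_eq_zero_iff he hx a v
  have hxs := mem_chart_source ℂ x
  have ho := hU.inter (chartAt ℂ x).open_source
  -- the derivative of the connection form
  have hder : ∀ v w : TangentSpace 𝓘(ℝ, ℂ) x,
      mvfderiv 𝓘(ℝ, ℂ) (fun y => traceLin H D e y (coordField x w y)) x v =
        Complex.I / (2 * Real.pi) * ∑ a,
          (H.inner x (D.toFun (fun y => D.toFun (e a) y (coordField x w y)) x v)
            (dualFrame H e a x) +
          H.inner x (D.toFun (e a) x w) (D.toFun (dualFrame H e a) x v)) := by
    intro v w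
    have hs1 : ∀ a, SmoothSectionOn F (fun y => D.toFun (e a) y (coordField x w y))
        (U ∩ (chartAt ℂ x).source) := fun a => D.smooth U hU _ (he.smooth hU a) x w
    have hs2 : ∀ a, SmoothSectionOn F (dualFrame H e a) (U ∩ (chartAt ℂ x).source) := fun a =>
      (he.smooth_dualFrame hU a).mono inter_subset_left
    have hs3 : ∀ a, MDifferentiableAt 𝓘(ℝ, ℂ) 𝓘(ℝ, ℂ) (fun y =>
        H.inner y (D.toFun (e a) y (coordField x w y)) (dualFrame H e a y)) x := fun a =>
      ContMDiffOn.mdifferentiableAt_real ho (H.smooth _ ho _ _ (hs1 a) (hs2 a)) ⟨hx, hxs⟩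
    have h1 := mvfderiv_sum_complex Finset.univ hs3 v
    have h2 := mvfderiv_mul_complex (f := fun _ => Complex.I / (2 * Real.pi : ℂ))
      (ContMDiffOn.mdifferentiableAt_real ho contMDiffOn_const ⟨hx, hxs⟩) h1.1 v
    refine h2.trans ?_
    rw [mvfderiv_const_complex, zero_mul, add_zero, h1.2]
    congr 1
    refine Finset.sum_congr rfl fun a _ => ?_
    refine (hD.1 _ ho _ _ (hs1 a) (hs2 a) x ⟨hx, hxs⟩ v).trans ?_
    rw [coordField_self]
  have hd := oneForm_d_apply hU (contMDiffOn_traceLin (H := H) (D := D) he hU) hx v (mulI v)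
  rw [hder, hder, ← mul_sub, Finset.sum_add_distrib, Finset.sum_add_distrib,
    sum_inner_deriv_dualFrame hD.1 he hU hx, sum_inner_deriv_dualFrame hD.1 he hU hx] at hd
  refine hd.trans ?_
  -- the terms quadratic in the connection matrix are symmetric, as in the trace of a commutator
  have hcomm : ∑ a, ∑ b, H.inner x (D.toFun (e a) x v) (dualFrame H e b x) *
        H.inner x (D.toFun (e b) x (mulI v)) (dualFrame H e a x) =
      ∑ a, ∑ b, H.inner x (D.toFun (e a) x (mulI v)) (dualFrame H e b x) *
        H.inner x (D.toFun (e b) x v) (dualFrame H e a x) := by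
    rw [Finset.sum_comm]
    exact Finset.sum_congr rfl fun a _ => Finset.sum_congr rfl fun b _ => mul_comm _ _
  have hc : ∑ a, H.inner x (D.toFun (fun y => D.toFun (e a) y (coordField x (mulI v) y)) x v)
        (dualFrame H e a x) -
      ∑ a, H.inner x (D.toFun (fun y => D.toFun (e a) y (coordField x v y)) x (mulI v))
        (dualFrame H e a x) =
      r * (-2 * Real.pi * Complex.I * μ * vol x ![v, mulI v]) := by
    rw [← Finset.sum_sub_distrib]
    have : ∀ a, H.inner x (D.toFun (fun y => D.toFun (e a) y (coordField x (mulI v) y)) x v)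
        (dualFrame H e a x) -
        H.inner x (D.toFun (fun y => D.toFun (e a) y (coordField x v y)) x (mulI v))
        (dualFrame H e a x) = -2 * Real.pi * Complex.I * μ * vol x ![v, mulI v] := by
      intro a
      rw [← LinearMap.sub_apply, ← map_sub]
      have h := hcurv U hU (e a) (he.smooth hU a) x hx v (mulI v)
      change D.toFun (fun y => D.toFun (e a) y (coordField x (mulI v) y)) x v -
        D.toFun (fun y => D.toFun (e a) y (coordField x v y)) x (mulI v) = _ at h
      rw [h, map_smul, LinearMap.smul_apply, he.inner_dualFrame hx]
      simp
    rw [Finset.sum_congr rfl fun a _ => this a]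
    simp
  have hb1 : ∑ a, ∑ c, H.inner x (dualFrame H e c x) (dualFrame H e a x) *
      H.inner x (secondForm H D e a x (mulI v)) (secondForm H D e c x v) = Complex.I * n := by
    rw [← hsum, Finset.mul_sum]
    refine Finset.sum_congr rfl fun a _ => ?_
    rw [Finset.mul_sum]
    refine Finset.sum_congr rfl fun c _ => ?_
    rw [secondForm_mulI hD he hU hx, map_smul, LinearMap.smul_apply, smul_eq_mul]
    ring
  have hb2 : ∑ a, ∑ c, H.inner x (dualFrame H e c x) (dualFrame H e a x) *
      H.inner x (secondForm H D e a x v) (secondForm H D e c x (mulI v)) = - Complex.I * n := by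
    rw [← hsum, Finset.mul_sum]
    refine Finset.sum_congr rfl fun a _ => ?_
    rw [Finset.mul_sum]
    refine Finset.sum_congr rfl fun c _ => ?_
    rw [secondForm_mulI hD he hU hx, LinearMap.map_smulₛₗ, smul_eq_mul, Complex.conj_I]
    ring
  rw [hb1, hb2, hcomm]
  set A := ∑ a, H.inner x (D.toFun (fun y => D.toFun (e a) y (coordField x (mulI v) y)) x v)
        (dualFrame H e a x)
  set B := ∑ a, H.inner x (D.toFun (fun y => D.toFun (e a) y (coordField x v y)) x (mulI v))
        (dualFrame H e a x)
  have hpi : (Real.pi : ℂ) ≠ 0 := Complex.ofReal_ne_zero.2 Real.pi_ne_zero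
  generalize (∑ a, ∑ b, H.inner x (D.toFun (e a) x (mulI v)) (dualFrame H e b x) *
        H.inner x (D.toFun (e b) x v) (dualFrame H e a x)) = Q
  have e1 : Complex.I / (2 * Real.pi : ℂ) * (A + (Complex.I * n - Q) - (B + (-Complex.I * n - Q))) =
      Complex.I / (2 * Real.pi : ℂ) * ((A - B) + 2 * Complex.I * n) := by ring
  refine e1.trans ?_
  rw [hc]
  push_cast
  field_simp
  ring_nf
  simp only [Complex.I_sq]
  ring

end Curvature

/-! ### Covers and logarithms -/

/-- A finite open cover of a compact Hausdorff space has a finite open refinement whose pairwise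
intersections satisfy a given local property of the pairwise intersections of the cover. -/
theorem exists_refinement_pairwise {X : Type*} [TopologicalSpace X] [CompactSpace X] [T2Space X]
    {ι : Type*} [Finite ι] {O : ι → Set X} (hO : ∀ a, IsOpen (O a)) (hcov : ⋃ a, O a = univ)
    {Q : ι → ι → Set X → Prop} (hmono : ∀ a b N N', N' ⊆ N → Q a b N → Q a b N')
    (hempty : ∀ a b, Q a b ∅)
    (hQ : ∀ a b, ∀ x ∈ O a ∩ O b, ∃ N, IsOpen N ∧ x ∈ N ∧ Q a b N) :
    ∃ (n : ℕ) (U : Fin n → Set X) (α : Fin n → ι), (∀ i, IsOpen (U i)) ∧ ⋃ i, U i = univ ∧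
      (∀ i, U i ⊆ O (α i)) ∧ ∀ i j, Q (α i) (α j) (U i ∩ U j) := by
  classical
  obtain ⟨C, hC, hCo, hCc⟩ := exists_iUnion_eq_closure_subset hO (fun x => Set.toFinite _) hcov
  have hα : ∀ x : X, ∃ a, x ∈ C a := fun x => mem_iUnion.1 (hC ▸ mem_univ x)
  choose α hα using hα
  -- near `x`, either the closures of `C a` and `C b` do not both come, or the property holds
  have hM : ∀ (x : X) (a b : ι), ∃ M, IsOpen M ∧ x ∈ M ∧
      ((M ∩ (closure (C a) ∩ closure (C b))).Nonempty → Q a b M) := by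
    intro x a b
    by_cases hx : x ∈ closure (C a) ∩ closure (C b)
    · obtain ⟨N, hN, hxN, hq⟩ := hQ a b x ⟨hCc a hx.1, hCc b hx.2⟩
      exact ⟨N, hN, hxN, fun _ => hq⟩
    · exact ⟨(closure (C a) ∩ closure (C b))ᶜ, (isClosed_closure.inter isClosed_closure).isOpen_compl,
        hx, fun ⟨y, hy⟩ => absurd hy.2 hy.1⟩
  choose M hMo hMx hMQ using hM
  let N : X → Set X := fun x => C (α x) ∩ ⋂ a, ⋂ b, M x a b
  have hNo : ∀ x, IsOpen (N x) := fun x =>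
    (hCo _).inter (isOpen_iInter_of_finite fun a => isOpen_iInter_of_finite fun b => hMo x a b)
  have hNx : ∀ x, x ∈ N x := fun x => ⟨hα x, mem_iInter.2 fun a => mem_iInter.2 fun b => hMx x a b⟩
  obtain ⟨t, ht⟩ := isCompact_univ.elim_nhds_subcover N fun x _ => (hNo x).mem_nhds (hNx x)
  refine ⟨t.card, fun i => N (t.equivFin.symm i), fun i => α (t.equivFin.symm i),
    fun i => hNo _, ?_, fun i => (inter_subset_left.trans subset_closure).trans (hCc _), ?_⟩
  · refine eq_univ_of_univ_subset (ht.2.trans fun x hx => ?_)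
    obtain ⟨y, hy, hxy⟩ := mem_iUnion₂.1 hx
    exact mem_iUnion.2 ⟨t.equivFin ⟨y, hy⟩, by simpa using hxy⟩
  · intro i j
    set x : X := (t.equivFin.symm i : X)
    set y : X := (t.equivFin.symm j : X)
    rcases (N x ∩ N y).eq_empty_or_nonempty with h | ⟨z, hz⟩
    · rw [h]; exact hempty _ _
    · have hsub : N x ⊆ M x (α x) (α y) := fun w hw =>
        mem_iInter.1 (mem_iInter.1 hw.2 (α x)) (α y)
      exact hmono _ _ _ _ (inter_subset_left.trans hsub) (hMQ x _ _
        ⟨z, hsub hz.1, subset_closure hz.1.1, subset_closure hz.2.1⟩)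

section

variable {X : Type*} [TopologicalSpace X] [ChartedSpace ℂ X] [IsManifold 𝓘(ℂ) ω X]

/-- A smooth function without zeros has smooth logarithms locally. -/
theorem exists_smooth_log {h : X → ℂ} {U : Set X} (hU : IsOpen U)
    (hh : ContMDiffOn 𝓘(ℝ, ℂ) 𝓘(ℝ, ℂ) ∞ h U) {x : X} (hx : x ∈ U) (h0 : h x ≠ 0) :
    ∃ (N : Set X) (l : X → ℂ), IsOpen N ∧ x ∈ N ∧ N ⊆ U ∧ ContMDiffOn 𝓘(ℝ, ℂ) 𝓘(ℝ, ℂ) ∞ l N ∧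
      ∀ y ∈ N, Complex.exp (l y) = h y := by
  have hS : IsOpen {z : ℂ | 0 < (z / h x).re} :=
    isOpen_lt continuous_const (Complex.continuous_re.comp (continuous_id.div_const _))
  refine ⟨U ∩ h ⁻¹' {z : ℂ | 0 < (z / h x).re}, fun y => Complex.log (h y / h x) +
    Complex.log (h x), hh.continuousOn.isOpen_inter_preimage hU hS, ⟨hx, ?_⟩, inter_subset_left,
    ?_, ?_⟩
  · simp [h0]
  · intro y hy
    have h1 : ContDiffAt ℂ ∞ (fun z : ℂ => Complex.log (z / h x) + Complex.log (h x)) (h y) :=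
      (ContDiffAt.comp (h y) (Complex.contDiffAt_log (Or.inl hy.2))
        (contDiffAt_id.div_const (h x))).add contDiffAt_const
    exact ((h1.restrict_scalars ℝ).contMDiffAt.comp y
      (hh.contMDiffAt (hU.mem_nhds hy.1))).contMDiffWithinAt
  · intro y hy
    have h2 : h y ≠ 0 := by
      rintro h3
      have := hy.2
      simp [h3] at this
    rw [Complex.exp_add, Complex.exp_log (div_ne_zero h2 h0), Complex.exp_log h0,
      div_mul_cancel₀ _ h0]

theorem mvfderiv_const_mul {f : X → ℂ} {x : X} (c : ℂ)
    (hf : MDifferentiableAt 𝓘(ℝ, ℂ) 𝓘(ℝ, ℂ) f x) (v : TangentSpace 𝓘(ℝ, ℂ) x) :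
    mvfderiv 𝓘(ℝ, ℂ) (fun y => c * f y) x v = c * mvfderiv 𝓘(ℝ, ℂ) f x v := by
  refine (mvfderiv_mul_complex (f := fun _ => c) mdifferentiableAt_const hf v).trans ?_
  rw [mvfderiv_const_complex, zero_mul, add_zero]

theorem oneForm_ext {α β : DForm X 1} {x : X} (h : ∀ v : TangentSpace 𝓘(ℝ, ℂ) x,
    α x ![v] = β x ![v]) : α x = β x := by
  ext v
  have hv : v = ![v 0] := by
    ext i
    fin_cases i
    rfl
  rw [hv]
  exact h (v 0)

theorem DForm.SmoothOn.smul {n : ℕ} {α : DForm X n} {U : Set X} (c : ℂ) (hα : α.SmoothOn U) :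
    (c • α).SmoothOn U := fun p => (hα p).const_smul c

end

/-! ### The curvature form of a subbundle -/

section CurvatureForm

variable {X : Type*} [TopologicalSpace X] [ChartedSpace ℂ X] [IsManifold 𝓘(ℂ) ω X]
  {F : Type*} [NormedAddCommGroup F] [NormedSpace ℂ F] [FiniteDimensional ℂ F]
  {V : X → Type*} [∀ x, AddCommGroup (V x)] [∀ x, Module ℂ (V x)] [∀ x, TopologicalSpace (V x)]
  [TopologicalSpace (TotalSpace F V)] [FiberBundle F V] [VectorBundle ℂ F V]
  [ContMDiffVectorBundle ω F V 𝓘(ℂ)]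
  {H : HermitianMetric F V} {D : Connection F V} {r : ℕ} {W : ∀ x, Submodule ℂ (V x)}
  {U U' : Set X} {e e' : Fin r → ∀ x, V x}

variable (H e e') in
/-- The matrix that expresses the frame `e'` in the frame `e`. -/
noncomputable def frameChange (x : X) : Matrix (Fin r) (Fin r) ℂ :=
  Matrix.of fun b a => H.inner x (e' a x) (dualFrame H e b x)

theorem frameChange_spec (he : IsHolomorphicFrame F W U e) (he' : IsHolomorphicFrame F W U' e')
    {x : X} (hx : x ∈ U ∩ U') (a : Fin r) :
    e' a x = ∑ b, frameChange H e e' x b a • e b x :=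
  he.eq_sum hx.1 (he'.mem hx.2 a)

theorem contMDiffOn_frameChange_det (hU : IsOpen U) (hU' : IsOpen U')
    (he : IsHolomorphicFrame F W U e) (he' : IsHolomorphicFrame F W U' e') :
    ContMDiffOn 𝓘(ℝ, ℂ) 𝓘(ℝ, ℂ) ∞ (fun x => (frameChange H e e' x).det) (U ∩ U') :=
  contMDiffOn_matrix_det fun b a =>
    (he.mono inter_subset_left).smooth_inner_dualFrame (hU.inter hU')
      ((he'.smooth hU' a).mono inter_subset_right) b

theorem frameChange_mul {e'' : Fin r → ∀ x, V x} (he : IsHolomorphicFrame F W U e)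
    (he' : IsHolomorphicFrame F W U' e') {x : X} (hx : x ∈ U ∩ U') :
    frameChange H e'' e x * frameChange H e e' x = frameChange H e'' e' x := by
  ext c a
  rw [Matrix.mul_apply]
  have h := congrArg (fun u => H.inner x u (dualFrame H e'' c x))
    (frameChange_spec (H := H) he he' hx a)
  simp only [map_sum, LinearMap.sum_apply, map_smul, LinearMap.smul_apply, smul_eq_mul] at h
  exact (Finset.sum_congr rfl fun b _ => mul_comm _ _).trans h.symm

theorem frameChange_self (he : IsHolomorphicFrame F W U e) {x : X} (hx : x ∈ U) :
    frameChange H e e x = 1 := by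
  ext b a
  exact (he.inner_dualFrame hx b a).trans ((if_congr eq_comm rfl rfl).trans
    (Matrix.one_apply).symm)

theorem frameChange_det_ne_zero (he : IsHolomorphicFrame F W U e)
    (he' : IsHolomorphicFrame F W U' e') {x : X} (hx : x ∈ U ∩ U') :
    (frameChange H e e' x).det ≠ 0 :=
  Matrix.det_ne_zero_of_left_inverse
    ((frameChange_mul (e'' := e') he he' hx).trans (frameChange_self he' hx.2))

/-- The curvature of the determinant does not depend on the frame. -/
theorem traceForm_d_eq (hU : IsOpen U) (hU' : IsOpen U') (he : IsHolomorphicFrame F W U e)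
    (he' : IsHolomorphicFrame F W U' e') {x : X} (hx : x ∈ U ∩ U') :
    (traceForm H D e').d x = (traceForm H D e).d x := by
  obtain ⟨N, l, hN, hxN, hNU, hl, hexp⟩ := exists_smooth_log (hU.inter hU')
    (contMDiffOn_frameChange_det (H := H) hU hU' he he') hx (frameChange_det_ne_zero he he' hx)
  have heN := he.mono (hNU.trans inter_subset_left)
  have heN' := he'.mono (hNU.trans inter_subset_right)
  have hcl : ContMDiffOn 𝓘(ℝ, ℂ) 𝓘(ℝ, ℂ) ∞ (fun y => Complex.I / (2 * Real.pi) * l y) N :=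
    contMDiffOn_mul_complex contMDiffOn_const hl
  have h1 : ∀ y ∈ N, (traceForm H D e' - traceForm H D e) y =
      dFun (fun y => Complex.I / (2 * Real.pi) * l y) y := by
    intro y hy
    refine oneForm_ext fun v => ?_
    refine (traceForm_change hN heN heN' (fun z hz a => frameChange_spec heN heN' ⟨hz, hz⟩ a)
      hl hexp hy v).trans ?_
    exact (mvfderiv_const_mul _ (ContMDiffOn.mdifferentiableAt_real hN hl hy) v).symm
  have h2 := d_congr hN h1 hxN
  rw [d_dFun hN hcl hxN, d_sub hN (smoothOn_traceForm heN' hN) (smoothOn_traceForm heN hN) hxN] at h2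
  exact sub_eq_zero.1 h2

variable (H D) in
/-- `i / 2π` times the curvature of the determinant of a subbundle, for the connection induced by
the orthogonal projection, computed in any local holomorphic frame. -/
noncomputable def HolomorphicSubbundle.curvForm (W : HolomorphicSubbundle F V) : DForm X 2 :=
  fun x => (traceForm H D (W.exists_frame x).choose_spec.choose).d x

theorem HolomorphicSubbundle.curvForm_eq (W : HolomorphicSubbundle F V)
    {e : Fin W.rank → ∀ x, V x} (hU : IsOpen U) (he : IsHolomorphicFrame F W.fiber U e) {x : X}
    (hx : x ∈ U) : W.curvForm H D x = (traceForm H D e).d x := by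
  have h := (W.exists_frame x).choose_spec.choose_spec
  exact traceForm_d_eq hU h.1 he h.2.2 ⟨hx, h.2.1⟩

theorem HolomorphicSubbundle.smoothOn_curvForm (W : HolomorphicSubbundle F V) :
    (W.curvForm H D).SmoothOn univ := by
  refine DForm.SmoothOn.of_locally fun x _ => ?_
  obtain ⟨U, e, hU, hx, he⟩ := W.exists_frame x
  exact ⟨U, hU, hx, ((smoothOn_traceForm he hU).d hU).congr fun y hy => W.curvForm_eq hU he hy⟩

end CurvatureForm

/-! ### The degree as the integral of the curvature -/

section Degree

variable {X : Type*} [TopologicalSpace X] [ChartedSpace ℂ X] [IsManifold 𝓘(ℂ) ω X]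
  [T2Space X] [CompactSpace X]
  {F : Type*} [NormedAddCommGroup F] [NormedSpace ℂ F] [FiniteDimensional ℂ F]
  {V : X → Type*} [∀ x, AddCommGroup (V x)] [∀ x, Module ℂ (V x)] [∀ x, TopologicalSpace (V x)]
  [TopologicalSpace (TotalSpace F V)] [FiberBundle F V] [VectorBundle ℂ F V]
  [ContMDiffVectorBundle ω F V 𝓘(ℂ)]
  {H : HermitianMetric F V} {D : Connection F V}

/-- Over a compact Riemann surface, a subbundle has holomorphic frames on a finite open cover, such
that the determinants of the changes of frames have smooth logarithms. -/
theorem HolomorphicSubbundle.exists_frames (H : HermitianMetric F V)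
    (W : HolomorphicSubbundle F V) :
    ∃ (n : ℕ) (U : Fin n → Set X) (e : Fin n → Fin W.rank → ∀ x, V x)
      (l : Fin n → Fin n → X → ℂ), (∀ i, IsOpen (U i)) ∧ ⋃ i, U i = univ ∧
      (∀ i, IsHolomorphicFrame F W.fiber (U i) (e i)) ∧
      (∀ i j, ContMDiffOn 𝓘(ℝ, ℂ) 𝓘(ℝ, ℂ) ∞ (l i j) (U i ∩ U j)) ∧
      ∀ i j, ∀ x ∈ U i ∩ U j, Complex.exp (l i j x) = (frameChange H (e i) (e j) x).det := by
  classical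
  choose O e hO hxO he using W.exists_frame
  obtain ⟨t, ht⟩ := isCompact_univ.elim_nhds_subcover O fun x _ => (hO x).mem_nhds (hxO x)
  have hcov : ⋃ a : t, O a = univ := by
    refine eq_univ_of_univ_subset (ht.2.trans fun x hx => ?_)
    obtain ⟨y, hy, hxy⟩ := mem_iUnion₂.1 hx
    exact mem_iUnion.2 ⟨⟨y, hy⟩, hxy⟩
  obtain ⟨n, U, α, hU, hUc, hUO, hl⟩ := exists_refinement_pairwise (O := fun a : t => O a)
    (Q := fun a b N => ∃ l : X → ℂ, ContMDiffOn 𝓘(ℝ, ℂ) 𝓘(ℝ, ℂ) ∞ l N ∧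
      ∀ y ∈ N, Complex.exp (l y) = (frameChange H (e a) (e b) y).det)
    (fun a => hO a) hcov
    (fun a b N N' h ⟨l, h1, h2⟩ => ⟨l, h1.mono h, fun y hy => h2 y (h hy)⟩)
    (fun a b => ⟨fun _ => 0, contMDiffOn_const, fun y hy => absurd hy (notMem_empty y)⟩)
    (fun a b x hx => by
      obtain ⟨N, l, hN, hxN, -, h1, h2⟩ := exists_smooth_log ((hO a).inter (hO b))
        (contMDiffOn_frameChange_det (H := H) (hO a) (hO b) (he a) (he b)) hx
        (frameChange_det_ne_zero (he a) (he b) hx)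
      exact ⟨N, hN, hxN, l, h1, h2⟩)
  choose l hl1 hl2 using hl
  exact ⟨n, U, fun i => e (α i), l, hU, hUc, fun i => (he _).mono (hUO i), hl1, hl2⟩

/-- The integral of the curvature, if it is real, is a degree. -/
theorem HolomorphicSubbundle.hasDegree_of_integral (W : HolomorphicSubbundle F V) {d : ℝ}
    (hd : integral (W.curvForm H D) = d) : W.HasDegree d := by
  classical
  obtain ⟨n, U, e, l, hU, hUc, he, hl, hexp⟩ := W.exists_frames H
  have hpi : (Real.pi : ℂ) ≠ 0 := Complex.ofReal_ne_zero.2 Real.pi_ne_zero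
  have hg : ∀ i j, ∀ x ∈ U i ∩ U j, ∀ a,
      e j a x = ∑ b, frameChange H (e i) (e j) x b a • e i b x := fun i j x hx a =>
    frameChange_spec (he i) (he j) hx a
  -- the logarithms form a cocycle up to multiples of `2πi`
  have hc : ∀ i j k, ∀ x, ∃ m : ℤ, x ∈ U i ∩ U j ∩ U k →
      (m : ℂ) = Complex.I / (2 * Real.pi) * (l j k x - l i k x + l i j x) := by
    intro i j k x
    by_cases hx : x ∈ U i ∩ U j ∩ U k
    swap
    · exact ⟨0, fun h => absurd h hx⟩
    have h1 : Complex.exp (l j k x - l i k x + l i j x) = 1 := by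
      rw [Complex.exp_add, Complex.exp_sub, hexp j k x ⟨hx.1.2, hx.2⟩, hexp i k x ⟨hx.1.1, hx.2⟩,
        hexp i j x hx.1, ← frameChange_mul (e'' := e i) (he j) (he k) ⟨hx.1.2, hx.2⟩, Matrix.det_mul]
      have h2 := frameChange_det_ne_zero (H := H) (he j) (he k) ⟨hx.1.2, hx.2⟩
      have h3 := frameChange_det_ne_zero (H := H) (he i) (he j) hx.1
      field_simp
    obtain ⟨m, hm⟩ := Complex.exp_eq_one_iff.1 h1
    refine ⟨-m, fun _ => ?_⟩
    rw [hm]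
    push_cast
    field_simp
    rw [Complex.I_sq]
    ring
  choose c hc using hc
  refine ⟨n, U, c, hU, hUc, ⟨e, fun i j => frameChange H (e i) (e j), l, he, hg, hl, hexp,
    fun i j k x hx => hc i j k x hx⟩, fun i j x => Complex.I / (2 * Real.pi) * l i j x,
    fun i => traceForm H D (e i), W.curvForm H D,
    fun i j => contMDiffOn_mul_complex contMDiffOn_const (hl i j), ?_,
    fun i => smoothOn_traceForm (he i) (hU i), ?_, fun i x hx => W.curvForm_eq (hU i) (he i) hx, hd⟩
  · intro i j k x hx
    rw [hc i j k x hx]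
    ring
  · intro i j x hx v
    have ho := (hU i).inter (hU j)
    refine (traceForm_change ho ((he i).mono inter_subset_left) ((he j).mono inter_subset_right)
      (fun y hy a => hg i j y hy a) (hl i j) (hexp i j) hx v).trans ?_
    exact (mvfderiv_const_mul _ (ContMDiffOn.mdifferentiableAt_real ho (hl i j) hx) v).symm

/-- A cocycle of smooth functions is a coboundary. -/
theorem exists_cochain {n : ℕ} {U : Fin n → Set X} (hU : ∀ i, IsOpen (U i)) (hUc : ⋃ i, U i = univ)
    {h : Fin n → Fin n → X → ℂ}
    (hs : ∀ i j, ContMDiffOn 𝓘(ℝ, ℂ) 𝓘(ℝ, ℂ) ∞ (h i j) (U i ∩ U j))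
    (hc : ∀ i j k, ∀ x ∈ U i ∩ U j ∩ U k, h j k x - h i k x + h i j x = 0) :
    ∃ u : Fin n → X → ℂ, (∀ i, ContMDiffOn 𝓘(ℝ, ℂ) 𝓘(ℝ, ℂ) ∞ (u i) (U i)) ∧
      ∀ i j, ∀ x ∈ U i ∩ U j, u j x - u i x = h i j x := by
  obtain ⟨ψ, hψ⟩ := SmoothPartitionOfUnity.exists_isSubordinate 𝓘(ℝ, ℂ) isClosed_univ U hU hUc.ge
  have hψ0 : ∀ k x, x ∉ U k → ψ k x = 0 := fun k x hx => by
    by_contra hne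
    exact hx (hψ k (subset_tsupport _ hne))
  refine ⟨fun i x => ∑ k, (ψ k x : ℂ) * h k i x, fun i => ?_, fun i j x hx => ?_⟩
  · refine contMDiffOn_sum_complex _ fun k _ x hx => ?_
    by_cases hxk : x ∈ U k
    · have ho := (hU k).inter (hU i)
      have h1 : ContMDiffOn 𝓘(ℝ, ℂ) 𝓘(ℝ, ℂ) ∞ (fun x => (ψ k x : ℂ)) (U k ∩ U i) :=
        Complex.ofRealCLM.contDiff.contMDiff.comp_contMDiffOn ((ψ k).contMDiff.contMDiffOn)
      exact ((contMDiffOn_mul_complex h1 (hs k i)).contMDiffAt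
        (ho.mem_nhds ⟨hxk, hx⟩)).contMDiffWithinAt
    · have hxs : x ∉ tsupport (ψ k) := fun hh => hxk (hψ k hh)
      refine ContMDiffAt.contMDiffWithinAt ((contMDiffAt_const (c := (0 : ℂ))).congr_of_eventuallyEq ?_)
      filter_upwards [(isClosed_tsupport (ψ k)).isOpen_compl.mem_nhds hxs] with y hy
      have : ψ k y = 0 := by
        by_contra hne
        exact hy (subset_tsupport _ hne)
      rw [this, Complex.ofReal_zero, zero_mul]
  · have hsum : ∑ k, (ψ k x : ℂ) = 1 := by
      have := ψ.sum_eq_one (mem_univ x)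
      rw [finsum_eq_sum_of_fintype] at this
      exact_mod_cast this
    rw [← Finset.sum_sub_distrib]
    have h1 : ∀ k, (ψ k x : ℂ) * h k j x - (ψ k x : ℂ) * h k i x = (ψ k x : ℂ) * h i j x := by
      intro k
      by_cases hxk : x ∈ U k
      · have := hc k i j x ⟨⟨hxk, hx.1⟩, hx.2⟩
        rw [show h i j x = h k j x - h k i x from by linear_combination this]
        ring
      · rw [hψ0 k x hxk]
        simp
    rw [Finset.sum_congr rfl fun k _ => h1 k, ← Finset.sum_mul, hsum, one_mul]

/-- Every degree is the integral of the curvature. -/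
theorem HolomorphicSubbundle.HasDegree.integral_eq {W : HolomorphicSubbundle F V} {d : ℝ}
    (h : W.HasDegree d) : integral (W.curvForm H D) = d := by
  obtain ⟨n, U, c, hU, hUc, ⟨e, g, l, he, hg, hl, hexp, hcl⟩, f, A, Φ, hf, hcf, hA, hAf, hΦ, hd⟩ := h
  have hil : ∀ i j, ContMDiffOn 𝓘(ℝ, ℂ) 𝓘(ℝ, ℂ) ∞
      (fun x => -(Complex.I / (2 * Real.pi)) * l i j x) (U i ∩ U j) := fun i j =>
    contMDiffOn_mul_complex contMDiffOn_const (hl i j)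
  have ho : ∀ i j, IsOpen (U i ∩ U j) := fun i j => (hU i).inter (hU j)
  have hh : ∀ i j, ContMDiffOn 𝓘(ℝ, ℂ) 𝓘(ℝ, ℂ) ∞
      (fun x => f i j x + -(Complex.I / (2 * Real.pi)) * l i j x) (U i ∩ U j) := fun i j =>
    (hf i j).add (hil i j)
  -- both `f` and `i / 2π` times the logarithms have coboundary `c`, so their difference is a cocycle
  obtain ⟨u, hu, hui⟩ := exists_cochain hU hUc hh (fun i j k x hx => by
    have h1 := hcf i j k x hx
    rw [hcl i j k x hx] at h1
    linear_combination h1)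
  -- the primitives of `Φ` and of the curvature differ by a global form
  let Bl : Fin n → DForm X 1 := fun i => A i - traceForm H D (e i) - dFun (u i)
  have hBls : ∀ i, (Bl i).SmoothOn (U i) := fun i =>
    ((hA i).sub (smoothOn_traceForm (he i) (hU i))).sub (smoothOn_dFun (hU i) (hu i))
  have hBl : ∀ i j, ∀ x ∈ U i ∩ U j, Bl j x = Bl i x := by
    intro i j x hx
    refine oneForm_ext fun v => ?_
    have h1 := hAf i j x hx v
    have h2 := traceForm_change (H := H) (D := D) (ho i j) ((he i).mono inter_subset_left)
      ((he j).mono inter_subset_right) (hg i j) (hl i j) (hexp i j) hx v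
    have hfm := ContMDiffOn.mdifferentiableAt_real (ho i j) (hf i j) hx
    have hlm := ContMDiffOn.mdifferentiableAt_real (ho i j) (hl i j) hx
    have hilm := ContMDiffOn.mdifferentiableAt_real (ho i j) (hil i j) hx
    have huim := ContMDiffOn.mdifferentiableAt_real (hU i) (hu i) hx.1
    have hhm := ContMDiffOn.mdifferentiableAt_real (ho i j) (hh i j) hx
    have h3 : mvfderiv 𝓘(ℝ, ℂ) (u j) x v = mvfderiv 𝓘(ℝ, ℂ) (u i) x v +
        (mvfderiv 𝓘(ℝ, ℂ) (f i j) x v +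
          -(Complex.I / (2 * Real.pi)) * mvfderiv 𝓘(ℝ, ℂ) (l i j) x v) := by
      rw [← mvfderiv_const_mul _ hlm, ← mvfderiv_add_complex hfm hilm,
        ← mvfderiv_add_complex huim hhm]
      refine DFunLike.congr_fun (mvfderiv_congr ?_) v
      filter_upwards [(ho i j).mem_nhds hx] with y hy
      linear_combination hui i j y hy
    change A j x ![v] - traceForm H D (e j) x ![v] - mvfderiv 𝓘(ℝ, ℂ) (u j) x v =
      A i x ![v] - traceForm H D (e i) x ![v] - mvfderiv 𝓘(ℝ, ℂ) (u i) x v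
    linear_combination h1 - h2 - h3
  have hcov : ∀ x : X, ∃ i, x ∈ U i := fun x => mem_iUnion.1 (hUc ▸ mem_univ x)
  choose ι hι using hcov
  let B : DForm X 1 := fun x => Bl (ι x) x
  have hB : ∀ i, ∀ x ∈ U i, B x = Bl i x := fun i x hx => hBl i (ι x) x ⟨hx, hι x⟩
  have hBs : B.SmoothOn univ := DForm.SmoothOn.of_locally fun x _ =>
    ⟨U (ι x), hU _, hι x, (hBls _).congr (hB _)⟩
  have hΦs : Φ.SmoothOn univ := DForm.SmoothOn.of_locally fun x _ =>
    ⟨U (ι x), hU _, hι x, ((hA _).d (hU _)).congr (hΦ _)⟩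
  have hdiff : Φ - W.curvForm H D = B.d := by
    funext x
    have hx := hι x
    have hi := hU (ι x)
    rw [d_congr hi (hB (ι x)) hx, d_sub hi ((hA _).sub (smoothOn_traceForm (he _) hi))
      (smoothOn_dFun hi (hu _)) hx, d_dFun hi (hu _) hx,
      d_sub hi (hA _) (smoothOn_traceForm (he _) hi) hx, ← hΦ _ x hx, ← W.curvForm_eq hi (he _) hx]
    exact (sub_zero (G := ℂ [⋀^Fin 2]→L[ℝ] ℂ) _).symm
  have h1 := integral_sub hΦs (W.smoothOn_curvForm (H := H) (D := D))
  rw [hdiff, integral_d hBs, hd] at h1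
  exact (sub_eq_zero.1 h1.symm).symm

variable (D) in
/-- A subbundle is parallel if the connection preserves its smooth local sections. -/
def HolomorphicSubbundle.IsParallel (W : HolomorphicSubbundle F V) : Prop :=
  ∀ (U : Set X), IsOpen U → ∀ s : ∀ x, V x, SmoothSectionOn F s U → (∀ x ∈ U, s x ∈ W.fiber x) →
    ∀ x ∈ U, ∀ v : TangentSpace 𝓘(ℝ, ℂ) x, D.toFun s x v ∈ W.fiber x

theorem HolomorphicSubbundle.isParallel_iff (H : HermitianMetric F V)
    (W : HolomorphicSubbundle F V) : W.IsParallel D ↔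
      ∀ (U : Set X) (e : Fin W.rank → ∀ x, V x), IsOpen U → IsHolomorphicFrame F W.fiber U e →
        ∀ x ∈ U, ∀ a, ∀ v : TangentSpace 𝓘(ℝ, ℂ) x, D.toFun (e a) x v ∈ W.fiber x := by
  constructor
  · intro h U e hU he x hx a v
    exact h U hU _ (he.smooth hU a) (fun y hy => he.mem hy a) x hx v
  · intro h U hU s hs hsW x hx v
    obtain ⟨U', e, hU', hx', he⟩ := W.exists_frame x
    have ho := hU.inter hU'
    have hg : ∀ b, ContMDiffOn 𝓘(ℝ, ℂ) 𝓘(ℝ, ℂ) ∞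
        (fun y => H.inner y (s y) (dualFrame H e b y)) (U ∩ U') := fun b =>
      (he.mono inter_subset_right).smooth_inner_dualFrame ho (hs.mono inter_subset_left) b
    have hes : ∀ b, SmoothSectionOn F (e b) (U ∩ U') := fun b =>
      (he.smooth hU' b).mono inter_subset_right
    rw [D.congr ho (SmoothSectionOn.sum_smul ho hg hes)
      (fun y hy => he.eq_sum (H := H) hy.2 (hsW y hy.1)) ⟨hx, hx'⟩ v,
      D.map_sum_smul ho hg hes ⟨hx, hx'⟩ v]
    exact Submodule.sum_mem _ fun b _ => Submodule.add_mem _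
      (Submodule.smul_mem _ _ (h U' e hU' he x hx' b v)) (Submodule.smul_mem _ _ (he.mem hx' b))

/-- If the curvature of the ambient bundle is `-2πi μ vol`, every holomorphic subbundle has slope at
most `μ`, with equality exactly for parallel subbundles. -/
theorem HolomorphicSubbundle.degree_eq (hD : D.IsChern H) {μ : ℝ} {vol : DForm X 2}
    (hvol : IsUnitVolumeForm vol)
    (hcurv : ∀ (U : Set X), IsOpen U → ∀ s : ∀ x, V x, SmoothSectionOn F s U →
      ∀ x ∈ U, ∀ v w : TangentSpace 𝓘(ℝ, ℂ) x,
        D.curvature s x v w = (-2 * Real.pi * Complex.I * μ * vol x ![v, w]) • s x)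
    (W : HolomorphicSubbundle F V) :
    W.degree ≤ W.rank * μ ∧ (W.degree = W.rank * μ ↔ W.IsParallel D) := by
  let κ : DForm X 2 := ((W.rank * μ : ℝ) : ℂ) • vol - W.curvForm H D
  have hvs : (((W.rank * μ : ℝ) : ℂ) • vol).SmoothOn univ := hvol.smooth.smul _
  have hΦs := W.smoothOn_curvForm (H := H) (D := D)
  have hκs : κ.SmoothOn univ := hvs.sub hΦs
  have hint : integral κ = ((W.rank * μ : ℝ) : ℂ) - integral (W.curvForm H D) := by
    rw [integral_sub hvs hΦs, integral_smul, hvol.integral_eq_one, mul_one]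
  -- the values of `κ` are square norms of second fundamental forms
  have hκ : ∀ (U : Set X) (e : Fin W.rank → ∀ x, V x), IsOpen U → IsHolomorphicFrame F W.fiber U e →
      ∀ x ∈ U, ∀ v : TangentSpace 𝓘(ℝ, ℂ) x, ∃ t : ℝ, 0 ≤ t ∧ κ x ![v, mulI v] = t ∧
        (t = 0 ↔ ∀ a, D.toFun (e a) x v ∈ W.fiber x) := by
    intro U e hU he x hx v
    obtain ⟨t, ht, h1, h2⟩ := traceForm_d_apply hD he hU hcurv hx v
    refine ⟨t, ht, ?_, h2⟩
    rw [← W.curvForm_eq hU he hx] at h1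
    change ((W.rank * μ : ℝ) : ℂ) * vol x ![v, mulI v] - W.curvForm H D x ![v, mulI v] = t
    rw [h1]
    ring
  have hκ' : ∀ (x : X) (v : TangentSpace 𝓘(ℝ, ℂ) x), ∃ t : ℝ, 0 ≤ t ∧ κ x ![v, mulI v] = t := by
    intro x v
    obtain ⟨U, e, hU, hx, he⟩ := W.exists_frame x
    obtain ⟨t, ht, h1, -⟩ := hκ U e hU he x hx v
    exact ⟨t, ht, h1⟩
  obtain ⟨T, hT, hT1, hT0⟩ := integral_nonneg hκs hκ'
  have hΦ : integral (W.curvForm H D) = ((W.rank * μ - T : ℝ) : ℂ) := by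
    rw [hT1] at hint
    push_cast at hint ⊢
    linear_combination hint
  have hex : ∃ d, W.HasDegree d := ⟨_, W.hasDegree_of_integral hΦ⟩
  have hdeg : W.degree = W.rank * μ - T := by
    rw [HolomorphicSubbundle.degree, dif_pos hex]
    have := hex.choose_spec.integral_eq (H := H) (D := D)
    rw [hΦ] at this
    exact_mod_cast this.symm
  refine ⟨by rw [hdeg]; linarith, ?_⟩
  have hT2 : W.degree = W.rank * μ ↔ T = 0 := by
    rw [hdeg]
    constructor <;> intro h <;> linarith
  rw [hT2, W.isParallel_iff H]
  constructor
  · intro h U e hU he x hx a v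
    obtain ⟨t, -, h1, h2⟩ := hκ U e hU he x hx v
    refine h2.1 ?_ a
    rw [hT0 h] at h1
    exact Complex.ofReal_eq_zero.1 h1.symm
  · intro h
    -- both `κ` and its opposite are non-negative
    have hneg : ∀ (x : X) (v : TangentSpace 𝓘(ℝ, ℂ) x), ∃ t : ℝ, 0 ≤ t ∧
        ((-1 : ℂ) • κ) x ![v, mulI v] = t := by
      intro x v
      obtain ⟨U, e, hU, hx, he⟩ := W.exists_frame x
      obtain ⟨t, -, h1, h2⟩ := hκ U e hU he x hx v
      refine ⟨0, le_rfl, ?_⟩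
      change (-1 : ℂ) * κ x ![v, mulI v] = _
      rw [h1, h2.2 fun a => h U e hU he x hx a v]
      simp
    obtain ⟨T', hT', hT1', -⟩ := integral_nonneg (hκs.smul (-1)) hneg
    rw [integral_smul, hT1] at hT1'
    have : -T = T' := by
      have h3 : ((-T : ℝ) : ℂ) = T' := by
        push_cast
        linear_combination hT1'
      exact_mod_cast h3
    linarith

end Degree

/-! ### Orthogonal complements of parallel subbundles -/

section Splitting

variable {X : Type*} [TopologicalSpace X] [ChartedSpace ℂ X]
  {F : Type*} [NormedAddCommGroup F] [NormedSpace ℂ F]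
  {V : X → Type*} [∀ x, AddCommGroup (V x)] [∀ x, Module ℂ (V x)] [∀ x, TopologicalSpace (V x)]
  [TopologicalSpace (TotalSpace F V)] [FiberBundle F V]

/-- The orthogonal complement of a subspace of a fibre. -/
def HermitianMetric.orthogonal (H : HermitianMetric F V) {x : X} (S : Submodule ℂ (V x)) :
    Submodule ℂ (V x) where
  carrier := {u | ∀ w ∈ S, H.inner x u w = 0}
  add_mem' hu hv w hw := by rw [map_add, LinearMap.add_apply, hu w hw, hv w hw, add_zero]
  zero_mem' w _ := by rw [map_zero, LinearMap.zero_apply]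
  smul_mem' c u hu w hw := by rw [map_smul, LinearMap.smul_apply, hu w hw, smul_zero]

variable {H : HermitianMetric F V}

theorem HermitianMetric.eq_zero_of_mem_orthogonal {x : X} {S : Submodule ℂ (V x)} {u : V x}
    (h : u ∈ S) (h' : u ∈ H.orthogonal S) : u = 0 :=
  hermitian_self_eq_zero (H.pos x) (h' u h)

theorem HermitianMetric.sup_inf_orthogonal {x : X} {S T : Submodule ℂ (V x)}
    [FiniteDimensional ℂ S] (h : S ≤ T) : S ⊔ (T ⊓ H.orthogonal S) = T := by
  refine le_antisymm (sup_le h inf_le_left) fun u hu => ?_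
  obtain ⟨p, hp, hpo⟩ := exists_orthogonal_decomposition (H.conj_symm x) (H.pos x) S u
  rw [← add_sub_cancel p u]
  exact Submodule.add_mem_sup hp ⟨T.sub_mem hu (h hp), hpo⟩

theorem HermitianMetric.finrank_inf_orthogonal {x : X} {S T : Submodule ℂ (V x)}
    [FiniteDimensional ℂ T] (h : S ≤ T) :
    Module.finrank ℂ (T ⊓ H.orthogonal S : Submodule ℂ (V x)) =
      Module.finrank ℂ T - Module.finrank ℂ S := by
  have : FiniteDimensional ℂ S := Submodule.finiteDimensional_of_le h
  have : FiniteDimensional ℂ (T ⊓ H.orthogonal S : Submodule ℂ (V x)) :=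
    Submodule.finiteDimensional_of_le inf_le_left
  have h1 := Submodule.finrank_sup_add_finrank_inf_eq S (T ⊓ H.orthogonal S)
  have h2 : S ⊓ (T ⊓ H.orthogonal S) = ⊥ :=
    (Submodule.eq_bot_iff _).2 fun u hu => H.eq_zero_of_mem_orthogonal hu.1 hu.2.2
  rw [H.sup_inf_orthogonal h, h2, finrank_bot] at h1
  omega

variable [IsManifold 𝓘(ℂ) ω X] [FiniteDimensional ℂ F] [VectorBundle ℂ F V]
  [ContMDiffVectorBundle ω F V 𝓘(ℂ)] {D : Connection F V}

theorem HolomorphicSubbundle.finiteDimensional_fiber (W : HolomorphicSubbundle F V) (x : X) :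
    FiniteDimensional ℂ (W.fiber x) := by
  obtain ⟨U, e, -, hx, he⟩ := W.exists_frame x
  exact he.finiteDimensional hx

theorem HolomorphicSubbundle.finrank_fiber (W : HolomorphicSubbundle F V) (x : X) :
    Module.finrank ℂ (W.fiber x) = W.rank := by
  obtain ⟨U, e, -, hx, he⟩ := W.exists_frame x
  exact he.finrank hx

/-- A unitary connection preserves the orthogonal complement of a parallel subbundle. -/
theorem HolomorphicSubbundle.IsParallel.mem_orthogonal (hD : D.IsUnitary H)
    {W : HolomorphicSubbundle F V} (hW : W.IsParallel D) {U : Set X} (hU : IsOpen U)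
    {s : ∀ x, V x} (hs : SmoothSectionOn F s U) (hsW : ∀ x ∈ U, s x ∈ H.orthogonal (W.fiber x))
    {x : X} (hx : x ∈ U) (v : TangentSpace 𝓘(ℝ, ℂ) x) :
    D.toFun s x v ∈ H.orthogonal (W.fiber x) := by
  intro w hw
  obtain ⟨U', e, hU', hx', he⟩ := W.exists_frame x
  have ho := hU.inter hU'
  refine he.inner_eq_zero hx' (fun b => ?_) hw
  have hes := (he.smooth hU' b)
  have h := hD _ ho s (e b) (hs.mono inter_subset_left) (hes.mono inter_subset_right)
    x ⟨hx, hx'⟩ v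
  have h1 : (fun y => H.inner y (s y) (e b y)) =ᶠ[𝓝 x] fun _ => 0 := by
    filter_upwards [ho.mem_nhds ⟨hx, hx'⟩] with y hy
    exact hsW y hy.1 _ (he.mem hy.2 b)
  rw [mvfderiv_congr h1, mvfderiv_const_complex,
    hsW x hx _ (hW U' hU' _ hes (fun y hy => he.mem hy b) x hx' v), add_zero] at h
  exact h.symm

/-- The component of a holomorphic section orthogonal to a parallel subbundle is holomorphic. -/
theorem HolomorphicSubbundle.IsParallel.holomorphic_sub (hD : D.IsChern H)
    {W : HolomorphicSubbundle F V} (hW : W.IsParallel D) {U : Set X} (hU : IsOpen U)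
    {e : Fin W.rank → ∀ x, V x} (he : IsHolomorphicFrame F W.fiber U e) {s : ∀ x, V x}
    (hs : HolomorphicSectionOn F s U) :
    HolomorphicSectionOn F
      (fun x => s x - ∑ b, H.inner x (s x) (dualFrame H e b x) • e b x) U := by
  have hss := hs.smooth hU
  have hg := fun b => he.smooth_inner_dualFrame (H := H) hU hss b
  have hes := fun b => he.smooth hU b
  have hps := SmoothSectionOn.sum_smul hU hg hes
  have hts := hss.sub hU hps
  refine holomorphicSectionOn_of_dbar hU hts fun x hx v => ?_
  -- the value of the Dolbeault operator is both in the subbundle and orthogonal to it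
  refine H.eq_zero_of_mem_orthogonal (S := W.fiber x) ?_ ?_
  · rw [← hD.2 U hU _ hts x hx v]
    have h1 : ∀ v, D.toFun (fun x => s x - ∑ b, H.inner x (s x) (dualFrame H e b x) • e b x) x v =
        D.toFun s x v - ∑ b, (H.inner x (s x) (dualFrame H e b x) • D.toFun (e b) x v +
          (mvfderiv 𝓘(ℝ, ℂ) (fun y => H.inner y (s y) (dualFrame H e b y)) x v : ℂ) • e b x) := by
      intro v
      rw [D.map_sub hU hss hps hx v, D.map_sum_smul hU hg hes hx v]
    have h2 : D.toFun s x v + Complex.I • D.toFun s x (mulI v) = 0 := by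
      rw [hD.toFun_mulI hU hs hx v, smul_smul, Complex.I_mul_I, neg_one_smul, add_neg_cancel]
    have h3 : ∀ v, ∑ b, (H.inner x (s x) (dualFrame H e b x) • D.toFun (e b) x v +
        (mvfderiv 𝓘(ℝ, ℂ) (fun y => H.inner y (s y) (dualFrame H e b y)) x v : ℂ) • e b x) ∈
          W.fiber x := fun v =>
      Submodule.sum_mem _ fun b _ => Submodule.add_mem _ (Submodule.smul_mem _ _
        (hW U hU _ (hes b) (fun y hy => he.mem hy b) x hx v)) (Submodule.smul_mem _ _ (he.mem hx b))
    rw [h1, h1, smul_sub, sub_add_sub_comm, h2, zero_sub]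
    exact Submodule.smul_mem _ _ (Submodule.neg_mem _ (Submodule.add_mem _ (h3 _)
      (Submodule.smul_mem _ _ (h3 _))))
  · rw [← hD.2 U hU _ hts x hx v]
    have h1 := fun v => hW.mem_orthogonal hD.1 hU hts
      (fun y hy w hw => he.inner_sub_eq_zero hy _ hw) hx v
    exact Submodule.smul_mem _ _ (Submodule.add_mem _ (h1 _) (Submodule.smul_mem _ _ (h1 _)))

/-- The orthogonal complement of a parallel subbundle in a holomorphic subbundle is holomorphic. -/
theorem HolomorphicSubbundle.exists_complement (hD : D.IsChern H)
    {W W' : HolomorphicSubbundle F V} (hle : ∀ x, W'.fiber x ≤ W.fiber x)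
    (hW' : W'.IsParallel D) :
    ∃ W'' : HolomorphicSubbundle F V, W''.rank = W.rank - W'.rank ∧
      ∀ x, W''.fiber x = W.fiber x ⊓ H.orthogonal (W'.fiber x) := by
  refine ⟨⟨fun x => W.fiber x ⊓ H.orthogonal (W'.fiber x), W.rank - W'.rank, fun x => ?_⟩,
    rfl, fun x => rfl⟩
  obtain ⟨U₁, e, hU₁, hx₁, he⟩ := W.exists_frame x
  obtain ⟨U₂, e', hU₂, hx₂, he'⟩ := W'.exists_frame x
  set U := U₁ ∩ U₂ with hUdef
  have hU : IsOpen U := hU₁.inter hU₂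
  have hx : x ∈ U := ⟨hx₁, hx₂⟩
  replace he := he.mono (inter_subset_left : U ⊆ U₁)
  replace he' := he'.mono (inter_subset_right : U ⊆ U₂)
  let s : Fin W.rank → ∀ x, V x := fun a x =>
    e a x - ∑ b, H.inner x (e a x) (dualFrame H e' b x) • e' b x
  have hs : ∀ a, HolomorphicSectionOn F (s a) U := fun a =>
    hW'.holomorphic_sub hD hU he' (he.holomorphic a)
  have hsmem : ∀ y ∈ U, ∀ a, s a y ∈ W.fiber y ⊓ H.orthogonal (W'.fiber y) := fun y hy a =>
    ⟨Submodule.sub_mem _ (he.mem hy a) (Submodule.sum_mem _ fun b _ =>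
      Submodule.smul_mem _ _ (hle y (he'.mem hy b))), fun w hw => he'.inner_sub_eq_zero hy _ hw⟩
  have hdim : ∀ y, Module.finrank ℂ (W.fiber y ⊓ H.orthogonal (W'.fiber y) : Submodule ℂ (V y)) =
      W.rank - W'.rank := fun y => by
    have := W.finiteDimensional_fiber y
    rw [H.finrank_inf_orthogonal (hle y), W.finrank_fiber, W'.finrank_fiber]
  have hspan : Submodule.span ℂ (range fun a => s a x) =
      W.fiber x ⊓ H.orthogonal (W'.fiber x) := by
    refine le_antisymm (Submodule.span_le.2 ?_) fun u hu => ?_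
    · rintro _ ⟨a, rfl⟩
      exact hsmem x hx a
    · have h1 := hu.1
      rw [← he.span_eq x hx] at h1
      obtain ⟨c, hc⟩ := (Submodule.mem_span_range_iff_exists_fun ℂ).1 h1
      refine (Submodule.mem_span_range_iff_exists_fun ℂ).2 ⟨c, ?_⟩
      -- the combination of the `s a` is the projection of `u`, which is `u`
      have h2 : ∑ a, c a • s a x =
          u - ∑ b, H.inner x u (dualFrame H e' b x) • e' b x := by
        simp only [s, smul_sub, Finset.sum_sub_distrib, hc]
        congr 1
        rw [← hc]
        simp only [map_sum, LinearMap.sum_apply, map_smul, LinearMap.smul_apply, smul_eq_mul,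
          Finset.smul_sum, smul_smul, Finset.sum_smul]
        exact Finset.sum_comm
      rw [h2, Finset.sum_eq_zero fun b _ => ?_, sub_zero]
      rw [hu.2 _ (he'.dualFrame_mem hx b), zero_smul]
  -- a basis among the `s a` at `x` is a frame wherever its Gram determinant does not vanish
  obtain ⟨κ, a, ha, hκs, hκi⟩ := exists_linearIndependent' ℂ (fun a => s a x)
  have : Finite κ := Finite.of_injective a ha
  have : Fintype κ := Fintype.ofFinite κ
  have hcard : Fintype.card κ = W.rank - W'.rank := by
    rw [← finrank_span_eq_card hκi, hκs, hspan, hdim]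
  let ε : Fin (W.rank - W'.rank) ≃ κ := (finCongr hcard.symm).trans (Fintype.equivFin κ).symm
  let t : Fin (W.rank - W'.rank) → ∀ x, V x := fun k => s (a (ε k))
  have hti : LinearIndependent ℂ fun k => t k x := hκi.comp ε ε.injective
  have hcont : ContinuousOn (fun y => (gram H t y).det) U :=
    (contMDiffOn_matrix_det (M := gram H t) fun j k => H.smooth U hU _ _
      ((hs _).smooth hU) ((hs _).smooth hU)).continuousOn
  refine ⟨U ∩ (fun y => (gram H t y).det) ⁻¹' {0}ᶜ, t,
    hcont.isOpen_inter_preimage hU isOpen_compl_singleton,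
    ⟨hx, (gram_det_ne_zero_iff_section t x).2 hti⟩,
    fun k => (hs _).mono inter_subset_left, fun y hy => (gram_det_ne_zero_iff_section t y).1 hy.2,
    fun y hy => ?_⟩
  have := W.finiteDimensional_fiber y
  have : FiniteDimensional ℂ (W.fiber y ⊓ H.orthogonal (W'.fiber y) : Submodule ℂ (V y)) :=
    Submodule.finiteDimensional_of_le inf_le_left
  refine Submodule.eq_of_le_of_finrank_eq (Submodule.span_le.2 ?_) ?_
  · rintro _ ⟨k, rfl⟩
    exact hsmem y hy.1 _
  · rw [hdim, finrank_span_eq_card ((gram_det_ne_zero_iff_section t y).1 hy.2), Fintype.card_fin]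

end Splitting

/-! ### Polystability -/

section Polystability

variable {X : Type*} [TopologicalSpace X] [ChartedSpace ℂ X] [IsManifold 𝓘(ℂ) ω X]
  [T2Space X] [CompactSpace X]
  {F : Type*} [NormedAddCommGroup F] [NormedSpace ℂ F] [FiniteDimensional ℂ F]
  {V : X → Type*} [∀ x, AddCommGroup (V x)] [∀ x, Module ℂ (V x)] [∀ x, TopologicalSpace (V x)]
  [TopologicalSpace (TotalSpace F V)] [FiberBundle F V] [VectorBundle ℂ F V]
  [ContMDiffVectorBundle ω F V 𝓘(ℂ)]
  {H : HermitianMetric F V} {D : Connection F V}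

/-- If slopes are at most `μ`, with equality exactly for parallel subbundles, then a parallel
subbundle is the orthogonal sum of parallel stable subbundles. -/
theorem HolomorphicSubbundle.IsParallel.exists_stable_decomposition (hD : D.IsChern H) {μ : ℝ}
    (hdeg : ∀ W : HolomorphicSubbundle F V,
      W.degree ≤ W.rank * μ ∧ (W.degree = W.rank * μ ↔ W.IsParallel D))
    [Nonempty X] (W : HolomorphicSubbundle F V) (hW : W.IsParallel D) :
    ∃ (ι : Type) (_ : Fintype ι) (S : ι → HolomorphicSubbundle F V),
      (∀ i, (S i).IsStable ∧ (S i).IsParallel D) ∧ (∀ x, ⨆ i, (S i).fiber x = W.fiber x) ∧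
      ∀ i j, i ≠ j → ∀ x, (S i).fiber x ≤ H.orthogonal ((S j).fiber x) := by
  induction hr : W.rank using Nat.strong_induction_on generalizing W with
  | _ r ih =>
  rcases Nat.eq_zero_or_pos r with h0 | hpos
  · refine ⟨Empty, inferInstance, fun i => i.elim, fun i => i.elim, fun x => ?_, fun i => i.elim⟩
    have := W.finiteDimensional_fiber x
    rw [iSup_of_empty, eq_comm, ← Submodule.finrank_eq_zero (R := ℂ), W.finrank_fiber, hr, h0]
  by_cases hst : W.IsStable
  · refine ⟨Unit, inferInstance, fun _ => W, fun _ => ⟨hst, hW⟩, fun x => ciSup_const,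
      fun i j hij => absurd (Subsingleton.elim i j) hij⟩
  have hslope : W.slope = μ := by
    have : (W.rank : ℝ) ≠ 0 := by
      rw [hr]; exact_mod_cast hpos.ne'
    rw [HolomorphicSubbundle.slope, (hdeg W).2.2 hW, mul_div_cancel_left₀ _ this]
  simp only [HolomorphicSubbundle.IsStable, hr, hpos, true_and, not_forall, not_lt] at hst
  obtain ⟨W', hle, hpos', hlt, hge⟩ := hst
  -- a destabilizing subbundle has slope exactly `μ`, so it is parallel
  have hW' : W'.IsParallel D := by
    refine (hdeg W').2.1 (le_antisymm (hdeg W').1 ?_)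
    rw [hslope, HolomorphicSubbundle.slope, le_div_iff₀ (by exact_mod_cast hpos')] at hge
    linarith
  obtain ⟨W'', hrank, hfib⟩ := HolomorphicSubbundle.exists_complement hD hle hW'
  have hW'' : W''.IsParallel D := by
    intro U hU s hs hsW x hx v
    rw [hfib]
    refine ⟨hW U hU s hs (fun y hy => ?_) x hx v,
      hW'.mem_orthogonal hD.1 hU hs (fun y hy => ?_) hx v⟩
    · have := hsW y hy
      rw [hfib] at this
      exact this.1
    · have := hsW y hy
      rw [hfib] at this
      exact this.2
  obtain ⟨ι₁, _, S₁, h₁, hsup₁, ho₁⟩ := ih W'.rank hlt W' hW' rfl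
  obtain ⟨ι₂, _, S₂, h₂, hsup₂, ho₂⟩ := ih W''.rank (by omega) W'' hW'' rfl
  have hle₁ : ∀ i x, (S₁ i).fiber x ≤ W'.fiber x := fun i x =>
    hsup₁ x ▸ le_iSup (fun i => (S₁ i).fiber x) i
  have hle₂ : ∀ i x, (S₂ i).fiber x ≤ H.orthogonal (W'.fiber x) := fun i x =>
    (hsup₂ x ▸ le_iSup (fun i => (S₂ i).fiber x) i : _ ≤ W''.fiber x).trans
      (hfib x ▸ inf_le_right)
  refine ⟨ι₁ ⊕ ι₂, inferInstance, Sum.elim S₁ S₂, ?_, fun x => ?_, ?_⟩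
  · rintro (i | i)
    exacts [h₁ i, h₂ i]
  · have := W'.finiteDimensional_fiber x
    rw [iSup_sum]
    simp only [Sum.elim_inl, Sum.elim_inr]
    rw [hsup₁, hsup₂, hfib, H.sup_inf_orthogonal (hle x)]
  · rintro (i | i) (j | j) hij x
    · exact ho₁ i j (fun h => hij (by rw [h])) x
    · intro u hu w hw
      simp only [Sum.elim_inl, Sum.elim_inr] at hu hw
      rw [H.conj_symm, hle₂ j x hw u (hle₁ i x hu), map_zero]
    · intro u hu w hw
      simp only [Sum.elim_inl, Sum.elim_inr] at hu hw
      exact hle₂ i x hu w (hle₁ j x hw)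
    · exact ho₂ i j (fun h => hij (by rw [h])) x

/-- Pairwise orthogonal subspaces are independent. -/
theorem HermitianMetric.iSupIndep_of_orthogonal {x : X} {ι : Type*} {S : ι → Submodule ℂ (V x)}
    (h : ∀ i j, i ≠ j → S i ≤ H.orthogonal (S j)) : iSupIndep S := by
  intro i
  rw [Submodule.disjoint_def]
  intro u hu hu'
  refine H.eq_zero_of_mem_orthogonal hu ?_
  exact (iSup₂_le fun j hj => h j i hj : _ ≤ H.orthogonal (S i)) hu'

end Polystability

end RiemannSurface

open RiemannSurface in
theorem proposition3p21
    {X : Type*} [TopologicalSpace X] [ChartedSpace ℂ X] [IsManifold 𝓘(ℂ) ω X]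
    [T2Space X] [CompactSpace X] [ConnectedSpace X]
    {F : Type*} [NormedAddCommGroup F] [NormedSpace ℂ F] [FiniteDimensional ℂ F] [Nontrivial F]
    {V : X → Type*} [∀ x, AddCommGroup (V x)] [∀ x, Module ℂ (V x)]
    [∀ x, TopologicalSpace (V x)] [TopologicalSpace (TotalSpace F V)]
    [FiberBundle F V] [VectorBundle ℂ F V] [ContMDiffVectorBundle ω F V 𝓘(ℂ)]
    (vol : DForm X 2) (hvol : IsUnitVolumeForm vol)
    (hE : ∃ H : HermitianMetric F V, H.IsHermitianEinstein vol) :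
    IsPolystable F V := by
  obtain ⟨H, D, hD, hcurv⟩ := hE
  have hdeg := HolomorphicSubbundle.degree_eq hD hvol hcurv
  have hpar : (HolomorphicSubbundle.whole F V).IsParallel D :=
    fun _ _ _ _ _ _ _ _ => Submodule.mem_top
  obtain ⟨ι, _, S, hS, hsup, hort⟩ := hpar.exists_stable_decomposition hD hdeg
  let ε := Fintype.equivFin ι
  refine Or.inr ⟨Fintype.card ι, fun i => S (ε.symm i), fun x => ?_, fun i => ⟨(hS _).1, ?_⟩⟩
  · rw [DirectSum.isInternal_submodule_iff_iSupIndep_and_iSup_eq_top]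
    refine ⟨H.iSupIndep_of_orthogonal fun i j hij =>
      hort _ _ (fun h => hij (ε.symm.injective h)) x, ?_⟩
    rw [ε.symm.iSup_comp (g := fun i => (S i).fiber x), hsup x]
    rfl
  · have hrank : ((S (ε.symm i)).rank : ℝ) ≠ 0 := by
      exact_mod_cast (hS (ε.symm i)).1.1.ne'
    rw [HolomorphicSubbundle.slope, (hdeg _).2.2 (hS _).2, mul_div_cancel_left₀ _ hrank]
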